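/- **Definitions.** A *quartic planar Eulerian orientation* is a connected planar map (a connected graph, loops and multiple edges allowed, embedded in the oriented sphere, considered up to orientation-preserving homeomorphism) in which every vertex has degree $4$, together with an orientation of its edges such that every vertex has in-degree $2$ and out-degree $2$. It is *rooted* if one of its (oriented) edges is distinguished. A vertex is *alternating* if the edges around it are, in cyclic order, out, in, out, in. Let $$Q(t,\gamma)=\sum_{n\ge 1}\sum_{k=0}^{n} q_{n,k}\,\gamma^k t^n ,$$ where $q_{n,k}$ is the number of rooted quartic planar Eulerian orientations with $n$ vertices, exactly $k$ of which are alternating. **Proposition.** Let $\omega$ be an indeterminate. There is a unique pair of series $W(t,\omega,x)\equiv W(x)$ and $H(t,\omega,x,y)\equiv H(x,y)$, belonging respectively to $\mathbb{Q}(\omega)[x][[t]]$ and $\mathbb{Q}(\omega)[x,y][[t]]$, that satisfies the equations $$W(x)=x^2t\,W(x)^2+\omega x t\,H(0,x)+\omega^{-1}x t\,H(x,0)+1,$$ $$H(x,y)=W(x)W(y)+\frac{\omega}{y}\bigl(H(x,y)-H(x,0)\bigr)+\frac{\omega^{-1}}{x}\bigl(H(x,y)-H(0,y)\bigr).$$ Moreover,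 for this pair, $$Q\left(t,\omega^2+\omega^{-2}\right)=H(0,0)-1=\frac{1}{t(\omega+\omega^{-1})}\,[x^1]W(x)-1,$$ where $[x^1]W(x)\in\mathbb{Q}(\omega)[[t]]$ denotes the coefficient of $x^1$ in $W(x)$. -/

import Mathlib

open Equiv

/-- The number of cycles of a permutation, fixed points included. -/
noncomputable def numCycles {D : Type} (f : Perm D) : ℕ :=
  Nat.card (Quotient (Perm.SameCycle.setoid f))

/-- A planar map (a connected graph embedded in the sphere, up to orientation preserving
homeomorphism) with set of half-edges `D`, as a combinatorial map of genus `0`.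
Vertices, edges and faces are the cycles of `rot`, `opp` and `rot * opp`. -/
structure PlanarMap (D : Type) where
  /-- the next half-edge in counterclockwise order around the same vertex -/
  rot : Perm D
  /-- the other half of the same edge -/
  opp : Perm D
  opp_opp : ∀ d, opp (opp d) = d
  opp_ne : ∀ d, opp d ≠ d
  connected : ∀ d e, ∃ g ∈ Subgroup.closure {rot, opp}, g d = e
  euler : numCycles rot + numCycles (rot * opp) = numCycles opp + 2

/-- Every vertex has degree `4`. -/
def PlanarMap.IsQuartic {D : Type} (M : PlanarMap D) : Prop :=
  ∀ d, {e | M.rot.SameCycle d e}.ncard = 4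

/-- `out` is an Eulerian orientation of the edges of `M`: `out d` tells whether the edge of `d`
leaves the vertex of `d` along `d`. Every edge leaves from exactly one of its two halves, and
every vertex has equal in- and out-degree. -/
structure PlanarMap.IsEulerianOrientation {D : Type} (M : PlanarMap D) (out : D → Bool) :
    Prop where
  out_opp : ∀ d, out (M.opp d) = !out d
  balanced : ∀ d, {e | M.rot.SameCycle d e ∧ out e = true}.ncard =
    {e | M.rot.SameCycle d e ∧ out e = false}.ncard

/-- A rooted quartic planar Eulerian orientation with set of half-edges `D`. The root edge carries
its canonical direction, hence it is given by its outgoing half. -/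
structure RootedQuarticOrientation (D : Type) extends PlanarMap D where
  out : D → Bool
  root : D
  quartic : toPlanarMap.IsQuartic
  eulerian : toPlanarMap.IsEulerianOrientation out
  root_out : out root = true

namespace RootedQuarticOrientation

/-- The number of alternating vertices, around which outgoing and incoming edges alternate. -/
noncomputable def numAlternating {D : Type} (M : RootedQuarticOrientation D) : ℕ :=
  Nat.card {v : Quotient (Perm.SameCycle.setoid M.rot) //
    ∀ d, Quotient.mk (Perm.SameCycle.setoid M.rot) d = v → M.out (M.rot d) ≠ M.out d}

/-- Isomorphism of rooted orientations: a relabelling of the half-edges. -/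
def Iso {D : Type} (M N : RootedQuarticOrientation D) : Prop :=
  ∃ f : Perm D, (∀ d, f (M.rot d) = N.rot (f d)) ∧ (∀ d, f (M.opp d) = N.opp (f d)) ∧
    (∀ d, N.out (f d) = M.out d) ∧ f M.root = N.root

/-- Isomorphism as an equivalence relation. -/
def isoSetoid (D : Type) : Setoid (RootedQuarticOrientation D) where
  r := Iso
  iseqv :=
    { refl := fun _ => ⟨1, fun _ => rfl, fun _ => rfl, fun _ => rfl, rfl⟩
      symm := by
        rintro M N ⟨f, h1, h2, h3, h4⟩
        refine ⟨f.symm, fun d => ?_, fun d => ?_, fun d => ?_, ?_⟩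
        · rw [Equiv.symm_apply_eq, h1, Equiv.apply_symm_apply]
        · rw [Equiv.symm_apply_eq, h2, Equiv.apply_symm_apply]
        · rw [← h3, Equiv.apply_symm_apply]
        · rw [Equiv.symm_apply_eq, h4]
      trans := by
        rintro M N P ⟨f, h1, h2, h3, h4⟩ ⟨g, k1, k2, k3, k4⟩
        exact ⟨f.trans g, fun d => by simp [h1, k1], fun d => by simp [h2, k2],
          fun d => by simp [h3, k3], by simp [h4, k4]⟩ }

/-- The number of rooted quartic planar Eulerian orientations, up to isomorphism, with `n` vertices
(hence `4 * n` half-edges), `k` of which are alternating. -/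
noncomputable def count (n k : ℕ) : ℕ :=
  Nat.card (Quotient ((isoSetoid (Fin (4 * n))).comap
    (Subtype.val : {M : RootedQuarticOrientation (Fin (4 * n)) // M.numAlternating = k} → _)))

end RootedQuarticOrientation

/-- The series `Q(t, γ)`: a power series in `t` with coefficients polynomial in `γ`. -/
noncomputable def Qseries : PowerSeries (Polynomial ℕ) :=
  PowerSeries.mk fun n => ∑ k ∈ Finset.range (n + 1),
    Polynomial.monomial k (RootedQuarticOrientation.count n k)

/-- The field `ℚ(ω)`. -/
abbrev Kω : Type := RatFunc ℚ

/-- The indeterminate `ω`. -/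
noncomputable def om : Kω := RatFunc.X

/-- The series `Q(t, γ)` at a value of `γ` in `ℚ(ω)`. -/
noncomputable def QseriesAt (g : Kω) : PowerSeries Kω :=
  Qseries.map (Polynomial.eval₂RingHom (Nat.castRingHom Kω) g)

/-- The ring `ℚ(ω)[x][[t]]`. -/
abbrev RingX : Type := PowerSeries (Polynomial Kω)

/-- The ring `ℚ(ω)[x, y][[t]]`, with `x` the variable `0` and `y` the variable `1`. -/
abbrev RingXY : Type := PowerSeries (MvPolynomial (Fin 2) Kω)

/-- The substitution `F(x) ↦ F(p)`. -/
noncomputable def substX {A : Type} [CommRing A] [Algebra Kω A] (F : RingX) (p : A) :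
    PowerSeries A :=
  F.map (Polynomial.aeval (R := Kω) p : Polynomial Kω →+* A)

/-- The substitution `F(x, y) ↦ F(p, q)`. -/
noncomputable def substXY {A : Type} [CommRing A] [Algebra Kω A] (F : RingXY) (p q : A) :
    PowerSeries A :=
  F.map (MvPolynomial.aeval (R := Kω) ![p, q] : MvPolynomial (Fin 2) Kω →+* A)

/-- The variable `x` of `ℚ(ω)[x, y]`. -/
noncomputable def vx : MvPolynomial (Fin 2) Kω := MvPolynomial.X 0

/-- The variable `y` of `ℚ(ω)[x, y]`. -/
noncomputable def vy : MvPolynomial (Fin 2) Kω := MvPolynomial.X 1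

/-- Coefficientwise division by the variable `i`; it is exact on multiples of that variable. -/
noncomputable def divVar (i : Fin 2) (F : RingXY) : RingXY :=
  PowerSeries.mk fun n => (F.coeff n).divMonomial (Finsupp.single i 1)

/-- The divided difference `(F(x, y) - F(0, y)) / x`. -/
noncomputable def divDiffX (F : RingXY) : RingXY := divVar 0 (F - substXY F 0 vy)

/-- The divided difference `(F(x, y) - F(x, 0)) / y`. -/
noncomputable def divDiffY (F : RingXY) : RingXY := divVar 1 (F - substXY F vx 0)

theorem divVar_C_mul (i : Fin 2) (F : RingXY) :
    divVar i (PowerSeries.C (MvPolynomial.X i) * F) = F := by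
  ext1 n
  simp [divVar, MvPolynomial.X_mul_divMonomial]

theorem exists_divDiffX (F : RingXY) :
    ∃ G : RingXY, F - substXY F 0 vy = PowerSeries.C vx * G := by
  have key : ∀ p : MvPolynomial (Fin 2) Kω,
      vx ∣ p - MvPolynomial.aeval (R := Kω) ![0, vy] p := by
    intro p
    induction p using MvPolynomial.induction_on with
    | C a => simp [MvPolynomial.algebraMap_eq]
    | add p q hp hq => rw [map_add, add_sub_add_comm]; exact dvd_add hp hq
    | mul_X p i hp =>
      fin_cases i
      · simp [vx]
      · simpa [vy, ← sub_mul] using Dvd.dvd.mul_right hp vy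
  choose g hg using key
  refine ⟨PowerSeries.mk fun n => g (F.coeff n), ?_⟩
  ext1 n
  simpa [substXY] using hg (F.coeff n)

theorem exists_divDiffY (F : RingXY) :
    ∃ G : RingXY, F - substXY F vx 0 = PowerSeries.C vy * G := by
  have key : ∀ p : MvPolynomial (Fin 2) Kω,
      vy ∣ p - MvPolynomial.aeval (R := Kω) ![vx, 0] p := by
    intro p
    induction p using MvPolynomial.induction_on with
    | C a => simp [MvPolynomial.algebraMap_eq]
    | add p q hp hq => rw [map_add, add_sub_add_comm]; exact dvd_add hp hq
    | mul_X p i hp =>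
      fin_cases i
      · simpa [vx, ← sub_mul] using Dvd.dvd.mul_right hp vx
      · simp [vy]
  choose g hg using key
  refine ⟨PowerSeries.mk fun n => g (F.coeff n), ?_⟩
  ext1 n
  simpa [substXY] using hg (F.coeff n)

/-- `divDiffX F` is the exact quotient. -/
theorem C_mul_divDiffX (F : RingXY) :
    PowerSeries.C vx * divDiffX F = F - substXY F 0 vy := by
  obtain ⟨G, hG⟩ := exists_divDiffX F
  rw [divDiffX, hG, vx, divVar_C_mul]

/-- `divDiffY F` is the exact quotient. -/
theorem C_mul_divDiffY (F : RingXY) :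
    PowerSeries.C vy * divDiffY F = F - substXY F vx 0 := by
  obtain ⟨G, hG⟩ := exists_divDiffY F
  rw [divDiffY, hG, vy, divVar_C_mul]

/-- A scalar of `ℚ(ω)`, as an element of `ℚ(ω)[x][[t]]`. -/
noncomputable def scX (c : Kω) : RingX := PowerSeries.C (Polynomial.C c)

/-- A scalar of `ℚ(ω)`, as an element of `ℚ(ω)[x, y][[t]]`. -/
noncomputable def scXY (c : Kω) : RingXY := PowerSeries.C (MvPolynomial.C c)

/-- The system of functional equations. In `ℚ(ω)[x][[t]]`, the variable `t` is `PowerSeries.X` and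
`x` is `PowerSeries.C Polynomial.X`. -/
structure IsSolution (W : RingX) (H : RingXY) : Prop where
  eqW : W = (PowerSeries.C Polynomial.X) ^ 2 * PowerSeries.X * W ^ 2
    + scX om * PowerSeries.C Polynomial.X * PowerSeries.X * substXY H 0 Polynomial.X
    + scX om⁻¹ * PowerSeries.C Polynomial.X * PowerSeries.X * substXY H Polynomial.X 0
    + 1
  eqH : H = substX W vx * substX W vy + scXY om * divDiffY H + scXY om⁻¹ * divDiffX H

/-- The coefficient `[x¹] F`, a power series in `t`. -/
noncomputable def coeffX1 (F : RingX) : PowerSeries Kω :=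
  PowerSeries.mk fun n => (F.coeff n).coeff 1

/-! The two equations encode a planar exploration. Replace each vertex of a quartic Eulerian
orientation by two disjoint arcs, each joining an ingoing half-edge to an adjacent outgoing one,
with a dashed edge between the two arcs. An alternating vertex can be split in two ways, any other
vertex in only one. Give an arc the weight `a = ω` or `b = ω⁻¹` according as its dashed end lies on
its left or on its right: an alternating vertex contributes `a ^ 2 + b ^ 2` in total, any other
vertex `a * b = 1` (`sum_local_splitting`, `sum_splitWeight`). Hence `Q` at `γ = ω² + ω⁻²` counts
weighted planar systems of oriented loops joined by dashed edges.

Such a system is a triple `(σ, τ, c)` on the set `E` of arcs: the next arc along the loop, the arc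
at the other end of the dashed edge, and the side of the dashed end. It is explored with a stack of
boundaries, which are lists of dashed ends still to be followed. The partner of the first end of the
top boundary lies either on the same boundary, which is then split in two; or on a loop not yet
seen, whose two sides become boundaries, one of them continued by the rest of the current boundary;
or on another boundary, which gets merged with the current one. Following an edge keeps the number
of faces, and an Euler count shows that each merge costs two faces (`Run.faceCount_eq`). A connected
system is therefore planar exactly when no merge occurs (`isExplored_iff`).

Explorations without merges obey a recursion. With one `t` per dashed edge, let `w k` count the ways
to fill a boundary with `k` ends, and `h i j` the ways to complete a loop under construction with
`i` pending ends on its right and `j` on its left. The first end of a boundary either splits it or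
discovers a loop, which gives the equation for `w (k + 1)`. A loop under construction either closes
up, with contribution `w i * w j`, or continues with an arc whose end is on the left (weight `a`) or
on the right (weight `b`), which gives the equation for `h i j`. These are the given equations read
on coefficients (`isSolution_iff`), and `openFormula` proves the interpretation by induction.
Starting from the root loop gives `a * h 0 1 + b * h 1 0 = h 0 0 - 1`.

All counting is done with labels: rooted maps have no automorphisms, so a class with `n` vertices
has `(4 * n)!` labellings of its half-edges, and arcs in turn carry `(2 * n)!` labellings. The
factors `U.card.factorial` come from there.

Existence and uniqueness hold because the coefficient of `t ^ n` in `w k` and `h i j` vanishes for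
`k > 2 * n` and `i + j > 2 * n`: the system is solved degree by degree in `t`, and for each degree
downwards in `i + j`. The expression with `[x¹] W` is the equation `w 1 = t (ω + ω⁻¹) h 0 0`. -/

/-! ### Coefficients in `x` and `y` -/

/-- The exponent of `x ^ i * y ^ j`. -/
noncomputable def expXY (i j : ℕ) : Fin 2 →₀ ℕ := Finsupp.single 0 i + Finsupp.single 1 j

@[simp] theorem expXY_zero (i j : ℕ) : expXY i j 0 = i := by simp [expXY]

@[simp] theorem expXY_one (i j : ℕ) : expXY i j 1 = j := by simp [expXY]

theorem eq_expXY_iff (s : Fin 2 →₀ ℕ) (i j : ℕ) : s = expXY i j ↔ s 0 = i ∧ s 1 = j := by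
  constructor
  · rintro rfl; simp
  · rintro ⟨h0, h1⟩
    ext a
    fin_cases a <;> simp [h0, h1]

/-- The coefficient of `x ^ k`, a power series in `t`. -/
noncomputable def coeffX (F : RingX) (k : ℕ) : PowerSeries Kω :=
  PowerSeries.mk fun n => (F.coeff n).coeff k

/-- The coefficient of `x ^ i * y ^ j`, a power series in `t`. -/
noncomputable def coeffXY (F : RingXY) (i j : ℕ) : PowerSeries Kω :=
  PowerSeries.mk fun n => (F.coeff n).coeff (expXY i j)

theorem ringX_ext {F G : RingX} (h : ∀ k, coeffX F k = coeffX G k) : F = G := by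
  ext n k
  simpa [coeffX] using congrArg (PowerSeries.coeff n) (h k)

theorem ringXY_ext {F G : RingXY} (h : ∀ i j, coeffXY F i j = coeffXY G i j) : F = G := by
  ext n s
  have := congrArg (PowerSeries.coeff n) (h (s 0) (s 1))
  have hs : s = expXY (s 0) (s 1) := (eq_expXY_iff _ _ _).2 ⟨rfl, rfl⟩
  rw [hs]
  simpa [coeffXY] using this

theorem coeffX_add (F G : RingX) (k : ℕ) : coeffX (F + G) k = coeffX F k + coeffX G k := by
  ext n; simp [coeffX]

theorem coeffX_one_zero : coeffX 1 0 = 1 := by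
  ext n; by_cases h : n = 0 <;> simp [coeffX, PowerSeries.coeff_one, h]

theorem coeffX_one_succ (k : ℕ) : coeffX 1 (k + 1) = 0 := by
  ext n; by_cases h : n = 0 <;> simp [coeffX, PowerSeries.coeff_one, h, Polynomial.coeff_one]

theorem coeffX_mul (F G : RingX) (k : ℕ) :
    coeffX (F * G) k = ∑ p ∈ Finset.HasAntidiagonal.antidiagonal k, coeffX F p.1 * coeffX G p.2 := by
  ext n
  simp only [coeffX, PowerSeries.coeff_mk, map_sum, PowerSeries.coeff_mul,
    Polynomial.finsetSum_coeff, Polynomial.coeff_mul]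
  exact Finset.sum_comm

theorem coeffX_x_mul_zero (F : RingX) : coeffX (PowerSeries.C Polynomial.X * F) 0 = 0 := by
  ext n; simp [coeffX]

theorem coeffX_x_mul_succ (F : RingX) (k : ℕ) :
    coeffX (PowerSeries.C Polynomial.X * F) (k + 1) = coeffX F k := by
  ext n; simp [coeffX, Polynomial.coeff_X_mul]

theorem coeffX_t_mul (F : RingX) (k : ℕ) :
    coeffX (PowerSeries.X * F) k = PowerSeries.X * coeffX F k := by
  ext n; cases n <;> simp [coeffX, PowerSeries.coeff_succ_X_mul]

theorem coeffX_scX_mul (a : Kω) (F : RingX) (k : ℕ) :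
    coeffX (scX a * F) k = PowerSeries.C a * coeffX F k := by
  ext n; simp [coeffX, scX]

theorem coeffXY_add (F G : RingXY) (i j : ℕ) :
    coeffXY (F + G) i j = coeffXY F i j + coeffXY G i j := by
  ext n; simp [coeffXY]

theorem coeffXY_scXY_mul (a : Kω) (F : RingXY) (i j : ℕ) :
    coeffXY (scXY a * F) i j = PowerSeries.C a * coeffXY F i j := by
  ext n; simp [coeffXY, scXY]

theorem coeff_aeval_zero_X (p : MvPolynomial (Fin 2) Kω) (k : ℕ) :
    (MvPolynomial.aeval (R := Kω) ![(0 : Polynomial Kω), Polynomial.X] p).coeff k =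
      p.coeff (expXY 0 k) := by
  induction p using MvPolynomial.induction_on' with
  | monomial s a =>
    rw [MvPolynomial.aeval_monomial, Finsupp.prod_fintype _ _ (fun i => pow_zero _),
      Fin.prod_univ_two, MvPolynomial.coeff_monomial]
    simp only [eq_expXY_iff, Polynomial.algebraMap_eq, Polynomial.coeff_C_mul]
    by_cases h0 : s 0 = 0
    · simp [h0, Polynomial.coeff_X_pow, eq_comm]
    · simp [h0]
  | add p q hp hq => simp [hp, hq]

theorem coeff_aeval_X_zero (p : MvPolynomial (Fin 2) Kω) (k : ℕ) :
    (MvPolynomial.aeval (R := Kω) ![Polynomial.X, (0 : Polynomial Kω)] p).coeff k =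
      p.coeff (expXY k 0) := by
  induction p using MvPolynomial.induction_on' with
  | monomial s a =>
    rw [MvPolynomial.aeval_monomial, Finsupp.prod_fintype _ _ (fun i => pow_zero _),
      Fin.prod_univ_two, MvPolynomial.coeff_monomial]
    simp only [eq_expXY_iff, Polynomial.algebraMap_eq, Polynomial.coeff_C_mul]
    by_cases h0 : s 1 = 0
    · simp [h0, Polynomial.coeff_X_pow, eq_comm]
    · simp [h0]
  | add p q hp hq => simp [hp, hq]

theorem aeval_zero_zero (p : MvPolynomial (Fin 2) Kω) :
    MvPolynomial.aeval (R := Kω) ![(0 : Kω), 0] p = p.coeff (expXY 0 0) := by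
  induction p using MvPolynomial.induction_on' with
  | monomial s a =>
    rw [MvPolynomial.aeval_monomial, Finsupp.prod_fintype _ _ (fun i => pow_zero _),
      Fin.prod_univ_two, MvPolynomial.coeff_monomial]
    simp only [eq_expXY_iff]
    by_cases h0 : s 0 = 0 <;> by_cases h1 : s 1 = 0 <;> simp [h0, h1]
  | add p q hp hq => rw [map_add, hp, hq, MvPolynomial.coeff_add]

theorem coeff_aeval_zero_vy (p : MvPolynomial (Fin 2) Kω) (i j : ℕ) :
    (MvPolynomial.aeval (R := Kω) ![0, vy] p).coeff (expXY (i + 1) j) = 0 := by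
  induction p using MvPolynomial.induction_on' with
  | monomial s a =>
    rw [MvPolynomial.aeval_monomial, Finsupp.prod_fintype _ _ (fun i => pow_zero _),
      Fin.prod_univ_two, MvPolynomial.algebraMap_eq, MvPolynomial.coeff_C_mul]
    by_cases h0 : s 0 = 0
    · simp only [Matrix.cons_val_zero, Matrix.cons_val_one, h0, pow_zero, one_mul, vy,
        MvPolynomial.coeff_X_pow]
      rw [if_neg, mul_zero]
      intro h
      simpa using DFunLike.congr_fun h 0
    · simp [h0]
  | add p q hp hq => rw [map_add, MvPolynomial.coeff_add, hp, hq, add_zero]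

theorem coeff_aeval_vx_zero (p : MvPolynomial (Fin 2) Kω) (i j : ℕ) :
    (MvPolynomial.aeval (R := Kω) ![vx, 0] p).coeff (expXY i (j + 1)) = 0 := by
  induction p using MvPolynomial.induction_on' with
  | monomial s a =>
    rw [MvPolynomial.aeval_monomial, Finsupp.prod_fintype _ _ (fun i => pow_zero _),
      Fin.prod_univ_two, MvPolynomial.algebraMap_eq, MvPolynomial.coeff_C_mul]
    by_cases h0 : s 1 = 0
    · simp only [Matrix.cons_val_zero, Matrix.cons_val_one, h0, pow_zero, mul_one, vx,
        MvPolynomial.coeff_X_pow]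
      rw [if_neg, mul_zero]
      intro h
      simpa using DFunLike.congr_fun h 1
    · simp [h0]
  | add p q hp hq => rw [map_add, MvPolynomial.coeff_add, hp, hq, add_zero]

theorem coeffX_substXY_zero_X (H : RingXY) (k : ℕ) :
    coeffX (substXY H 0 Polynomial.X) k = coeffXY H 0 k := by
  ext n; simp [coeffX, coeffXY, substXY, coeff_aeval_zero_X]

theorem coeffX_substXY_X_zero (H : RingXY) (k : ℕ) :
    coeffX (substXY H Polynomial.X 0) k = coeffXY H k 0 := by
  ext n; simp [coeffX, coeffXY, substXY, coeff_aeval_X_zero]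

theorem substXY_zero_zero (H : RingXY) : substXY H (0 : Kω) 0 = coeffXY H 0 0 := by
  ext n
  rw [substXY, PowerSeries.coeff_map, coeffXY, PowerSeries.coeff_mk]
  exact aeval_zero_zero _

theorem coeffXY_divDiffX (H : RingXY) (i j : ℕ) :
    coeffXY (divDiffX H) i j = coeffXY H (i + 1) j := by
  ext n
  have : Finsupp.single 0 1 + expXY i j = expXY (i + 1) j := by
    rw [eq_expXY_iff]; simp [add_comm]
  simpa [coeffXY, divDiffX, divVar, this, substXY] using coeff_aeval_zero_vy (H.coeff n) i j

theorem coeffXY_divDiffY (H : RingXY) (i j : ℕ) :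
    coeffXY (divDiffY H) i j = coeffXY H i (j + 1) := by
  ext n
  have : Finsupp.single 1 1 + expXY i j = expXY i (j + 1) := by
    rw [eq_expXY_iff]; simp [add_comm]
  simpa [coeffXY, divDiffY, divVar, this, substXY] using coeff_aeval_vx_zero (H.coeff n) i j

theorem coeff_aeval_vx_mul_aeval_vy (P Q : Polynomial Kω) (i j : ℕ) :
    (Polynomial.aeval (R := Kω) vx P * Polynomial.aeval (R := Kω) vy Q).coeff (expXY i j) =
      P.coeff i * Q.coeff j := by
  induction P using Polynomial.induction_on' with
  | add P P' h h' => rw [map_add, add_mul, MvPolynomial.coeff_add, h, h', Polynomial.coeff_add,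
      add_mul]
  | monomial k a =>
    induction Q using Polynomial.induction_on' with
    | add Q Q' h h' => rw [map_add, mul_add, MvPolynomial.coeff_add, h, h', Polynomial.coeff_add,
        mul_add]
    | monomial l b =>
      rw [Polynomial.aeval_monomial, Polynomial.aeval_monomial, MvPolynomial.algebraMap_eq, vx, vy,
        MvPolynomial.C_mul_X_pow_eq_monomial, MvPolynomial.C_mul_X_pow_eq_monomial,
        MvPolynomial.monomial_mul, MvPolynomial.coeff_monomial, Polynomial.coeff_monomial,
        Polynomial.coeff_monomial]
      change (if expXY k l = expXY i j then _ else _) = _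
      simp only [eq_expXY_iff, expXY_zero, expXY_one]
      by_cases h0 : k = i <;> by_cases h1 : l = j <;> simp [h0, h1]

theorem coeffXY_substX_mul_substX (F G : RingX) (i j : ℕ) :
    coeffXY (substX F vx * substX G vy) i j = coeffX F i * coeffX G j := by
  ext n
  simp [coeffXY, coeffX, substX, PowerSeries.coeff_mul, MvPolynomial.coeff_sum,
    coeff_aeval_vx_mul_aeval_vy]

/-! ### The system on coefficients -/

/-- The system of functional equations, read on the coefficients of the monomials in `x` and `y`. -/
structure IsCoeffSolution {K : Type*} [Field K] (a b : K) (w : ℕ → PowerSeries K)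
    (h : ℕ → ℕ → PowerSeries K) : Prop where
  w_zero : w 0 = 1
  w_succ : ∀ k, w (k + 1) = PowerSeries.X * (∑ i ∈ Finset.range k, w i * w (k - 1 - i) +
    PowerSeries.C a * h 0 k + PowerSeries.C b * h k 0)
  h_eq : ∀ i j, h i j = w i * w j + PowerSeries.C a * h i (j + 1) + PowerSeries.C b * h (i + 1) j
  -- This is what remains of polynomiality in `x` and `y`. Without it the linear recursion for `h`
  -- would have many solutions.
  h_finite : ∀ n, ∃ B, ∀ i j, B < i + j → (h i j).coeff n = 0

theorem coeffXY_finite (H : RingXY) (n : ℕ) :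
    ∃ B, ∀ i j, B < i + j → (coeffXY H i j).coeff n = 0 := by
  refine ⟨(H.coeff n).totalDegree, fun i j hij => ?_⟩
  rw [coeffXY, PowerSeries.coeff_mk]
  apply MvPolynomial.coeff_eq_zero_of_totalDegree_lt
  have : ∑ a ∈ (expXY i j).support, expXY i j a = ∑ a, expXY i j a :=
    Finset.sum_subset (Finset.subset_univ _) (by simp)
  rw [this, Fin.sum_univ_two]
  simpa using hij

theorem sum_antidiagonal_eq_sum_range_pred {K : Type*} [Field K] (w : ℕ → PowerSeries K) (k : ℕ) :
    ∑ i ∈ Finset.range (k + 1), w i * w (k + 1 - 1 - i) =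
      ∑ p ∈ Finset.HasAntidiagonal.antidiagonal k, w p.1 * w p.2 := by
  rw [Finset.Nat.sum_antidiagonal_eq_sum_range_succ_mk]
  simp

/-- Apart from the constant `1`, the right-hand side of the first equation is divisible by `x * t`,
hence the shift from `k` to `k + 1`. One factor `x` stays with `W ^ 2`, so that its coefficients
have total index `k - 1`; for `k = 0` the sum over `Finset.range k` is empty and the truncated
subtraction is harmless. Divided differences are shifts of indices. -/
theorem isSolution_iff (W : RingX) (H : RingXY) :
    IsSolution W H ↔ IsCoeffSolution om om⁻¹ (coeffX W) (coeffXY H) := by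
  set R : RingX := (PowerSeries.C Polynomial.X) ^ 2 * PowerSeries.X * W ^ 2
    + scX om * PowerSeries.C Polynomial.X * PowerSeries.X * substXY H 0 Polynomial.X
    + scX om⁻¹ * PowerSeries.C Polynomial.X * PowerSeries.X * substXY H Polynomial.X 0
    + 1 with hR
  have hR' : R = PowerSeries.C Polynomial.X * (PowerSeries.X *
      (PowerSeries.C Polynomial.X * (W * W) + scX om * substXY H 0 Polynomial.X
        + scX om⁻¹ * substXY H Polynomial.X 0)) + 1 := by rw [hR]; ring
  have h0 : coeffX R 0 = 1 := by
    rw [hR', coeffX_add, coeffX_x_mul_zero, coeffX_one_zero, zero_add]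
  have h1 : ∀ k, coeffX R (k + 1) = PowerSeries.X *
      (∑ i ∈ Finset.range k, coeffX W i * coeffX W (k - 1 - i) +
        PowerSeries.C om * coeffXY H 0 k + PowerSeries.C om⁻¹ * coeffXY H k 0) := by
    intro k
    rw [hR', coeffX_add, coeffX_x_mul_succ, coeffX_one_succ, add_zero, coeffX_t_mul, coeffX_add,
      coeffX_add, coeffX_scX_mul, coeffX_scX_mul, coeffX_substXY_zero_X, coeffX_substXY_X_zero]
    cases k with
    | zero => rw [coeffX_x_mul_zero]; simp
    | succ k => rw [coeffX_x_mul_succ, coeffX_mul, sum_antidiagonal_eq_sum_range_pred]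
  have h2 : ∀ i j, coeffXY (substX W vx * substX W vy + scXY om * divDiffY H
      + scXY om⁻¹ * divDiffX H) i j = coeffX W i * coeffX W j +
        PowerSeries.C om * coeffXY H i (j + 1) + PowerSeries.C om⁻¹ * coeffXY H (i + 1) j := by
    intro i j
    rw [coeffXY_add, coeffXY_add, coeffXY_substX_mul_substX, coeffXY_scXY_mul, coeffXY_scXY_mul,
      coeffXY_divDiffY, coeffXY_divDiffX]
  constructor
  · rintro ⟨hW, hH⟩
    refine ⟨?_, fun k => ?_, fun i j => ?_, coeffXY_finite H⟩
    · conv_lhs => rw [hW]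
      exact h0
    · conv_lhs => rw [hW]
      exact h1 k
    · conv_lhs => rw [hH]
      exact h2 i j
  · intro h
    refine ⟨ringX_ext fun k => ?_, ringXY_ext fun i j => ?_⟩
    · cases k with
      | zero => exact h.w_zero.trans h0.symm
      | succ k => exact (h.w_succ k).trans (h1 k).symm
    · exact (h.h_eq i j).trans (h2 i j).symm

/-! ### Order in `t` and uniqueness -/

/-- The coefficients of `f` vanish below degree `k / 2`. -/
def HalfOrderGE {K : Type*} [Field K] (k : ℕ) (f : PowerSeries K) : Prop :=
  ∀ n, 2 * n < k → f.coeff n = 0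

theorem HalfOrderGE.mul {K : Type*} [Field K] {k l : ℕ} {f g : PowerSeries K}
    (hf : HalfOrderGE k f) (hg : HalfOrderGE l g) : HalfOrderGE (k + l) (f * g) := by
  intro n hn
  rw [PowerSeries.coeff_mul]
  refine Finset.sum_eq_zero fun p hp => ?_
  have := Finset.HasAntidiagonal.mem_antidiagonal.1 hp
  rcases lt_or_ge (2 * p.1) k with h | h
  · rw [hf _ h, zero_mul]
  · rw [hg p.2 (by omega), mul_zero]

namespace IsCoeffSolution

variable {K : Type*} [Field K] {a b : K} {w w' : ℕ → PowerSeries K} {h h' : ℕ → ℕ → PowerSeries K}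

/-- Every dashed edge has two ends, so degree `n` in `t` leaves room for at most `2 * n` pending
ends. In the induction, the recursion for `w` uses lower degrees only, while the one for `h` stays
in degree `n` and raises `i + j`. -/
theorem coeff_w_h_eq_zero (hs : IsCoeffSolution a b w h) (n : ℕ) :
    (∀ k, 2 * n < k → (w k).coeff n = 0) ∧ ∀ i j, 2 * n < i + j → (h i j).coeff n = 0 := by
  induction n using Nat.strong_induction_on with
  | _ n ih =>
    have key : ∀ i j p : ℕ, p < n → 2 * p < i + j → (w i * w j).coeff p = 0 := by
      intro i j p hp hij
      rw [PowerSeries.coeff_mul]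
      refine Finset.sum_eq_zero fun q hq => ?_
      have := Finset.HasAntidiagonal.mem_antidiagonal.1 hq
      rcases lt_or_ge (2 * q.1) i with h1 | h1
      · rw [(ih q.1 (by omega)).1 _ h1, zero_mul]
      · rw [(ih q.2 (by omega)).1 j (by omega), mul_zero]
    have hw : ∀ k, 2 * n < k → (w k).coeff n = 0 := by
      intro k hk
      obtain ⟨k, rfl⟩ : ∃ l, k = l + 1 := ⟨k - 1, by omega⟩
      rw [hs.w_succ]
      cases n with
      | zero => simp
      | succ n =>
        rw [PowerSeries.coeff_succ_X_mul, map_add, map_add, PowerSeries.coeff_C_mul,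
          PowerSeries.coeff_C_mul, (ih n (by omega)).2 0 k (by omega),
          (ih n (by omega)).2 k 0 (by omega), map_sum, Finset.sum_eq_zero, mul_zero, mul_zero,
          add_zero, add_zero]
        intro i hi
        have := Finset.mem_range.1 hi
        exact key _ _ _ (by omega) (by omega)
    refine ⟨hw, ?_⟩
    obtain ⟨B, hB⟩ := hs.h_finite n
    -- Descending induction on `i + j`, starting beyond the bound `B` provided by polynomiality.
    suffices ∀ N i j, B < N + (i + j) → 2 * n < i + j → (h i j).coeff n = 0 from
      fun i j hij => this (B + 1) i j (by omega) hij
    intro N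
    induction N with
    | zero => exact fun i j hN _ => hB i j (by omega)
    | succ N ihN =>
      intro i j hN hij
      have hww : (w i * w j).coeff n = 0 := by
        rw [PowerSeries.coeff_mul]
        refine Finset.sum_eq_zero fun q hq => ?_
        have := Finset.HasAntidiagonal.mem_antidiagonal.1 hq
        have hw' : ∀ p k, p ≤ n → 2 * p < k → (w k).coeff p = 0 := fun p k hp hk =>
          (Nat.lt_or_eq_of_le hp).elim (fun hp => (ih p hp).1 k hk) fun hp => by
            subst hp; exact hw k hk
        rcases lt_or_ge (2 * q.1) i with h1 | h1
        · rw [hw' q.1 _ (by omega) h1, zero_mul]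
        · rw [hw' q.2 j (by omega) (by omega), mul_zero]
      rw [hs.h_eq, map_add, map_add, PowerSeries.coeff_C_mul, PowerSeries.coeff_C_mul, hww,
        ihN i (j + 1) (by omega) (by omega), ihN (i + 1) j (by omega) (by omega)]
      simp

theorem halfOrderGE_w (hs : IsCoeffSolution a b w h) (k : ℕ) : HalfOrderGE k (w k) :=
  fun n hn => (hs.coeff_w_h_eq_zero n).1 k hn

theorem halfOrderGE_h (hs : IsCoeffSolution a b w h) (i j : ℕ) : HalfOrderGE (i + j) (h i j) :=
  fun n hn => (hs.coeff_w_h_eq_zero n).2 i j hn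

/-- In each degree, `w` is determined by lower degrees. Then `h` is determined by descending
induction on `i + j` from the range `i + j > 2 * n`, where both solutions vanish. -/
theorem coeff_unique (hs : IsCoeffSolution a b w h) (hs' : IsCoeffSolution a b w' h') (n : ℕ) :
    (∀ k, (w k).coeff n = (w' k).coeff n) ∧ ∀ i j, (h i j).coeff n = (h' i j).coeff n := by
  induction n using Nat.strong_induction_on with
  | _ n ih =>
    have hw : ∀ k, (w k).coeff n = (w' k).coeff n := by
      intro k
      cases k with
      | zero => rw [hs.w_zero, hs'.w_zero]
      | succ k =>
        rw [hs.w_succ, hs'.w_succ]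
        cases n with
        | zero => simp
        | succ n =>
          simp only [PowerSeries.coeff_succ_X_mul, map_add, PowerSeries.coeff_C_mul, map_sum,
            (ih n (by omega)).2]
          congr 2
          simp only [PowerSeries.coeff_mul]
          refine Finset.sum_congr rfl fun i _ => Finset.sum_congr rfl fun q hq => ?_
          have := Finset.HasAntidiagonal.mem_antidiagonal.1 hq
          rw [(ih q.1 (by omega)).1, (ih q.2 (by omega)).1]
    refine ⟨hw, ?_⟩
    have hw' : ∀ p k, p ≤ n → (w k).coeff p = (w' k).coeff p := fun p k hp =>
      (Nat.lt_or_eq_of_le hp).elim (fun hp => (ih p hp).1 k) fun hp => by subst hp; exact hw k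
    suffices ∀ N i j, 2 * n < N + (i + j) → (h i j).coeff n = (h' i j).coeff n from
      fun i j => this (2 * n + 1) i j (by omega)
    intro N
    induction N with
    | zero =>
      intro i j hN
      rw [hs.halfOrderGE_h i j n (by omega), hs'.halfOrderGE_h i j n (by omega)]
    | succ N ihN =>
      intro i j hN
      rw [hs.h_eq, hs'.h_eq]
      simp only [map_add, PowerSeries.coeff_C_mul, ihN i (j + 1) (by omega),
        ihN (i + 1) j (by omega)]
      congr 2
      simp only [PowerSeries.coeff_mul]
      refine Finset.sum_congr rfl fun q hq => ?_
      have := Finset.HasAntidiagonal.mem_antidiagonal.1 hq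
      rw [hw' q.1 _ (by omega), hw' q.2 _ (by omega)]

end IsCoeffSolution

/-! ### Construction of a solution -/

section Existence

variable {K : Type*} [Field K] (a b : K)

/-- The solution of `u i j = f i j + a * u i (j + 1) + b * u (i + 1) j` that is `0` after `N`
steps. -/
def stepSum (f : ℕ → ℕ → K) : ℕ → ℕ → ℕ → K
  | 0, _, _ => 0
  | N + 1, i, j => f i j + a * stepSum f N i (j + 1) + b * stepSum f N (i + 1) j

/-- The coefficients of the series `w`, by recursion on the degree in `t`. -/
noncomputable def solW : ℕ → ℕ → K
  | 0, k => if k = 0 then 1 else 0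
  | _ + 1, 0 => 0
  | n + 1, k + 1 =>
    -- `Fin (n + 1)` lets the termination check see that `p ≤ n`. With `2 * n + 1 - (i + j)` steps
    -- the recursion for `h` reaches index sum `2 * n`, beyond which everything is `0`.
    let f : ℕ → ℕ → K := fun i j => ∑ p : Fin (n + 1), solW p i * solW (n - p) j
    ∑ i ∈ Finset.range k, f i (k - 1 - i) + a * stepSum a b f (2 * n + 1 - k) 0 k +
      b * stepSum a b f (2 * n + 1 - k) k 0
  termination_by n => n
  decreasing_by all_goals omega

/-- The coefficients of the products `w i * w j`. -/
noncomputable def solWW (n i j : ℕ) : K :=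
  ∑ p ∈ Finset.HasAntidiagonal.antidiagonal n, solW a b p.1 i * solW a b p.2 j

/-- The coefficients of the series `h`. -/
noncomputable def solH (n i j : ℕ) : K := stepSum a b (solWW a b n) (2 * n + 1 - (i + j)) i j

theorem solW_succ_succ (n k : ℕ) : solW a b (n + 1) (k + 1) =
    ∑ i ∈ Finset.range k, solWW a b n i (k - 1 - i) + a * solH a b n 0 k + b * solH a b n k 0 := by
  have : (fun i j => ∑ p : Fin (n + 1), solW a b p i * solW a b (n - p) j) = solWW a b n := by
    funext i j
    rw [solWW, Finset.Nat.sum_antidiagonal_eq_sum_range_succ_mk, ← Fin.sum_univ_eq_sum_range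
      (fun p => solW a b p i * solW a b (n - p) j)]
  rw [solW]
  simp only [this, solH, zero_add, add_zero]
  congr 2
  exact Finset.sum_congr rfl fun i _ => congrFun (congrFun this i) _

theorem solW_eq_zero (n : ℕ) : ∀ k, 2 * n < k → solW a b n k = 0 := by
  induction n using Nat.strong_induction_on with
  | _ n ih =>
    intro k hk
    obtain ⟨k, rfl⟩ : ∃ l, k = l + 1 := ⟨k - 1, by omega⟩
    cases n with
    | zero => rw [solW]; simp
    | succ n =>
      rw [solW_succ_succ, solH, solH, show 2 * n + 1 - (0 + k) = 0 by omega,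
        show 2 * n + 1 - (k + 0) = 0 by omega, stepSum, stepSum, mul_zero, mul_zero, add_zero,
        add_zero]
      refine Finset.sum_eq_zero fun i hi => Finset.sum_eq_zero fun q hq => ?_
      have := Finset.HasAntidiagonal.mem_antidiagonal.1 hq
      have := Finset.mem_range.1 hi
      rcases lt_or_ge (2 * q.1) i with h1 | h1
      · rw [ih q.1 (by omega) _ h1, zero_mul]
      · rw [ih q.2 (by omega) _ (by omega), mul_zero]

theorem solWW_eq_zero (n i j : ℕ) (h : 2 * n < i + j) : solWW a b n i j = 0 := by
  refine Finset.sum_eq_zero fun q hq => ?_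
  have := Finset.HasAntidiagonal.mem_antidiagonal.1 hq
  rcases lt_or_ge (2 * q.1) i with h1 | h1
  · rw [solW_eq_zero a b _ _ h1, zero_mul]
  · rw [solW_eq_zero a b q.2 j (by omega), mul_zero]

theorem solH_eq_zero (n i j : ℕ) (h : 2 * n < i + j) : solH a b n i j = 0 := by
  rw [solH, show 2 * n + 1 - (i + j) = 0 by omega, stepSum]

/-- Both neighbours of `(i, j)` have index sum one larger, hence exactly one step fewer to go.
Beyond `2 * n` all terms are `0`. -/
theorem solH_eq (n i j : ℕ) :
    solH a b n i j = solWW a b n i j + a * solH a b n i (j + 1) + b * solH a b n (i + 1) j := by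
  rcases lt_or_ge (2 * n) (i + j) with h | h
  · rw [solH_eq_zero _ _ _ _ _ h, solWW_eq_zero _ _ _ _ _ h, solH_eq_zero _ _ _ _ _ (by omega),
      solH_eq_zero _ _ _ _ _ (by omega)]
    simp
  · rw [solH, show 2 * n + 1 - (i + j) = (2 * n - (i + j)) + 1 by omega, stepSum, solH, solH,
      show 2 * n + 1 - (i + (j + 1)) = 2 * n - (i + j) by omega,
      show 2 * n + 1 - (i + 1 + j) = 2 * n - (i + j) by omega]

theorem isCoeffSolution_sol : IsCoeffSolution a b
    (fun k => PowerSeries.mk fun n => solW a b n k)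
    (fun i j => PowerSeries.mk fun n => solH a b n i j) := by
  refine ⟨?_, fun k => ?_, fun i j => ?_, fun n => ⟨2 * n, fun i j hij => ?_⟩⟩
  · ext n
    cases n with
    | zero => simp [solW]
    | succ n => simp [solW, PowerSeries.coeff_one]
  · ext n
    cases n with
    | zero => simp [solW]
    | succ n =>
      rw [PowerSeries.coeff_succ_X_mul]
      simp only [map_add, PowerSeries.coeff_C_mul, map_sum, PowerSeries.coeff_mk, solW_succ_succ,
        solWW]
      simp only [PowerSeries.coeff_mul, PowerSeries.coeff_mk]
  · ext n
    rw [PowerSeries.coeff_mk, solH_eq]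
    simp only [map_add, PowerSeries.coeff_C_mul, PowerSeries.coeff_mk, solWW]
    simp only [PowerSeries.coeff_mul, PowerSeries.coeff_mk]
  · simpa using solH_eq_zero a b n i j hij

end Existence

/-! ### The solution over `ℚ(ω)` and the coefficient of `x` -/

/-- The series in `ℚ(ω)[x][[t]]` whose coefficients are those of the solution. -/
noncomputable def solRingX : RingX :=
  PowerSeries.mk fun n => ∑ k ∈ Finset.range (2 * n + 1),
    Polynomial.monomial k (solW om om⁻¹ n k)

/-- The series in `ℚ(ω)[x, y][[t]]` whose coefficients are those of the solution. -/
noncomputable def solRingXY : RingXY :=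
  PowerSeries.mk fun n => ∑ p ∈ Finset.range (2 * n + 1) ×ˢ Finset.range (2 * n + 1),
    MvPolynomial.monomial (expXY p.1 p.2) (solH om om⁻¹ n p.1 p.2)

theorem coeffX_solRingX (k : ℕ) :
    coeffX solRingX k = PowerSeries.mk fun n => solW om om⁻¹ n k := by
  ext n
  simp only [coeffX, solRingX, PowerSeries.coeff_mk, Polynomial.finsetSum_coeff,
    Polynomial.coeff_monomial, Finset.sum_ite_eq', Finset.mem_range]
  split_ifs with h
  · rfl
  · rw [solW_eq_zero _ _ _ _ (by omega)]

theorem coeffXY_solRingXY (i j : ℕ) :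
    coeffXY solRingXY i j = PowerSeries.mk fun n => solH om om⁻¹ n i j := by
  ext n
  simp only [coeffXY, solRingXY, PowerSeries.coeff_mk, MvPolynomial.coeff_sum,
    MvPolynomial.coeff_monomial, eq_expXY_iff, expXY_zero, expXY_one]
  by_cases h : i + j ≤ 2 * n
  · rw [Finset.sum_eq_single (i, j)]
    · simp
    · rintro ⟨p, q⟩ - hne
      rw [if_neg]
      rintro ⟨rfl, rfl⟩
      exact hne rfl
    · intro hmem
      exact absurd (Finset.mem_product.2 ⟨Finset.mem_range.2 (by omega),
        Finset.mem_range.2 (by omega)⟩) hmem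
  · rw [solH_eq_zero _ _ _ _ _ (by omega)]
    refine Finset.sum_eq_zero fun p _ => ?_
    split_ifs with hp
    · rw [solH_eq_zero _ _ _ _ _ (by omega)]
    · rfl

theorem existsUnique_isSolution : ∃! p : RingX × RingXY, IsSolution p.1 p.2 := by
  refine ⟨(solRingX, solRingXY), ?_, ?_⟩
  · refine (isSolution_iff _ _).2 ?_
    convert isCoeffSolution_sol om om⁻¹ using 1
    · funext k; exact coeffX_solRingX k
    · funext i j; exact coeffXY_solRingXY i j
  · rintro ⟨W, H⟩ hWH
    rw [isSolution_iff] at hWH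
    have key := hWH.coeff_unique (isCoeffSolution_sol om om⁻¹)
    refine Prod.ext (ringX_ext fun k => ?_) (ringXY_ext fun i j => ?_)
    · rw [coeffX_solRingX]; ext n; exact (key n).1 k
    · rw [coeffXY_solRingXY]; ext n; exact (key n).2 i j

theorem om_add_inv_ne_zero : om + om⁻¹ ≠ 0 := by
  have hX : om ≠ 0 := RatFunc.X_ne_zero
  intro h
  have h1 : om ^ 2 + 1 = 0 := by
    have := congrArg (· * om) h
    simpa [add_mul, hX, sq] using this
  have h2 : algebraMap (Polynomial ℚ) Kω (Polynomial.X ^ 2 + 1) = 0 := by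
    simpa [om] using h1
  rw [map_eq_zero_iff _ (RatFunc.algebraMap_injective ℚ)] at h2
  -- The constant term of `X ^ 2 + 1` is `1`.
  have := congrArg (Polynomial.eval 0) h2
  simp at this

/-- For `k = 0` the quadratic term in the equation for `w (k + 1)` is absent, and both remaining
terms involve `h 0 0`. -/
theorem IsSolution.substXY_zero_eq {W : RingX} {H : RingXY} (hs : IsSolution W H) :
    ((substXY H (0 : Kω) 0 - 1 : PowerSeries Kω) : LaurentSeries Kω) =
        (coeffX1 W : LaurentSeries Kω) /
          (((PowerSeries.X : PowerSeries Kω) : LaurentSeries Kω) *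
            ((PowerSeries.C (om + om⁻¹) : PowerSeries Kω) : LaurentSeries Kω)) - 1 := by
  have h1 : coeffX1 W = PowerSeries.X * PowerSeries.C (om + om⁻¹) * substXY H (0 : Kω) 0 := by
    have := ((isSolution_iff W H).1 hs).w_succ 0
    rw [substXY_zero_zero, map_add]
    change coeffX W 1 = _
    rw [this]
    simp; ring
  have hne : (PowerSeries.X * PowerSeries.C (om + om⁻¹) : PowerSeries Kω) ≠ 0 := by
    refine mul_ne_zero PowerSeries.X_ne_zero ?_
    rw [Ne, map_eq_zero_iff _ PowerSeries.C_injective]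
    exact om_add_inv_ne_zero
  have hne' : ((PowerSeries.X * PowerSeries.C (om + om⁻¹) : PowerSeries Kω) : LaurentSeries Kω)
      ≠ 0 := by
    rw [Ne, ← map_zero (HahnSeries.ofPowerSeries ℤ Kω)]
    exact fun h => hne (HahnSeries.ofPowerSeries_injective h)
  rw [h1, ← map_mul, map_mul _ (_ * _) (substXY _ _ _), mul_div_cancel_left₀ _ hne', map_sub,
    map_one]

/-! ### Numbers of cycles -/

section Cycles

theorem eq_of_sameCycle {D β : Type*} {f : Perm D} {F : D → β} (hF : ∀ x, F (f x) = F x) {x y : D}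
    (h : f.SameCycle x y) : F x = F y := by
  obtain ⟨i, rfl⟩ := h
  induction i using Int.induction_on with
  | zero => simp
  | succ i ih => rw [ih, add_comm, zpow_add, zpow_one, Perm.mul_apply, hF]
  | pred i ih => rw [ih, ← hF ((f ^ (-(i : ℤ) - 1)) x), ← Perm.mul_apply, ← zpow_one_add]; simp

theorem numCycles_one (D : Type) : numCycles (1 : Perm D) = Nat.card D := by
  refine Nat.card_congr (Equiv.ofBijective (fun x => Quotient.mk _ x) ⟨?_, ?_⟩).symm
  · intro x y h
    exact eq_of_sameCycle (F := id) (fun _ => rfl) (Quotient.exact h)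
  · rintro ⟨x⟩
    exact ⟨x, rfl⟩

variable {D : Type} [DecidableEq D]

/-- The permutation `f` with the element `a` taken out of its cycle. -/
def skip (f : Perm D) (a : D) : Perm D := swap a (f a) * f

@[simp] theorem skip_self (f : Perm D) (a : D) : skip f a a = a := by simp [skip]

theorem skip_of_eq {f : Perm D} {a x : D} (h : f x = a) : skip f a x = f a := by
  simp [skip, h]

theorem skip_of_ne {f : Perm D} {a x : D} (hx : x ≠ a) (h : f x ≠ a) : skip f a x = f x := by
  simp [skip, swap_apply_of_ne_of_ne h (fun h' => hx (f.injective h'))]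

theorem skip_eq_self {f : Perm D} {a : D} (h : f a = a) : skip f a = f := by
  rw [skip, h, swap_self]; rfl

/-- The cycles of `skip f a` are those of `f`, with `a` left out, together with the new fixed point
`a`. The proof makes this a bijection with an `Option` type. -/
theorem numCycles_skip [Finite D] {f : Perm D} {a : D} (ha : f a ≠ a) :
    numCycles (skip f a) = numCycles f + 1 := by
  set g := skip f a with hg
  have hgs : ∀ x, g.SameCycle (g x) x := fun x => (Perm.SameCycle.refl g x).apply_left
  have hfs : ∀ x, f.SameCycle (f x) x := fun x => (Perm.SameCycle.refl f x).apply_left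
  -- As `a` has left its cycle, `f a ≠ a` represents that cycle instead.
  let κ : D → Quotient (Perm.SameCycle.setoid g) := fun x =>
    if x = a then Quotient.mk _ (f a) else Quotient.mk _ x
  have hκ : ∀ x, κ (f x) = κ x := by
    intro x
    by_cases hx : x = a
    · subst hx; simp [κ]
    · by_cases hfx : f x = a
      · simp only [κ, hfx, hx, if_true, if_false]
        rw [← skip_of_eq hfx]
        exact Quotient.sound (hgs x)
      · simp only [κ, hfx, hx, if_false]
        rw [← skip_of_ne hx hfx]
        exact Quotient.sound (hgs x)
  let μ : D → Option (Quotient (Perm.SameCycle.setoid f)) := fun x =>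
    if x = a then none else some (Quotient.mk _ x)
  have hμ : ∀ x, μ (g x) = μ x := by
    intro x
    by_cases hx : x = a
    · subst hx; simp [hg]
    · have hgx : g x ≠ a := fun h => hx (g.injective (h.trans (skip_self f a).symm))
      simp only [μ, hgx, hx, if_false, Option.some.injEq]
      refine Quotient.sound ?_
      by_cases hfx : f x = a
      · rw [hg, skip_of_eq hfx, ← hfx]
        exact (hfs _).trans (hfs _)
      · rw [hg, skip_of_ne hx hfx]
        exact hfs x
  let e : Quotient (Perm.SameCycle.setoid g) ≃ Option (Quotient (Perm.SameCycle.setoid f)) :=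
    { toFun := Quotient.lift μ fun x y h => eq_of_sameCycle hμ h
      invFun := fun o => o.elim (Quotient.mk _ a) (Quotient.lift κ fun x y h => eq_of_sameCycle hκ h)
      left_inv := by
        refine fun q => Quotient.inductionOn q fun x => ?_
        by_cases hx : x = a
        · simp [μ, hx]
        · simp [μ, κ, hx]
      right_inv := by
        rintro (_ | q)
        · simp [μ]
        · refine Quotient.inductionOn q fun x => ?_
          by_cases hx : x = a
          · simp only [Option.elim, Quotient.lift_mk, κ, μ, hx, if_true, ha, if_false]
            exact congrArg some (Quotient.sound (hfs a))
          · simp [μ, κ, hx] }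
  rw [numCycles, Nat.card_congr e, Finite.card_option, numCycles]

end Cycles

/-! ### Cyclic lists -/

section CyclicLists

variable {α : Type*} {R R' : α → α → Prop}

/-- Consecutive elements of the cyclic list `L` are related by `R`. -/
def CycChain (R : α → α → Prop) : List α → Prop
  | [] => True
  | x :: l => (x :: l ++ [x]).IsChain R

/-- Used when a cycle is cut and closed up elsewhere: the inner steps only change relation, and the
last step gets a new target. The head of `L` is never the target of an inner step, so `h1` asks only
about `L.tail`. -/
theorem IsChain.replace_last {L : List α} {a b : α} (h : (L ++ [a]).IsChain R)
    (h1 : ∀ x ∈ L, ∀ y ∈ L.tail, R x y → R' x y) (h2 : ∀ x ∈ L, R x a → R' x b) :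
    (L ++ [b]).IsChain R' := by
  induction L with
  | nil => simp
  | cons x l ih =>
    cases l with
    | nil => simpa using h2 x (by simp) (by simpa using h)
    | cons y l =>
      simp only [List.cons_append, List.isChain_cons_cons] at h ⊢
      refine ⟨h1 x (by simp) y (by simp) h.1, ih h.2 (fun u hu v hv => ?_) fun u hu => ?_⟩
      · exact h1 u (List.mem_cons_of_mem _ hu) v (List.mem_of_mem_tail hv)
      · exact h2 u (List.mem_cons_of_mem _ hu)

theorem CycChain.imp_of_mem {L : List α} (h : CycChain R L)
    (h1 : ∀ x ∈ L, ∀ y ∈ L, R x y → R' x y) : CycChain R' L := by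
  cases L with
  | nil => trivial
  | cons x l =>
    exact IsChain.replace_last (a := x) h
      (fun u hu v hv => h1 u hu v (List.mem_of_mem_tail hv)) fun u hu => h1 u hu x (by simp)

theorem CycChain.rotate {l₁ l₂ : List α} (h : CycChain R (l₁ ++ l₂)) : CycChain R (l₂ ++ l₁) := by
  cases l₁ with
  | nil => simpa using h
  | cons x a =>
    cases l₂ with
    | nil => simpa using h
    | cons y b =>
      have h' : (x :: a ++ y :: (b ++ [x])).IsChain R := by simpa [CycChain] using h
      rw [List.isChain_split] at h'
      have : (y :: b ++ x :: (a ++ [y])).IsChain R := by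
        rw [List.isChain_split]
        exact ⟨by simpa using h'.2, by simpa using h'.1⟩
      simpa [CycChain] using this

theorem exists_rel_of_isChain {l : List α} {a b : α} (h : (a :: l ++ [b]).IsChain R) :
    (∀ y ∈ l ++ [b], ∃ x ∈ a :: l, R x y) ∧ ∀ x ∈ a :: l, ∃ y ∈ l ++ [b], R x y := by
  induction l generalizing a with
  | nil => simpa using h
  | cons c l ih =>
    simp only [List.cons_append, List.isChain_cons_cons] at h
    obtain ⟨ih1, ih2⟩ := ih (a := c) h.2
    constructor
    · intro y hy
      rcases List.mem_cons.1 hy with rfl | hy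
      · exact ⟨a, by simp, h.1⟩
      · obtain ⟨x, hx, hxy⟩ := ih1 y hy
        exact ⟨x, List.mem_cons_of_mem _ hx, hxy⟩
    · intro x hx
      rcases List.mem_cons.1 hx with rfl | hx
      · exact ⟨c, by simp, h.1⟩
      · obtain ⟨y, hy, hxy⟩ := ih2 x hx
        exact ⟨y, List.mem_cons_of_mem _ hy, hxy⟩

end CyclicLists

/-! ### Removing edges without changing the number of faces -/

section Faces

variable {D : Type} {tw π₀ : D → D} {φ : Perm D} {V : Finset D}
  {Θ Θ' : List (List D)}

/-- The permutation `φ` is `tw` composed with the permutation that agrees with `π₀` on `V`, and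
whose other cycles are the lists of `Θ`; elements outside are fixed. -/
structure FacePerm (tw π₀ : D → D) (φ : Perm D) (V : Finset D) (Θ : List (List D)) : Prop where
  fixed : ∀ x, x ∉ V → x ∉ Θ.flatten → φ x = x
  map_mem : ∀ x ∈ V, π₀ x ∈ V
  apply_mem : ∀ x ∈ V, φ x = tw (π₀ x)
  cycles : ∀ L ∈ Θ, CycChain (fun x y => φ x = tw y) L
  nodup : Θ.flatten.Nodup
  disj : ∀ x ∈ V, x ∉ Θ.flatten

theorem FacePerm.congr_tw {tw' : D → D} (h : FacePerm tw π₀ φ V Θ) (hV : ∀ x ∈ V, tw x = tw' x)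
    (hΘ : ∀ x ∈ Θ.flatten, tw x = tw' x) : FacePerm tw' π₀ φ V Θ where
  fixed := h.fixed
  map_mem := h.map_mem
  apply_mem x hx := (h.apply_mem x hx).trans (hV _ (h.map_mem x hx))
  cycles L hL := (h.cycles L hL).imp_of_mem fun _ _ y hy hxy =>
    hxy.trans (hΘ y (List.mem_flatten.2 ⟨L, hL, hy⟩))
  nodup := h.nodup
  disj := h.disj

theorem FacePerm.perm (h : FacePerm tw π₀ φ V Θ) (hΘ : Θ.Perm Θ') : FacePerm tw π₀ φ V Θ' where
  fixed x hx hx' := h.fixed x hx fun h' => hx' (hΘ.flatten.mem_iff.1 h')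
  map_mem := h.map_mem
  apply_mem := h.apply_mem
  cycles L hL := h.cycles L (hΘ.mem_iff.2 hL)
  nodup := hΘ.flatten.nodup_iff.1 h.nodup
  disj x hx hx' := h.disj x hx (hΘ.flatten.mem_iff.2 hx')

theorem FacePerm.rotate {l₁ l₂ : List D} (h : FacePerm tw π₀ φ V ((l₁ ++ l₂) :: Θ)) :
    FacePerm tw π₀ φ V ((l₂ ++ l₁) :: Θ) := by
  have hp : ((l₁ ++ l₂) :: Θ).flatten.Perm ((l₂ ++ l₁) :: Θ).flatten := by
    simp only [List.flatten_cons]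
    exact List.perm_append_comm.append_right _
  refine ⟨fun x hx hx' => h.fixed x hx fun h' => hx' (hp.mem_iff.1 h'), h.map_mem, h.apply_mem,
    fun L hL => ?_, hp.nodup_iff.1 h.nodup, fun x hx hx' => h.disj x hx (hp.mem_iff.2 hx')⟩
  rcases List.mem_cons.1 hL with rfl | hL
  · exact (h.cycles _ (by simp)).rotate
  · exact h.cycles L (List.mem_cons_of_mem _ hL)

variable [DecidableEq D]

/-- The number of faces, up to the number of elements outside of `V` and `Θ`. -/
noncomputable def faceCount (φ : Perm D) (V : Finset D) (Θ : List (List D)) : ℕ :=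
  numCycles φ + Θ.count [] + Θ.flatten.length + V.card

theorem faceCount_perm (hΘ : Θ.Perm Θ') : faceCount φ V Θ = faceCount φ V Θ' := by
  rw [faceCount, faceCount, hΘ.count_eq, hΘ.flatten.length_eq]

theorem faceCount_rotate {l₁ l₂ : List D} :
    faceCount φ V ((l₁ ++ l₂) :: Θ) = faceCount φ V ((l₂ ++ l₁) :: Θ) := by
  simp only [faceCount, List.count_cons, List.flatten_cons, List.length_append,
    beq_iff_eq, List.append_eq_nil_iff, and_comm (a := l₁ = [])]
  omega

section RemovePair

variable {d d' : D}

theorem tw_swap_of_ne {x : D} (h1 : x ≠ d) (h2 : x ≠ d') : (tw ∘ swap d d') x = tw x := by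
  simp [swap_apply_of_ne_of_ne h1 h2]

/-- An edge `{d, d'}` is removed in two stages. Replacing `tw` by `tw ∘ swap d d'` makes both `d`
and `d'` fixed points of the twist, and `skip φ d` takes `d` out of its face; then `d'` goes as a
fixed point of the new twist. Steps away from `d` and `d'` are unaffected. -/
theorem skip_apply_of_tw (htw : Function.Injective tw) (hd' : tw d' = d) {x z : D} (hx : x ≠ d)
    (hz : z ≠ d') (hz' : z ≠ d) (h : φ x = tw z) : skip φ d x = (tw ∘ swap d d') z := by
  rw [tw_swap_of_ne hz' hz, skip_of_ne hx, h]
  rw [h, ← hd']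
  exact fun h' => hz (htw h')

theorem skip_apply_of_tw_self (hd : tw d = d') (hne : d' ≠ d) {x : D} (hx : x ≠ d)
    (h : φ x = tw d) : skip φ d x = (tw ∘ swap d d') d' := by
  rw [skip_of_ne hx (by rwa [h, hd]), h]; simp

end RemovePair

variable [Finite D]

/-- Taking a fixed point of `tw` out of a cycle. -/
theorem FacePerm.remove_fixed (htw : Function.Injective tw) {y : D} {l : List D} (hy : tw y = y)
    (h : FacePerm tw π₀ φ V ((y :: l) :: Θ)) :
    ∃ φ', FacePerm tw π₀ φ' V (l :: Θ) ∧ faceCount φ' V (l :: Θ) =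
      faceCount φ V ((y :: l) :: Θ) := by
  have hnd := h.nodup
  simp only [List.flatten_cons, List.cons_append, List.nodup_cons, List.mem_append, not_or] at hnd
  have hyV : y ∉ V := fun hV => h.disj y hV (by simp)
  have hc := h.cycles (y :: l) (by simp)
  have htwy : ∀ {x}, tw x = y → x = y := fun hx => htw (hx.trans hy.symm)
  refine ⟨skip φ y, ⟨fun x hxV hx => ?_, h.map_mem, fun x hx => ?_, fun L hL => ?_, hnd.2,
    fun x hx hx' => h.disj x hx ?_⟩, ?_⟩
  · by_cases hxy : x = y
    · subst hxy; simp
    · have hfx := h.fixed x hxV (by simpa [hxy] using hx)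
      rw [skip_of_ne hxy (by rwa [hfx]), hfx]
  · have hne : φ x ≠ y := by
      rw [h.apply_mem x hx]
      exact fun h' => hyV (htwy h' ▸ h.map_mem x hx)
    rw [← h.apply_mem x hx, skip_of_ne _ hne]
    rintro rfl
    exact hyV hx
  · have key : ∀ x, x ≠ y → ∀ z, z ≠ y → φ x = tw z → skip φ y x = tw z := by
      intro x hx z hz hxz
      rw [skip_of_ne hx fun h' => hz (htwy (hxz.symm.trans h')), hxz]
    rcases List.mem_cons.1 hL with rfl | hL
    · cases L with
      | nil => trivial
      | cons x l =>
        simp only [CycChain, List.cons_append, List.isChain_cons_cons] at hc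
        refine IsChain.replace_last (L := x :: l) hc.2 (fun u hu v hv => key u ?_ v ?_)
          fun u hu huy => ?_
        · rintro rfl; exact hnd.1.1 hu
        · rintro rfl; exact hnd.1.1 (List.mem_of_mem_tail hv)
        · rw [skip_of_eq (huy.trans hy), hc.1]
    · refine (h.cycles L (List.mem_cons_of_mem _ hL)).imp_of_mem fun u hu v hv => key u ?_ v ?_
      · rintro rfl; exact hnd.1.2 (List.mem_flatten.2 ⟨L, hL, hu⟩)
      · rintro rfl; exact hnd.1.2 (List.mem_flatten.2 ⟨L, hL, hv⟩)
  · simp only [List.flatten_cons, List.cons_append, List.mem_cons] at hx' ⊢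
    exact Or.inr hx'
  -- If `l` is empty, then `y` was a face by itself and the empty list now counts for it. Otherwise
  -- skipping `y` creates one more cycle of `φ`, which offsets the loss of one entry.
  · cases l with
    | nil =>
      have : φ y = y := by simpa [CycChain, hy] using hc
      rw [skip_eq_self this]
      simp [faceCount]
      omega
    | cons x l =>
      have hxy : φ y ≠ y := by
        simp only [CycChain, List.cons_append, List.isChain_cons_cons] at hc
        rw [hc.1]
        exact fun h' => hnd.1.1 (by simp [htwy h'])
      simp only [faceCount, List.count_cons, numCycles_skip hxy]
      simp
      omega

/-- Fixed points of the twist are removed one at a time; only the head of a list can be removed,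
hence the rotations. -/
theorem FacePerm.filter (htw : Function.Injective tw) {p : D → Bool} {A B : List D}
    (hp : ∀ y ∈ B, p y = false → tw y = y) (h : FacePerm tw π₀ φ V ((A ++ B) :: Θ)) :
    ∃ φ', FacePerm tw π₀ φ' V ((A ++ B.filter p) :: Θ) ∧ faceCount φ' V ((A ++ B.filter p) :: Θ) =
      faceCount φ V ((A ++ B) :: Θ) := by
  induction B generalizing A φ with
  | nil => exact ⟨φ, by simpa using h, by simp⟩
  | cons y B ih =>
    cases hpy : p y with
    | true =>
      have h' : FacePerm tw π₀ φ V (((A ++ [y]) ++ B) :: Θ) := by simpa using h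
      obtain ⟨φ', h1, h2⟩ := ih (fun z hz => hp z (List.mem_cons_of_mem _ hz)) h'
      refine ⟨φ', ?_, ?_⟩
      · simpa [List.filter_cons, hpy] using h1
      · simpa [List.filter_cons, hpy] using h2
    | false =>
      obtain ⟨φ₁, h1, h2⟩ := h.rotate.remove_fixed (l := B ++ A) htw (hp y (by simp) hpy)
      obtain ⟨φ', h3, h4⟩ := ih (fun z hz => hp z (List.mem_cons_of_mem _ hz)) h1.rotate
      refine ⟨φ', ?_, ?_⟩
      · simpa [List.filter_cons, hpy] using h3
      · rw [faceCount_rotate (l₁ := A) (l₂ := y :: B)]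
        rw [faceCount_rotate (l₁ := A) (l₂ := B), h2] at h4
        simpa [List.filter_cons, hpy] using h4

/-- Removing an edge whose two ends belong to the same cycle. -/
theorem FacePerm.split (htw : Function.Injective tw) {d d' : D} (hd : tw d = d') (hd' : tw d' = d)
    {l₁ l₂ : List D} (h : FacePerm tw π₀ φ V ((d :: l₁ ++ d' :: l₂) :: Θ)) :
    ∃ φ', FacePerm tw π₀ φ' V (l₁ :: l₂ :: Θ) ∧ faceCount φ' V (l₁ :: l₂ :: Θ) =
      faceCount φ V ((d :: l₁ ++ d' :: l₂) :: Θ) := by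
  have hnd := h.nodup
  have hp : ((d :: l₁ ++ d' :: l₂) :: Θ).flatten.Perm (d :: d' :: (l₁ ++ l₂ ++ Θ.flatten)) := by
    simp only [List.flatten_cons, List.cons_append, List.append_assoc]
    exact List.Perm.cons _ List.perm_middle
  have hnd' := hp.nodup_iff.1 hnd
  simp only [List.nodup_cons, List.mem_cons, List.mem_append, not_or] at hnd'
  obtain ⟨⟨hdd', ⟨hd1, hd2⟩, hd3⟩, ⟨⟨hd1', hd2'⟩, hd3'⟩, hnd''⟩ := hnd'
  have hdV : d ∉ V := fun hV => h.disj d hV (by simp)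
  have hdV' : d' ∉ V := fun hV => h.disj d' hV (by simp)
  have hc := h.cycles (d :: l₁ ++ d' :: l₂) (by simp)
  have hc' : (d :: l₁ ++ d' :: (l₂ ++ [d])).IsChain (fun x y => φ x = tw y) := by
    simpa [CycChain] using hc
  rw [List.isChain_split] at hc'
  obtain ⟨hc1, hc2⟩ := hc'
  have htw' : Function.Injective (tw ∘ swap d d') := htw.comp (swap d d').injective
  -- The element just before `d'` was sent by `φ` to `tw d' = d`. With `d` skipped it goes to `φ d`,
  -- the twist of the head of `l₁`, which closes `l₁`. The end of the list, sent to `tw d = d'`, now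
  -- closes on `d'`.
  have key : FacePerm (tw ∘ swap d d') π₀ (skip φ d) V ((d' :: l₂) :: l₁ :: Θ) := by
    refine ⟨fun x hxV hx => ?_, h.map_mem, fun x hx => ?_, fun L hL => ?_, ?_,
      fun x hx hx' => h.disj x hx (hp.mem_iff.2 ?_)⟩
    · by_cases hxd : x = d
      · subst hxd; simp
      · have hfx := h.fixed x hxV fun h' => hx (by have := hp.mem_iff.1 h'; simp at this ⊢; tauto)
        rw [skip_of_ne hxd (by rwa [hfx]), hfx]
    · have := h.map_mem x hx
      exact skip_apply_of_tw htw hd' (fun h' => hdV (h' ▸ hx)) (fun h' => hdV' (h' ▸ this))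
        (fun h' => hdV (h' ▸ this)) (h.apply_mem x hx)
    · simp only [List.mem_cons] at hL
      rcases hL with rfl | rfl | hL
      · refine IsChain.replace_last (L := d' :: l₂) hc2 (fun u hu v hv => ?_) fun u hu => ?_
        · refine skip_apply_of_tw htw hd' ?_ ?_ ?_
          · rintro rfl; simp only [List.mem_cons] at hu; tauto
          · rintro rfl; exact hd2' hv
          · rintro rfl; exact hd2 hv
        · refine skip_apply_of_tw_self hd (Ne.symm hdd') ?_
          rintro rfl; simp only [List.mem_cons] at hu; tauto
      · cases L with
        | nil => trivial
        | cons x l =>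
          simp only [List.cons_append, List.isChain_cons_cons] at hc1
          refine IsChain.replace_last (L := x :: l) hc1.2 (fun u hu v hv => ?_) fun u hu huy => ?_
          · refine skip_apply_of_tw htw hd' ?_ ?_ ?_
            · rintro rfl; exact hd1 hu
            · rintro rfl; exact hd1' (List.mem_of_mem_tail hv)
            · rintro rfl; exact hd1 (List.mem_of_mem_tail hv)
          · rw [skip_of_eq (huy.trans hd'), tw_swap_of_ne, hc1.1]
            · rintro rfl; simp at hd1
            · rintro rfl; simp at hd1'
      · refine (h.cycles L (List.mem_cons_of_mem _ hL)).imp_of_mem fun u hu v hv =>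
          skip_apply_of_tw htw hd' ?_ ?_ ?_
        · rintro rfl; exact hd3 (List.mem_flatten.2 ⟨L, hL, hu⟩)
        · rintro rfl; exact hd3' (List.mem_flatten.2 ⟨L, hL, hv⟩)
        · rintro rfl; exact hd3 (List.mem_flatten.2 ⟨L, hL, hv⟩)
    · have : ((d' :: l₂) :: l₁ :: Θ).flatten.Perm (d' :: (l₁ ++ l₂ ++ Θ.flatten)) := by
        simp only [List.flatten_cons, List.cons_append, ← List.append_assoc]
        exact List.Perm.cons _ (List.perm_append_comm.append_right _)
      rw [this.nodup_iff, List.nodup_cons]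
      exact ⟨by simp [hd1', hd2', hd3'], hnd''⟩
    · simp at hx' ⊢; tauto
  have hcount : faceCount (skip φ d) V ((d' :: l₂) :: l₁ :: Θ) =
      faceCount φ V ((d :: l₁ ++ d' :: l₂) :: Θ) := by
    cases l₁ with
    | nil =>
      have : φ d = d := by simpa [hd'] using hc1
      rw [skip_eq_self this]
      simp [faceCount]
      omega
    | cons x l =>
      have hxd : φ d ≠ d := by
        simp only [List.cons_append, List.isChain_cons_cons] at hc1
        rw [hc1.1, Ne, ← hd']
        exact fun h' => by have := htw h'; subst this; simp at hd1'
      simp only [faceCount, List.count_cons, numCycles_skip hxd]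
      simp
      omega
  obtain ⟨φ', h1, h2⟩ := key.remove_fixed htw' (by simpa using hd)
  refine ⟨φ', FacePerm.congr_tw (h1.perm (List.Perm.swap _ _ _)) (fun x hx => ?_)
    (fun x hx => ?_), by rw [← hcount, ← h2]; exact faceCount_perm (List.Perm.swap _ _ _)⟩
  · exact tw_swap_of_ne (fun h' => hdV (h' ▸ hx)) (fun h' => hdV' (h' ▸ hx))
  · simp only [List.flatten_cons, List.mem_append] at hx
    refine tw_swap_of_ne ?_ ?_ <;> rintro rfl <;> tauto

/-- Removing an edge whose two ends belong to different cycles. -/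
theorem FacePerm.merge (htw : Function.Injective tw) {d d' : D} (hd : tw d = d') (hd' : tw d' = d)
    {l₁ l₂ : List D} (h : FacePerm tw π₀ φ V ((d :: l₁) :: (d' :: l₂) :: Θ)) :
    ∃ φ', FacePerm tw π₀ φ' V ((l₂ ++ l₁) :: Θ) ∧ faceCount φ' V ((l₂ ++ l₁) :: Θ) =
      faceCount φ V ((d :: l₁) :: (d' :: l₂) :: Θ) := by
  have hnd := h.nodup
  have hp : ((d :: l₁) :: (d' :: l₂) :: Θ).flatten.Perm (d :: d' :: (l₁ ++ l₂ ++ Θ.flatten)) := by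
    simp only [List.flatten_cons, List.cons_append, List.append_assoc]
    exact List.Perm.cons _ List.perm_middle
  have hnd' := hp.nodup_iff.1 hnd
  simp only [List.nodup_cons, List.mem_cons, List.mem_append, not_or] at hnd'
  obtain ⟨⟨hdd', ⟨hd1, hd2⟩, hd3⟩, ⟨⟨hd1', hd2'⟩, hd3'⟩, hnd''⟩ := hnd'
  have hdV : d ∉ V := fun hV => h.disj d hV (by simp)
  have hdV' : d' ∉ V := fun hV => h.disj d' hV (by simp)
  have hc1 := h.cycles (d :: l₁) (by simp)
  have hc2 := h.cycles (d' :: l₂) (by simp)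
  have htw' : Function.Injective (tw ∘ swap d d') := htw.comp (swap d d').injective
  have key : FacePerm (tw ∘ swap d d') π₀ (skip φ d) V ((d' :: (l₂ ++ l₁)) :: Θ) := by
    refine ⟨fun x hxV hx => ?_, h.map_mem, fun x hx => ?_, fun L hL => ?_, ?_,
      fun x hx hx' => h.disj x hx (hp.mem_iff.2 ?_)⟩
    · by_cases hxd : x = d
      · subst hxd; simp
      · have hfx := h.fixed x hxV fun h' => hx (by have := hp.mem_iff.1 h'; simp at this ⊢; tauto)
        rw [skip_of_ne hxd (by rwa [hfx]), hfx]
    · have := h.map_mem x hx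
      exact skip_apply_of_tw htw hd' (fun h' => hdV (h' ▸ hx)) (fun h' => hdV' (h' ▸ this))
        (fun h' => hdV (h' ▸ this)) (h.apply_mem x hx)
    · simp only [List.mem_cons] at hL
      rcases hL with rfl | hL
      · have aux : ∀ z, φ d = (tw ∘ swap d d') z →
            (d' :: l₂ ++ [z]).IsChain (fun x y => skip φ d x = (tw ∘ swap d d') y) := by
          intro z hz
          refine IsChain.replace_last (L := d' :: l₂) hc2 (fun u hu v hv => ?_) fun u hu huy => ?_
          · refine skip_apply_of_tw htw hd' ?_ ?_ ?_
            · rintro rfl; simp only [List.mem_cons] at hu; tauto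
            · rintro rfl; exact hd2' hv
            · rintro rfl; exact hd2 hv
          · rw [skip_of_eq (huy.trans hd'), hz]
        cases l₁ with
        | nil =>
          have hφd : φ d = tw d := by simpa [CycChain] using hc1
          simpa [CycChain] using aux d' (by simp [hφd])
        | cons x l =>
          simp only [CycChain, List.cons_append, List.isChain_cons_cons] at hc1
          have h3 := aux x (by
            rw [tw_swap_of_ne, hc1.1]
            · rintro rfl; simp at hd1
            · rintro rfl; simp at hd1')
          have h4 : (x :: l ++ [d']).IsChain (fun x y => skip φ d x = (tw ∘ swap d d') y) := by
            refine IsChain.replace_last (L := x :: l) hc1.2 (fun u hu v hv => ?_) fun u hu => ?_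
            · refine skip_apply_of_tw htw hd' ?_ ?_ ?_
              · rintro rfl; exact hd1 hu
              · rintro rfl; exact hd1' (List.mem_of_mem_tail hv)
              · rintro rfl; exact hd1 (List.mem_of_mem_tail hv)
            · refine skip_apply_of_tw_self hd (Ne.symm hdd') ?_
              rintro rfl; exact hd1 hu
          have : (d' :: l₂ ++ x :: (l ++ [d'])).IsChain
              (fun x y => skip φ d x = (tw ∘ swap d d') y) := List.isChain_split.2 ⟨h3, h4⟩
          simpa [CycChain] using this
      · refine (h.cycles L (by simp [hL])).imp_of_mem fun u hu v hv =>
          skip_apply_of_tw htw hd' ?_ ?_ ?_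
        · rintro rfl; exact hd3 (List.mem_flatten.2 ⟨L, hL, hu⟩)
        · rintro rfl; exact hd3' (List.mem_flatten.2 ⟨L, hL, hv⟩)
        · rintro rfl; exact hd3 (List.mem_flatten.2 ⟨L, hL, hv⟩)
    · have : ((d' :: (l₂ ++ l₁)) :: Θ).flatten.Perm (d' :: (l₁ ++ l₂ ++ Θ.flatten)) := by
        simp only [List.flatten_cons, List.cons_append]
        exact List.Perm.cons _ (List.perm_append_comm.append_right _)
      rw [this.nodup_iff, List.nodup_cons]
      exact ⟨by simp [hd1', hd2', hd3'], hnd''⟩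
    · simp at hx' ⊢; tauto
  have hcount : faceCount (skip φ d) V ((d' :: (l₂ ++ l₁)) :: Θ) =
      faceCount φ V ((d :: l₁) :: (d' :: l₂) :: Θ) := by
    have hxd : φ d ≠ d := by
      cases l₁ with
      | nil =>
        have hφd : φ d = tw d := by simpa [CycChain] using hc1
        rw [hφd, hd]; exact Ne.symm hdd'
      | cons x l =>
        simp only [CycChain, List.cons_append, List.isChain_cons_cons] at hc1
        rw [hc1.1, Ne, ← hd']
        exact fun h' => by have := htw h'; subst this; simp at hd1'
    simp only [faceCount, List.count_cons, numCycles_skip hxd]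
    simp
    omega
  obtain ⟨φ', h1, h2⟩ := key.remove_fixed htw' (by simpa using hd)
  refine ⟨φ', FacePerm.congr_tw h1 (fun x hx => ?_) (fun x hx => ?_), by rw [← hcount, ← h2]⟩
  · exact tw_swap_of_ne (fun h' => hdV (h' ▸ hx)) (fun h' => hdV' (h' ▸ hx))
  · simp only [List.flatten_cons, List.mem_append] at hx
    refine tw_swap_of_ne ?_ ?_ <;> rintro rfl <;> tauto

end Faces

/-! ### Exploration of a loop system and its Euler count -/

section Exploration

variable {E : Type} {σ τ : Perm E} {c : E → Bool}

/-- The first half-edge, counterclockwise, of the arc `e` after its dashed end. The half-edges are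
`(e, true)`, the outgoing one, and `(e, false)`, the incoming one; `c e` tells whether the dashed
end lies on the right of the arc. -/
def firstDart (c : E → Bool) (e : E) : E × Bool := (e, c e)

/-- Following a dashed edge from its end on the arc `e` to its end on the arc `τ e`. -/
def twist (τ : Perm E) (c : E → Bool) (x : E × Bool) : E × Bool :=
  if x.2 = c x.1 then (τ x.1, c (τ x.1)) else x

theorem twist_firstDart (τ : Perm E) (c : E → Bool) (e : E) :
    twist τ c (firstDart c e) = firstDart c (τ e) := by simp [twist, firstDart]

theorem twist_of_ne {x : E × Bool} (h : x.2 ≠ c x.1) : twist τ c x = x := by simp [twist, h]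

theorem twist_injective (τ : Perm E) (c : E → Bool) : Function.Injective (twist τ c) := by
  rintro ⟨e, b⟩ ⟨f, b'⟩ h
  by_cases h1 : b = c e <;> by_cases h2 : b' = c f <;>
    simp [twist, h1, h2] at h ⊢
  · exact ⟨h.1, by rw [h.1]⟩
  · exact absurd h.2.symm (by rw [h.1]; exact h2)
  · exact absurd h.2 (by rw [← h.1]; exact h1)
  · exact h

/-- Moving along the two sides of a loop. -/
def sideNext (σ : Perm E) (x : E × Bool) : E × Bool :=
  (if x.2 then σ x.1 else σ.symm x.1, x.2)

/-- The list `v` is a path of `σ` from `e` to `f`, end points excluded. -/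
def IsPath (σ : Perm E) (e : E) (v : List E) (f : E) : Prop :=
  (e :: v ++ [f]).IsChain fun x y => σ x = y

/-- The ends on the left of the path `v`, in reverse order. -/
def leftEnds (c : E → Bool) (v : List E) : List E := (v.filter fun e => !c e).reverse

/-- The ends on the right of the path `v`. -/
def rightEnds (c : E → Bool) (v : List E) : List E := v.filter c

theorem IsPath.mem_iff {e : E} {v : List E} (hv : IsPath σ e v e) (x : E) :
    σ x ∈ e :: v ↔ x ∈ e :: v := by
  obtain ⟨h1, h2⟩ := exists_rel_of_isChain hv
  have hm : ∀ y, y ∈ v ++ [e] ↔ y ∈ e :: v := fun y => by simp [or_comm]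
  constructor
  · intro h
    obtain ⟨z, hz, hzx⟩ := h1 _ ((hm _).2 h)
    rwa [← σ.injective hzx]
  · intro h
    obtain ⟨y, hy, hxy⟩ := h2 x h
    rw [hxy]
    exact (hm _).1 hy

theorem IsPath.mem_of_closed {T : Set E} (hσ : ∀ e ∈ T, σ e ∈ T) {e f : E} {v : List E}
    (hv : IsPath σ e v f) (he : e ∈ T) : ∀ x ∈ e :: v, x ∈ T := by
  induction v generalizing e with
  | nil => intro x hx; simp only [List.mem_singleton] at hx; rwa [hx]
  | cons y w ihw =>
    intro x hx
    simp only [IsPath, List.cons_append, List.isChain_cons_cons] at hv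
    rcases List.mem_cons.1 hx with rfl | hx
    · exact he
    · exact ihw hv.2 (hv.1 ▸ hσ e he) x hx

theorem filter_map_eq_map_firstDart (c : E → Bool) (b : Bool) (v : List E) :
    (v.map fun x => (x, b)).filter (fun x => x.2 == c x.1) =
      (v.filter fun x => b == c x).map (firstDart c) := by
  rw [List.filter_map]
  refine List.map_congr_left fun x hx => ?_
  have := (List.mem_filter.1 hx).2
  simp only [Function.comp_apply, beq_iff_eq] at this
  simp [firstDart, this]

theorem exists_isPath [Finite E] (σ : Perm E) (e : E) : ∃ v, (e :: v).Nodup ∧ IsPath σ e v e ∧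
    ∀ x ∈ v, ∃ i : ℕ, x = (σ ^ i) e := by
  obtain ⟨n, hn⟩ : ∃ n, Function.minimalPeriod σ e = n + 1 := by
    refine Nat.exists_eq_succ_of_ne_zero (Function.minimalPeriod_pos_of_mem_periodicPts ?_).ne'
    exact Function.mem_periodicPts.2 ⟨orderOf σ, orderOf_pos σ, by
      rw [Function.IsPeriodicPt, Function.IsFixedPt, ← Perm.coe_pow, pow_orderOf_eq_one]; rfl⟩
  have h1 : (e :: (List.range n).map fun i => (σ ^ (i + 1)) e) =
      (List.range (n + 1)).map fun i => (σ ^ i) e := by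
    rw [List.range_succ_eq_map]; simp [Function.comp_def]
  have h2 : (e :: (List.range n).map fun i => (σ ^ (i + 1)) e) ++ [e] =
      (List.range (n + 2)).map fun i => (σ ^ i) e := by
    rw [h1, List.range_succ (n := n + 1), List.map_append, List.map_singleton]
    congr 2
    have := Function.iterate_minimalPeriod (f := σ) (x := e)
    rw [hn, ← Perm.coe_pow] at this
    exact this.symm
  refine ⟨(List.range n).map fun i => (σ ^ (i + 1)) e, ?_, ?_, ?_⟩
  · rw [h1]
    refine List.Nodup.map_on (fun i hi j hj hij => ?_) List.nodup_range
    refine Function.iterate_injOn_Iio_minimalPeriod (f := σ) (x := e) ?_ ?_ ?_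
    · rw [Set.mem_Iio, hn]; exact List.mem_range.1 hi
    · rw [Set.mem_Iio, hn]; exact List.mem_range.1 hj
    · simpa only [Perm.coe_pow] using hij
  · rw [IsPath, h2, List.isChain_map]
    refine List.IsChain.imp (fun i j hij => ?_) ((List.isChain_range_succ (fun i j => j = i + 1) (n + 1)).2
      fun m _ => rfl)
    subst hij
    rw [pow_succ', Perm.mul_apply]
  · intro x hx
    obtain ⟨i, -, rfl⟩ := List.mem_map.1 hx
    exact ⟨i + 1, rfl⟩

variable [DecidableEq E]

/-- The exploration of a system of loops `σ` and dashed edges `τ`, with undiscovered part `U` and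
a stack `S` of boundaries, merges two boundaries `g` times. -/
inductive Run (σ τ : Perm E) (c : E → Bool) : Finset E → List (List E) → ℕ → Prop
  | done : Run σ τ c ∅ [] 0
  | pop {U : Finset E} {S : List (List E)} {g : ℕ} (h : Run σ τ c U S g) : Run σ τ c U ([] :: S) g
  | split {U : Finset E} {S : List (List E)} {g : ℕ} {d : E} {l : List E} (l₁ l₂ : List E)
      (hl : l = l₁ ++ τ d :: l₂) (h : Run σ τ c U (l₁ :: l₂ :: S) g) : Run σ τ c U ((d :: l) :: S) g
  -- The increment is an equation so that an inversion at count `0` becomes a contradiction in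
  -- arithmetic.
  | merge {U : Finset E} {S : List (List E)} {g g' : ℕ} {d : E} {l : List E} (l₁ l₂ : List E)
      (S₁ S₂ : List (List E)) (hS : S = S₁ ++ (l₂ ++ τ d :: l₁) :: S₂) (hg : g' = g + 1)
      (h : Run σ τ c U ((l₁ ++ l₂ ++ l) :: (S₁ ++ S₂)) g) : Run σ τ c U ((d :: l) :: S) g'
  -- The rest `l` of the current boundary lies on the side of the new loop from which the dashed
  -- edge arrives. Right ends are met along the loop, left ends against it.
  | loop {U : Finset E} {S : List (List E)} {g : ℕ} {d : E} {l : List E} (v : List E)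
      (hU : ∀ e ∈ τ d :: v, e ∈ U) (hnd : (τ d :: v).Nodup) (hv : IsPath σ (τ d) v (τ d))
      (h : Run σ τ c (U \ (τ d :: v).toFinset)
        ((leftEnds c v ++ if c (τ d) then [] else l) ::
          ((if c (τ d) then l else []) ++ rightEnds c v) :: S) g) :
      Run σ τ c U ((d :: l) :: S) g

variable {φ : Perm (E × Bool)} {U : Finset E} {Θ : List (List (E × Bool))}

/-- A loop gives two cycles of `sideNext σ`: its right side, run forwards on the half-edges marked
`true`, and its left side, run backwards on those marked `false`. -/
theorem FacePerm.add_sides (h : FacePerm (twist τ c) (sideNext σ) φ (U ×ˢ Finset.univ) Θ)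
    {e : E} {v : List E} (hU : ∀ x ∈ e :: v, x ∈ U) (hnd : (e :: v).Nodup) (hv : IsPath σ e v e) :
    FacePerm (twist τ c) (sideNext σ) φ ((U \ (e :: v).toFinset) ×ˢ Finset.univ)
      ((e :: v).map (fun x => (x, true)) :: (e :: v.reverse).map (fun x => (x, false)) :: Θ) := by
  have hmem : ∀ x ∈ e :: v, ∀ b, (x, b) ∈ U ×ˢ (Finset.univ : Finset Bool) := fun x hx b => by
    simp only [Finset.mem_product, Finset.mem_univ, and_true]; exact hU x hx
  have hrev : ∀ x, x ∈ e :: v.reverse ↔ x ∈ e :: v := fun x => by simp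
  have hsub : ∀ x, x ∈ (U \ (e :: v).toFinset) ×ˢ (Finset.univ : Finset Bool) ↔
      x ∈ U ×ˢ (Finset.univ : Finset Bool) ∧ x.1 ∉ e :: v := fun x => by
    simp only [Finset.mem_product, Finset.mem_sdiff, List.mem_toFinset, Finset.mem_univ, and_true]
  have hflat : ∀ x : E × Bool, x ∈ ((e :: v).map (fun x => (x, true)) ::
      (e :: v.reverse).map (fun x => (x, false)) :: Θ).flatten ↔ x.1 ∈ e :: v ∨ x ∈ Θ.flatten := by
    rintro ⟨x, b⟩
    rw [List.flatten_cons, List.flatten_cons, List.mem_append, List.mem_append, ← or_assoc]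
    refine or_congr_left ?_
    simp only [List.mem_map, Prod.mk.injEq, hrev]
    cases b <;> simp
  refine ⟨fun x hx hx' => ?_, fun x hx => ?_, fun x hx => ?_, fun L hL => ?_, ?_, fun x hx hx' => ?_⟩
  · rw [hflat, not_or] at hx'
    rw [hsub, not_and_not_right] at hx
    exact h.fixed x (fun h' => hx'.1 (hx h')) hx'.2
  · rw [hsub] at hx ⊢
    refine ⟨h.map_mem x hx.1, ?_⟩
    rcases x with ⟨x, _ | _⟩
    · simp only [sideNext]
      rw [← hv.mem_iff]
      simpa using hx.2
    · simp only [sideNext, if_true, hv.mem_iff]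
      exact hx.2
  · exact h.apply_mem x ((hsub x).1 hx).1
  · simp only [List.mem_cons] at hL
    rcases hL with rfl | rfl | hL
    · have : ((e :: v ++ [e]).map (fun x => (x, true))).IsChain
          (fun x y => φ x = twist τ c y) := by
        rw [List.isChain_map]
        refine List.IsChain.imp_of_mem_imp (fun x y hx hy hxy => ?_) hv
        rw [h.apply_mem _ (hmem x (by simpa [or_comm] using hx) true), sideNext]
        simp [hxy]
      simpa [CycChain] using this
    · have hv' : (e :: v.reverse ++ [e]).IsChain (fun x y => σ y = x) := by
        have := List.isChain_reverse.2 hv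
        simpa using this
      have : ((e :: v.reverse ++ [e]).map (fun x => (x, false))).IsChain
          (fun x y => φ x = twist τ c y) := by
        rw [List.isChain_map]
        refine List.IsChain.imp_of_mem_imp (fun x y hx hy hxy => ?_) hv'
        rw [h.apply_mem _ (hmem x (by simpa [or_comm] using hx) false), sideNext]
        simp [← hxy]
      simpa [CycChain] using this
    · exact h.cycles L hL
  · have hd : ∀ x ∈ e :: v, ∀ b, (x, b) ∉ Θ.flatten := fun x hx b => h.disj _ (hmem x hx b)
    rw [List.flatten_cons, List.flatten_cons, List.nodup_append', List.nodup_append']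
    refine ⟨hnd.map fun _ _ h => congrArg Prod.fst h, ⟨?_, h.nodup, ?_⟩, ?_⟩
    · refine List.Nodup.map (fun _ _ h => congrArg Prod.fst h) ?_
      rw [List.nodup_cons] at hnd ⊢
      simpa using hnd
    · intro x hx
      obtain ⟨y, hy, rfl⟩ := List.mem_map.1 hx
      exact hd y ((hrev y).1 hy) false
    · intro x hx hx'
      obtain ⟨y, hy, rfl⟩ := List.mem_map.1 hx
      rcases List.mem_append.1 hx' with hx' | hx'
      · simp at hx'
      · exact hd y hy true hx'
  · rw [hsub] at hx
    rw [hflat] at hx'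
    exact hx'.elim hx.2 (h.disj x hx.1)

theorem faceCount_add_sides {e : E} {v : List E} (hU : ∀ x ∈ e :: v, x ∈ U)
    (hnd : (e :: v).Nodup) :
    faceCount φ ((U \ (e :: v).toFinset) ×ˢ Finset.univ)
      ((e :: v).map (fun x => (x, true)) :: (e :: v.reverse).map (fun x => (x, false)) :: Θ) =
    faceCount φ (U ×ˢ Finset.univ) Θ := by
  have h1 : (e :: v).toFinset ⊆ U := fun x hx => hU x (List.mem_toFinset.1 hx)
  have h2 := Finset.card_sdiff_add_card_eq_card h1
  rw [List.toFinset_card_of_nodup hnd] at h2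
  simp only [faceCount, Finset.card_product, List.flatten_cons, List.length_append,
    List.length_map, List.length_cons, List.length_reverse, Finset.card_univ, Fintype.card_bool]
  simp only [List.length_cons, List.toFinset_cons] at h2
  simp
  omega

variable [Fintype E]

/-- Discovering a loop. -/
theorem FacePerm.discover (h : FacePerm (twist τ c) (sideNext σ) φ (U ×ˢ Finset.univ) Θ)
    {e : E} {v : List E} (hU : ∀ x ∈ e :: v, x ∈ U) (hnd : (e :: v).Nodup) (hv : IsPath σ e v e) :
    ∃ φ', FacePerm (twist τ c) (sideNext σ) φ' ((U \ (e :: v).toFinset) ×ˢ Finset.univ)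
        ((leftEnds c v ++ if c e then [] else [e]).map (firstDart c) ::
          ((if c e then [e] else []) ++ rightEnds c v).map (firstDart c) :: Θ) ∧
      faceCount φ' ((U \ (e :: v).toFinset) ×ˢ Finset.univ)
        ((leftEnds c v ++ if c e then [] else [e]).map (firstDart c) ::
          ((if c e then [e] else []) ++ rightEnds c v).map (firstDart c) :: Θ) =
      faceCount φ (U ×ˢ Finset.univ) Θ := by
  have htw := twist_injective τ c
  have hp : ∀ B : List (E × Bool), ∀ y ∈ B, (y.2 == c y.1) = false → twist τ c y = y :=
    fun B y _ hy => twist_of_ne (by simpa using hy)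
  -- Half-edges on a side without dashed end are fixed by `twist` and can be dropped from the two
  -- sides.
  obtain ⟨φ₁, h1, h1'⟩ := (h.add_sides hU hnd hv).filter (A := [])
    (B := (e :: v).map fun x => (x, true)) htw (hp _)
  have h1s := h1.perm (List.Perm.swap _ _ _)
  obtain ⟨φ₂, h2, h2'⟩ := h1s.filter (A := []) (B := (e :: v.reverse).map fun x => (x, false))
    htw (hp _)
  -- The left side is listed from `e`, but the arc `e` has to come last; a rotation repairs this.
  have hl : ∃ l₁ l₂, [] ++ ((e :: v.reverse).map fun x => (x, false)).filter (fun x => x.2 == c x.1) =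
      l₁ ++ l₂ ∧ (leftEnds c v ++ if c e then [] else [e]).map (firstDart c) = l₂ ++ l₁ := by
    rw [filter_map_eq_map_firstDart]
    refine ⟨(if c e then [] else [e]).map (firstDart c), (leftEnds c v).map (firstDart c), ?_, ?_⟩
    · rw [leftEnds, ← List.filter_reverse]
      cases hc : c e <;> simp [hc]
    · rw [List.map_append]
  have hr : [] ++ ((e :: v).map fun x => (x, true)).filter (fun x => x.2 == c x.1) =
      ((if c e then [e] else []) ++ rightEnds c v).map (firstDart c) := by
    rw [filter_map_eq_map_firstDart, rightEnds]
    cases hc : c e <;> simp [hc]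
  rw [hr] at h1' h2 h2'
  obtain ⟨l₁, l₂, hl1, hl2⟩ := hl
  rw [hl1] at h2 h2'
  rw [hl2]
  refine ⟨φ₂, h2.rotate, ?_⟩
  rw [faceCount_rotate, h2', faceCount_perm (List.Perm.swap _ _ _), List.nil_append, h1',
    List.nil_append, faceCount_add_sides hU hnd]

theorem FacePerm.pop {D : Type} [DecidableEq D] {tw π₀ : D → D} {φ : Perm D} {V : Finset D}
    {Θ : List (List D)} (h : FacePerm tw π₀ φ V ([] :: Θ)) : FacePerm tw π₀ φ V Θ :=
  ⟨by simpa using h.fixed, h.map_mem, h.apply_mem, fun L hL => h.cycles L (by simp [hL]),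
    by simpa using h.nodup, by simpa using h.disj⟩

/-- Every merge lowers the number of faces by `2`. -/
theorem Run.faceCount_eq (hτ : ∀ e, τ (τ e) = e) {S : List (List E)} {g : ℕ}
    (h : Run σ τ c U S g) (hφ : FacePerm (twist τ c) (sideNext σ) φ (U ×ˢ Finset.univ)
      (S.map (List.map (firstDart c)))) :
    2 * faceCount φ (U ×ˢ Finset.univ) (S.map (List.map (firstDart c))) + 4 * g =
      2 * Fintype.card (E × Bool) + (U.card + S.flatten.length) + 2 * S.length := by
  have htw := twist_injective τ c
  -- Each followed edge uses up two ends. In the cases `split` and `loop` there is one more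
  -- boundary, which makes up for them. A `merge` loses a boundary as well, and the deficit of `4`
  -- is absorbed by `4 * g`. A `pop` removes an empty boundary, which counted as one face.
  induction h generalizing φ with
  | done =>
    have : φ = 1 := Equiv.ext fun x => hφ.fixed x (by simp) (by simp)
    subst this
    simp [faceCount, numCycles_one]
  | pop h ih =>
    have h1 := ih hφ.pop
    simp only [faceCount, List.map_cons, List.map_nil, List.count_cons, List.flatten_cons,
      List.length_cons, List.nil_append] at h1 ⊢
    simp at h1 ⊢
    omega
  | @split U S g d l l₁ l₂ hl h ih =>
    subst hl
    have hφ' : FacePerm (twist τ c) (sideNext σ) φ (U ×ˢ Finset.univ)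
        ((firstDart c d :: l₁.map (firstDart c) ++
          firstDart c (τ d) :: l₂.map (firstDart c)) :: S.map (List.map (firstDart c))) := by
      simpa using hφ
    obtain ⟨φ', h1, h2⟩ := hφ'.split htw (twist_firstDart τ c d)
      (by rw [twist_firstDart, hτ])
    have h3 := ih h1
    simp only [List.map_cons] at h3
    rw [h2] at h3
    simp only [List.flatten_cons, List.length_append, List.length_cons, List.map_cons,
      List.map_append, List.cons_append] at h3 ⊢
    omega
  | @merge U S g g' d l l₁ l₂ S₁ S₂ hS hg h ih =>
    subst hS hg
    set F := List.map (firstDart c)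
    have hp : ((d :: l) :: (S₁ ++ (l₂ ++ τ d :: l₁) :: S₂)).Perm
        ((l₂ ++ τ d :: l₁) :: (d :: l) :: (S₁ ++ S₂)) :=
      (List.Perm.cons _ List.perm_middle).trans (List.Perm.swap _ _ _)
    have hφ1 : FacePerm (twist τ c) (sideNext σ) φ (U ×ˢ Finset.univ)
        ((F l₂ ++ firstDart c (τ d) :: F l₁) :: (firstDart c d :: F l) :: (S₁ ++ S₂).map F) := by
      simpa [F] using hφ.perm (hp.map F)
    have hφ2 := hφ1.rotate.perm (List.Perm.swap _ _ _)
    obtain ⟨φ', h1, h2⟩ := hφ2.merge (l₂ := F l₁ ++ F l₂) htw (twist_firstDart τ c d)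
      (by rw [twist_firstDart, hτ])
    have h3 := ih (φ := φ') (by simpa [F] using h1)
    have h4 : faceCount φ (U ×ˢ Finset.univ)
        (((d :: l) :: (S₁ ++ (l₂ ++ τ d :: l₁) :: S₂)).map F) =
        faceCount φ' (U ×ˢ Finset.univ) (((l₁ ++ l₂ ++ l) :: (S₁ ++ S₂)).map F) := by
      rw [faceCount_perm (hp.map F)]
      have e1 : (((l₁ ++ l₂ ++ l) :: (S₁ ++ S₂)).map F) =
        (F l₁ ++ F l₂ ++ F l) :: (S₁ ++ S₂).map F := by simp [F]
      have e2 : (((l₂ ++ τ d :: l₁) :: (d :: l) :: (S₁ ++ S₂)).map F) =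
        (F l₂ ++ firstDart c (τ d) :: F l₁) :: (firstDart c d :: F l) :: (S₁ ++ S₂).map F := by
        simp [F]
      rw [e1, e2, h2, faceCount_rotate, faceCount_perm (List.Perm.swap _ _ _)]
      rfl
    rw [h4]
    simp only [List.flatten_cons, List.length_append, List.length_cons, List.flatten_append]
      at h3 ⊢
    omega
  | @loop U S g d l v hU hnd hv h ih =>
    set F := List.map (firstDart c)
    obtain ⟨φ₁, h1, h1'⟩ := hφ.discover hU hnd hv
    have hcard : (U \ (τ d :: v).toFinset).card + (v.length + 1) = U.card := by
      have h1 : (τ d :: v).toFinset ⊆ U := fun x hx => hU x (List.mem_toFinset.1 hx)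
      have h2 := Finset.card_sdiff_add_card_eq_card h1
      rwa [List.toFinset_card_of_nodup hnd] at h2
    have hlen : (leftEnds c v).length + (rightEnds c v).length = v.length := by
      rw [leftEnds, rightEnds, List.length_reverse, add_comm,
        ← List.length_eq_length_filter_add]
    -- The two sides of the loop are new boundaries, and the edge from `d` to `τ d` joins the
    -- current boundary to the side containing `τ d`. This joining costs no genus, since the loop is
    -- new.
    have key : ∃ φ', FacePerm (twist τ c) (sideNext σ) φ'
          ((U \ (τ d :: v).toFinset) ×ˢ Finset.univ)
          (((leftEnds c v ++ if c (τ d) then [] else l) ::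
          ((if c (τ d) then l else []) ++ rightEnds c v) :: S).map F) ∧
        faceCount φ' ((U \ (τ d :: v).toFinset) ×ˢ Finset.univ)
          (((leftEnds c v ++ if c (τ d) then [] else l) ::
          ((if c (τ d) then l else []) ++ rightEnds c v) :: S).map F) =
        faceCount φ (U ×ˢ Finset.univ) (((d :: l) :: S).map F) := by
      set V' : Finset (E × Bool) := (U \ (τ d :: v).toFinset) ×ˢ Finset.univ
      rw [← h1']
      cases hc : c (τ d) with
      | true =>
        simp only [hc, if_true, List.append_nil, List.singleton_append] at h1 ⊢
        have hp : (F (leftEnds c v) :: F (τ d :: rightEnds c v) :: F (d :: l) :: S.map F).Perm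
            (F (d :: l) :: F (τ d :: rightEnds c v) :: F (leftEnds c v) :: S.map F) := by
          refine (List.Perm.swap _ _ _).trans ((List.Perm.cons _ (List.Perm.swap _ _ _)).trans
            (List.Perm.swap _ _ _))
        obtain ⟨φ', h2, h3⟩ := (h1.perm hp).merge htw (twist_firstDart τ c d)
          (by rw [twist_firstDart, hτ])
        refine ⟨φ', ?_, ?_⟩
        · simpa [F] using h2.rotate.perm (List.Perm.swap _ _ _)
        · refine Eq.trans ?_ (h3.trans (faceCount_perm hp).symm)
          rw [faceCount_rotate, faceCount_perm (List.Perm.swap _ _ _)]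
          simp [F]
      | false =>
        simp only [hc, List.nil_append, Bool.false_eq_true, if_false] at h1 ⊢
        have h1r : FacePerm (twist τ c) (sideNext σ) φ₁ V'
            ((F (leftEnds c v) ++ [firstDart c (τ d)]) :: F (rightEnds c v) :: F (d :: l) ::
              S.map F) := by simpa [F] using h1
        have hp : (([firstDart c (τ d)] ++ F (leftEnds c v)) :: F (rightEnds c v) :: F (d :: l) ::
            S.map F).Perm (F (d :: l) :: ([firstDart c (τ d)] ++ F (leftEnds c v)) ::
              F (rightEnds c v) :: S.map F) :=
          (List.Perm.cons _ (List.Perm.swap _ _ _)).trans (List.Perm.swap _ _ _)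
        obtain ⟨φ', h2, h3⟩ := (h1r.rotate.perm hp).merge htw (twist_firstDart τ c d)
          (by rw [twist_firstDart, hτ])
        refine ⟨φ', ?_, ?_⟩
        · simpa [F] using h2
        · have e1 : faceCount φ₁ V' (F (leftEnds c v ++ [τ d]) :: F (rightEnds c v) ::
              ((d :: l) :: S).map F) = faceCount φ₁ V' ((F (leftEnds c v) ++
              [firstDart c (τ d)]) :: F (rightEnds c v) :: F (d :: l) :: S.map F) := by simp [F]
          rw [e1, faceCount_rotate, faceCount_perm hp]
          refine Eq.trans ?_ h3
          simp [F]
    obtain ⟨φ', h2, h2'⟩ := key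
    have h3 := ih h2
    rw [h2'] at h3
    cases hc : c (τ d) <;>
    · simp only [hc, if_true, Bool.false_eq_true, if_false, List.append_nil, List.nil_append,
        List.flatten_cons, List.length_append, List.length_cons] at h3 ⊢
      omega

/-- Closed subsets containing the boundaries contain everything that gets explored. -/
theorem Run.subset_of_closed {S : List (List E)} {g : ℕ} (h : Run σ τ c U S g) {T : Set E}
    (hσ : ∀ e ∈ T, σ e ∈ T) (hτ : ∀ e ∈ T, τ e ∈ T) (hS : ∀ e ∈ S.flatten, e ∈ T) :
    ∀ e ∈ U, e ∈ T := by
  induction h with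
  | done => simp
  | pop h ih => exact ih (by simpa using hS)
  | split l₁ l₂ hl h ih =>
    subst hl
    refine ih fun e he => hS e ?_
    simp only [List.flatten_cons, List.mem_append, List.mem_cons] at he ⊢
    tauto
  | merge l₁ l₂ S₁ S₂ hS' hg h ih =>
    subst hS'
    refine ih fun e he => hS e ?_
    simp only [List.flatten_cons, List.flatten_append, List.mem_append, List.mem_cons] at he ⊢
    tauto
  | @loop U S g d l v hU hnd hv h ih =>
    have hloop : ∀ e ∈ τ d :: v, e ∈ T := hv.mem_of_closed hσ (hτ d (hS d (by simp)))
    have hl : ∀ e ∈ l, e ∈ T := fun e he => hS e (by simp [he])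
    have hS' : ∀ e ∈ S.flatten, e ∈ T := fun e he => hS e (by
      simp only [List.flatten_cons, List.mem_append]
      exact Or.inr he)
    intro e he
    by_cases hev : e ∈ τ d :: v
    · exact hloop e hev
    · refine ih (fun x hx => ?_) e (by simp only [Finset.mem_sdiff, List.mem_toFinset]; exact ⟨he, hev⟩)
      simp only [List.flatten_cons, List.mem_append, leftEnds, rightEnds, List.mem_reverse,
        List.mem_filter] at hx
      rcases hx with (hx | hx) | (hx | hx) | hx
      · exact hloop x (List.mem_cons_of_mem _ hx.1)
      · split_ifs at hx
        · simp at hx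
        · exact hl x hx
      · split_ifs at hx
        · exact hl x hx
        · simp at hx
      · exact hloop x (List.mem_cons_of_mem _ hx.1)
      · exact hS' x hx

/-- A connected system can be explored. -/
theorem exists_run (hτ : ∀ e, τ (τ e) = e) (hτ' : ∀ e, τ e ≠ e) (U : Finset E) (S : List (List E))
    (hnd : S.flatten.Nodup) (hdisj : ∀ e ∈ U, e ∉ S.flatten) (hσU : ∀ e ∈ U, σ e ∈ U)
    (hτU : ∀ e, e ∈ U ∨ e ∈ S.flatten → τ e ∈ U ∨ τ e ∈ S.flatten)
    (hconn : ∀ T ⊆ U, (∀ e ∈ T, σ e ∈ T) → (∀ e ∈ T, τ e ∈ T) → T = ∅) :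
    ∃ g, Run σ τ c U S g := by
  -- Following an edge removes two ends and adds at most one boundary; a `pop` removes one boundary.
  induction hN : 2 * (U.card + S.flatten.length) + S.length using Nat.strong_induction_on
    generalizing U S with
  | _ N ih =>
    subst hN
    rcases S with _ | ⟨_ | ⟨d, l⟩, S⟩
    · obtain rfl := hconn U subset_rfl hσU (by simpa using hτU)
      exact ⟨0, Run.done⟩
    · obtain ⟨g, hg⟩ := ih _ (by simp) U S (by simpa using hnd) (by simpa using hdisj) hσU
        (by simpa using hτU) hconn rfl
      exact ⟨g, hg.pop⟩
    have hd := hτU d (Or.inr (by simp))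
    have hcase : τ d ∈ U ∨ τ d ∈ l ∨ ∃ L ∈ S, τ d ∈ L := by
      simpa [hτ' d] using hd
    -- In each case exactly `d` and `τ d` disappear, and what remains is again closed under `τ`.
    have closed : ∀ (U' : Finset E) (S' : List (List E)),
        (∀ e, (e ∈ U' ∨ e ∈ S'.flatten) ↔
          (e ∈ U ∨ e ∈ ((d :: l) :: S).flatten) ∧ e ≠ d ∧ e ≠ τ d) →
        ∀ e, e ∈ U' ∨ e ∈ S'.flatten → τ e ∈ U' ∨ τ e ∈ S'.flatten := by
      intro U' S' h e he
      rw [h] at he ⊢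
      refine ⟨hτU e he.1, fun h' => he.2.2 ?_, fun h' => he.2.1 (τ.injective h')⟩
      rw [← h', hτ]
    rcases hcase with hU | hl | ⟨L, hL, hdL⟩
    · obtain ⟨v, hv1, hv2, hv3⟩ := exists_isPath σ (τ d)
      have hpow : ∀ i : ℕ, (σ ^ i) (τ d) ∈ U := by
        intro i
        induction i with
        | zero => simpa using hU
        | succ i ih' => rw [pow_succ', Perm.mul_apply]; exact hσU _ ih'
      have hvU : ∀ e ∈ τ d :: v, e ∈ U := by
        intro e he
        rcases List.mem_cons.1 he with rfl | he
        · exact hU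
        · obtain ⟨i, rfl⟩ := hv3 e he
          exact hpow i
      have hperm : ((leftEnds c v ++ if c (τ d) then [] else l) ::
          ((if c (τ d) then l else []) ++ rightEnds c v) :: S).flatten.Perm
          (v ++ l ++ S.flatten) := by
        have hvp : (leftEnds c v ++ rightEnds c v).Perm v := by
          rw [leftEnds, rightEnds]
          refine ((List.reverse_perm _).append_right _).trans ?_
          exact List.perm_append_comm.trans (List.filter_append_perm c v)
        rw [List.flatten_cons, List.flatten_cons, ← List.append_assoc]
        refine List.Perm.append_right _ ?_
        cases c (τ d)
        · simp only [Bool.false_eq_true, if_false, List.nil_append, List.append_assoc]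
          refine List.Perm.trans (List.Perm.append_left _ List.perm_append_comm) ?_
          rw [← List.append_assoc]
          exact hvp.append_right _
        · simp only [if_true, List.append_nil]
          refine List.Perm.trans (List.Perm.append_left _ List.perm_append_comm) ?_
          rw [← List.append_assoc]
          exact hvp.append_right _
      have hlen := hperm.length_eq
      have hcard : (U \ (τ d :: v).toFinset).card + (v.length + 1) = U.card := by
        have h1 : (τ d :: v).toFinset ⊆ U := fun x hx => hvU x (List.mem_toFinset.1 hx)
        have h2 := Finset.card_sdiff_add_card_eq_card h1
        rwa [List.toFinset_card_of_nodup hv1] at h2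
      rw [List.flatten_cons, List.cons_append, List.nodup_cons, List.mem_append, not_or] at hnd
      have hdU : d ∉ U := fun h => hdisj d h (by simp)
      have hflat : ∀ e ∈ U, e ∉ l ++ S.flatten := fun e he h => hdisj e he (by
        rw [List.flatten_cons, List.cons_append]; exact List.mem_cons_of_mem _ h)
      refine Exists.elim (ih _ ?_ (U \ (τ d :: v).toFinset) _ (hperm.nodup_iff.2 ?_)
        (fun e he => fun h => ?_) (fun e he => ?_) (closed _ _ fun e => ?_)
        (fun T hT => hconn T (hT.trans Finset.sdiff_subset)) rfl) fun g hg => ⟨g, Run.loop v hvU hv1 hv2 hg⟩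
      · rw [hlen]
        simp only [List.length_append, List.length_cons, List.flatten_cons]
        omega
      · rw [List.append_assoc, List.nodup_append']
        exact ⟨(List.nodup_cons.1 hv1).2, hnd.2, fun e he he' =>
          hflat e (hvU e (List.mem_cons_of_mem _ he)) he'⟩
      · rw [hperm.mem_iff, List.append_assoc, List.mem_append] at h
        simp only [Finset.mem_sdiff, List.mem_toFinset] at he
        exact h.elim (fun h => he.2 (List.mem_cons_of_mem _ h)) (hflat e he.1)
      · simp only [Finset.mem_sdiff, List.mem_toFinset] at he ⊢
        exact ⟨hσU e he.1, fun h => he.2 ((hv2.mem_iff e).1 h)⟩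
      · rw [hperm.mem_iff, List.append_assoc, List.mem_append, List.flatten_cons, List.cons_append,
          List.mem_cons]
        simp only [Finset.mem_sdiff, List.mem_toFinset, List.mem_cons, not_or]
        constructor
        · rintro (⟨h1, h2, h3⟩ | h | h)
          · exact ⟨Or.inl h1, fun h => hdU (h ▸ h1), h2⟩
          · have h1 := hvU e (List.mem_cons_of_mem _ h)
            refine ⟨Or.inl h1, fun h => hdU (h ▸ h1), fun h' => ?_⟩
            subst h'
            exact (List.nodup_cons.1 hv1).1 h
          · refine ⟨Or.inr (Or.inr h), fun h' => ?_, fun h' => ?_⟩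
            · subst h'
              exact (List.mem_append.1 h).elim hnd.1.1 hnd.1.2
            · subst h'
              exact hflat _ hU h
        · rintro ⟨h1 | h1 | h1, h2, h3⟩
          · by_cases hev : e ∈ v
            · exact Or.inr (Or.inl hev)
            · exact Or.inl ⟨h1, h3, hev⟩
          · exact absurd h1 h2
          · exact Or.inr (Or.inr h1)
    · obtain ⟨l₁, l₂, rfl⟩ := List.append_of_mem hl
      have hperm : ((d :: (l₁ ++ τ d :: l₂)) :: S).flatten.Perm
          (d :: τ d :: (l₁ :: l₂ :: S).flatten) := by
        simp only [List.flatten_cons, List.cons_append, List.append_assoc]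
        exact List.Perm.cons _ List.perm_middle
      have hnd' := hperm.nodup_iff.1 hnd
      simp only [List.nodup_cons, List.mem_cons, not_or] at hnd'
      have hlen := hperm.length_eq
      simp only [List.length_cons] at hlen
      refine Exists.elim (ih _ ?_ U (l₁ :: l₂ :: S) hnd'.2.2 (fun e he h => ?_) hσU
        (closed _ _ fun e => ?_) hconn rfl) fun g hg => ⟨g, Run.split l₁ l₂ rfl hg⟩
      · simp only [List.length_cons]; omega
      · exact hdisj e he (hperm.mem_iff.2 (by simp only [List.mem_cons]; tauto))
      · rw [hperm.mem_iff]
        simp only [List.mem_cons]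
        constructor
        · rintro (h | h)
          · have := hdisj e h
            rw [hperm.mem_iff] at this
            simp only [List.mem_cons, not_or] at this
            tauto
          · refine ⟨Or.inr (Or.inr (Or.inr h)), ?_, ?_⟩
            · rintro rfl; exact hnd'.1.2 h
            · rintro rfl; exact hnd'.2.1 h
        · tauto
    · obtain ⟨S₁, S₂, rfl⟩ := List.append_of_mem hL
      obtain ⟨l₂, l₁, rfl⟩ := List.append_of_mem hdL
      have hperm : ((d :: l) :: (S₁ ++ (l₂ ++ τ d :: l₁) :: S₂)).flatten.Perm
          (d :: τ d :: ((l₁ ++ l₂ ++ l) :: (S₁ ++ S₂)).flatten) := by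
        simp only [List.flatten_cons, List.flatten_append, List.cons_append]
        refine List.Perm.cons _ ?_
        rw [← Multiset.coe_eq_coe]
        simp only [← Multiset.coe_add, ← Multiset.cons_coe, ← Multiset.singleton_add]
        abel
      have hnd' := hperm.nodup_iff.1 hnd
      simp only [List.nodup_cons, List.mem_cons, not_or] at hnd'
      have hlen := hperm.length_eq
      simp only [List.length_cons] at hlen
      refine Exists.elim (ih _ ?_ U ((l₁ ++ l₂ ++ l) :: (S₁ ++ S₂)) hnd'.2.2 (fun e he h => ?_) hσU
        (closed _ _ fun e => ?_) hconn rfl) fun g hg => ⟨g + 1, Run.merge l₁ l₂ S₁ S₂ rfl rfl hg⟩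
      · simp only [List.length_cons, List.length_append] at hlen ⊢; omega
      · exact hdisj e he (hperm.mem_iff.2 (by simp only [List.mem_cons]; tauto))
      · rw [hperm.mem_iff]
        simp only [List.mem_cons]
        constructor
        · rintro (h | h)
          · have := hdisj e h
            rw [hperm.mem_iff] at this
            simp only [List.mem_cons, not_or] at this
            tauto
          · refine ⟨Or.inr (Or.inr (Or.inr h)), ?_, ?_⟩
            · rintro rfl; exact hnd'.1.2 h
            · rintro rfl; exact hnd'.2.1 h
        · tauto

end Exploration

/-! ### Partial loop systems -/

section Counting

variable {E : Type} [DecidableEq E]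

/-- A system of loops (the cycles of the first permutation) and dashed edges (the second one), with
the sides of the dashed ends. -/
abbrev LoopSystem (E : Type) : Type := Perm E × Perm E × (E → Bool)

/-- The dashed edges form a perfect matching. -/
def IsMatching (τ : Perm E) : Prop := (∀ e, τ (τ e) = e) ∧ ∀ e, τ e ≠ e

/-- The system `s` agrees with `s₀` on the loops outside of `A`, on the dashed edges of `s₀`, and
on the sides outside of `U`. -/
structure Agrees (s₀ : LoopSystem E) (A U : Finset E) (s : LoopSystem E) : Prop where
  loops : ∀ e, e ∉ A → s.1 e = s₀.1 e
  edges : ∀ e, s₀.2.1 e ≠ e → s.2.1 e = s₀.2.1 e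
  sides : ∀ e, e ∉ U → s.2.2 e = s₀.2.2 e
  matching : IsMatching s.2.1

/-- In the partial system `s₀`, the loops in `U` and the dashed ends in `U` and `S` are still to be
chosen. -/
structure IsPartial (s₀ : LoopSystem E) (U : Finset E) (S : List (List E)) : Prop where
  loops : ∀ e ∈ U, s₀.1 e = e
  inv : ∀ e, s₀.2.1 (s₀.2.1 e) = e
  edges : ∀ e, s₀.2.1 e = e ↔ e ∈ U ∨ e ∈ S.flatten
  nodup : S.flatten.Nodup
  disj : ∀ e ∈ U, e ∉ S.flatten

/-- Adding a dashed edge. -/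
def addEdge (s₀ : LoopSystem E) (d x : E) : LoopSystem E := (s₀.1, swap d x * s₀.2.1, s₀.2.2)

/-- Choosing the side of a dashed end. -/
def setSide (s₀ : LoopSystem E) (x : E) (β : Bool) : LoopSystem E :=
  (s₀.1, s₀.2.1, Function.update s₀.2.2 x β)

/-- Adding `f` to the loop of `e`, after `e`. -/
def addToLoop (s₀ : LoopSystem E) (e f : E) : LoopSystem E := (s₀.1 * swap e f, s₀.2.1, s₀.2.2)

variable {s₀ s : LoopSystem E} {A U : Finset E} {S : List (List E)}

theorem addEdge_apply {d x : E} (hinv : ∀ e, s₀.2.1 (s₀.2.1 e) = e) (hd : s₀.2.1 d = d)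
    (hx : s₀.2.1 x = x) :
    (addEdge s₀ d x).2.1 d = x ∧ (addEdge s₀ d x).2.1 x = d ∧
      ∀ e, e ≠ d → e ≠ x → (addEdge s₀ d x).2.1 e = s₀.2.1 e := by
  refine ⟨by simp [addEdge, hd], by simp [addEdge, hx], fun e he he' => ?_⟩
  simp only [addEdge, Perm.mul_apply]
  refine swap_apply_of_ne_of_ne (fun h => he ?_) (fun h => he' ?_)
  · rw [← hinv e, h, hd]
  · rw [← hinv e, h, hx]

/-- Recording a choice in the partial system amounts to imposing it as a condition on its
extensions. The sums below are cut into fibres with this lemma and its analogues for sides and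
loops. -/
theorem agrees_addEdge_iff {d x : E} (hinv : ∀ e, s₀.2.1 (s₀.2.1 e) = e) (hd : s₀.2.1 d = d)
    (hx : s₀.2.1 x = x) (hdx : d ≠ x) :
    Agrees (addEdge s₀ d x) A U s ↔ Agrees s₀ A U s ∧ s.2.1 d = x := by
  obtain ⟨h1, h2, h3⟩ := addEdge_apply hinv hd hx
  constructor
  · intro h
    refine ⟨⟨h.loops, fun e he => ?_, h.sides, h.matching⟩, ?_⟩
    · have hed : e ≠ d := fun h' => he (h' ▸ hd)
      have hex : e ≠ x := fun h' => he (h' ▸ hx)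
      rw [← h3 e hed hex]
      exact h.edges e (by rwa [h3 e hed hex])
    · rw [← h1]
      exact h.edges d (by rw [h1]; exact hdx.symm)
  · rintro ⟨h, hs⟩
    refine ⟨h.loops, fun e he => ?_, h.sides, h.matching⟩
    by_cases hed : e = d
    · rw [hed, h1, hs]
    by_cases hex : e = x
    · rw [hex, h2, ← hs, h.matching.1]
    · rw [h3 e hed hex] at he ⊢
      exact h.edges e he

theorem IsPartial.with_edge {d x : E} (h : IsPartial s₀ U S) (hd : s₀.2.1 d = d)
    (hx : s₀.2.1 x = x) (hdx : d ≠ x) {U' : Finset E} {S' : List (List E)} (hU : U' ⊆ U)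
    (hnd : S'.flatten.Nodup) (hdisj : ∀ e ∈ U', e ∉ S'.flatten)
    (hmem : ∀ e, e ∈ U' ∨ e ∈ S'.flatten ↔ (e ∈ U ∨ e ∈ S.flatten) ∧ e ≠ d ∧ e ≠ x) :
    IsPartial (addEdge s₀ d x) U' S' := by
  obtain ⟨h1, h2, h3⟩ := addEdge_apply h.inv hd hx
  refine ⟨fun e he => h.loops e (hU he), fun e => ?_, fun e => ?_, hnd, hdisj⟩
  · by_cases hed : e = d
    · rw [hed, h1, h2]
    by_cases hex : e = x
    · rw [hex, h2, h1]
    · rw [h3 e hed hex, h3, h.inv]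
      · exact fun h' => hed (by rw [← h.inv e, h', hd])
      · exact fun h' => hex (by rw [← h.inv e, h', hx])
  · rw [hmem, ← h.edges]
    by_cases hed : e = d
    · subst hed; simp [h1, hdx.symm]
    by_cases hex : e = x
    · subst hex; simp [h2, hdx]
    · simp [h3 e hed hex, hed, hex]

theorem agrees_setSide_iff {x : E} (hx : x ∈ U) (β : Bool) :
    Agrees (setSide s₀ x β) A (U.erase x) s ↔ Agrees s₀ A U s ∧ s.2.2 x = β := by
  constructor
  · intro h
    refine ⟨⟨h.loops, h.edges, fun e he => ?_, h.matching⟩, ?_⟩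
    · have hex : e ≠ x := fun h' => he (h' ▸ hx)
      rw [h.sides e fun h' => he (Finset.mem_of_mem_erase h')]
      simp [setSide, Function.update_of_ne hex]
    · rw [h.sides x (by simp)]
      simp [setSide]
  · rintro ⟨h, hs⟩
    refine ⟨h.loops, h.edges, fun e he => ?_, h.matching⟩
    by_cases hex : e = x
    · subst hex; simp [setSide, hs]
    · rw [h.sides e fun h' => he (Finset.mem_erase.2 ⟨hex, h'⟩)]
      simp [setSide, Function.update_of_ne hex]

/-- Composing with `swap e f` keeps the unfinished loop a cycle of a permutation: `f`, fixed until
then, becomes the last arc and inherits the successor of `e`, which is the start of the loop. -/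
theorem agrees_addToLoop_iff {e f : E} (hf : f ∈ U) (heU : e ∉ U) (hs₀ : s₀.1 f = f) :
    Agrees (addToLoop s₀ e f) U A s ↔ Agrees s₀ (insert e U) A s ∧ s.1 e = f := by
  constructor
  · intro h
    refine ⟨⟨fun x hx => ?_, h.edges, h.sides, h.matching⟩, ?_⟩
    · rw [Finset.mem_insert, not_or] at hx
      rw [h.loops x hx.2]
      have hxf : x ≠ f := fun h' => hx.2 (h' ▸ hf)
      simp [addToLoop, swap_apply_of_ne_of_ne hx.1 hxf]
    · rw [h.loops e heU]
      simp [addToLoop, hs₀]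
  · rintro ⟨h, hs⟩
    refine ⟨fun x hx => ?_, h.edges, h.sides, h.matching⟩
    by_cases hxe : x = e
    · subst hxe; simp [addToLoop, hs₀, hs]
    · rw [h.loops x (by simp [hxe, hx])]
      have hxf : x ≠ f := fun h' => hx (h' ▸ hf)
      simp [addToLoop, swap_apply_of_ne_of_ne hxe hxf]

variable {K : Type*} [Field K] {a b : K}

/-- The weight of a dashed end on the left or on the right. -/
def sideWeight (a b : K) (β : Bool) : K := if β then b else a

/-- The weight of the dashed ends in `U`. -/
def weightOn (a b : K) (U : Finset E) (s : LoopSystem E) : K :=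
  ∏ e ∈ U, sideWeight a b (s.2.2 e)

theorem weightOn_erase {x : E} (hx : x ∈ U) :
    weightOn a b U s = sideWeight a b (s.2.2 x) * weightOn a b (U.erase x) s :=
  (Finset.mul_prod_erase U _ hx).symm

variable [Fintype E]

open Classical in
/-- The systems extending `s₀` that are explored from `U` and `S` without merges. -/
noncomputable def closedSet (s₀ : LoopSystem E) (U : Finset E) (S : List (List E)) :
    Finset (LoopSystem E) :=
  Finset.univ.filter fun s => Agrees s₀ U U s ∧ Run s.1 s.2.1 s.2.2 U S 0

open Classical in
/-- The systems extending `s₀`, in which the loop of `e₀` is discovered up to `e`, that are explored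
without merges. The boundaries on the left and on the right of that loop are `lL` and `lR`. -/
noncomputable def openSet (s₀ : LoopSystem E) (U : Finset E) (e₀ e : E) (lL lR : List E)
    (S : List (List E)) : Finset (LoopSystem E) :=
  Finset.univ.filter fun s => Agrees s₀ (insert e U) U s ∧ ∃ v, (∀ x ∈ v, x ∈ U) ∧ v.Nodup ∧
    IsPath s.1 e v e₀ ∧ Run s.1 s.2.1 s.2.2 (U \ v.toFinset)
      ((leftEnds s.2.2 v ++ lL) :: (lR ++ rightEnds s.2.2 v) :: S) 0

end Counting

/-! ### Weighted counts of explorations without merges -/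

section CountingSums

variable {E : Type} {s₀ s : LoopSystem E} {U : Finset E}
  {S : List (List E)} {K : Type*} [Field K] {a b : K} {w : ℕ → PowerSeries K}
  {h : ℕ → ℕ → PowerSeries K}

/-- The product of the series of the boundaries in `S`. -/
noncomputable def stackSeries (w : ℕ → PowerSeries K) {E : Type} (S : List (List E)) :
    PowerSeries K :=
  (S.map fun l => w l.length).prod

theorem stackSeries_cons (l : List E) :
    stackSeries w (l :: S) = w l.length * stackSeries w S := by simp [stackSeries]

theorem IsCoeffSolution.halfOrderGE_stackSeries (hs : IsCoeffSolution a b w h)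
    (S : List (List E)) : HalfOrderGE S.flatten.length (stackSeries w S) := by
  induction S with
  | nil => intro n hn; simp at hn
  | cons l S ih =>
    rw [stackSeries_cons, List.flatten_cons, List.length_append]
    exact (hs.halfOrderGE_w _).mul ih

theorem IsPartial.pop (hp : IsPartial s₀ U ([] :: S)) : IsPartial s₀ U S :=
  ⟨hp.loops, hp.inv, by simpa using hp.edges, by simpa using hp.nodup, by simpa using hp.disj⟩

variable [DecidableEq E]

theorem IsPartial.with_edge_mem {d x : E} {S' : List (List E)} (hp : IsPartial s₀ U S)
    (hperm : S.flatten.Perm (d :: x :: S'.flatten)) : IsPartial (addEdge s₀ d x) U S' := by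
  have hnd := hperm.nodup_iff.1 hp.nodup
  simp only [List.nodup_cons, List.mem_cons, not_or] at hnd
  have hdisj : ∀ e ∈ U, e ≠ d ∧ e ≠ x ∧ e ∉ S'.flatten := fun e he => by
    have := hp.disj e he
    rw [hperm.mem_iff] at this
    simpa only [List.mem_cons, not_or] using this
  refine hp.with_edge ((hp.edges d).2 (Or.inr (hperm.mem_iff.2 (by simp))))
    ((hp.edges x).2 (Or.inr (hperm.mem_iff.2 (by simp)))) hnd.1.1 subset_rfl hnd.2.2
    (fun e he => (hdisj e he).2.2) fun e => ?_
  rw [hperm.mem_iff, List.mem_cons, List.mem_cons]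
  constructor
  · rintro (h | h)
    · exact ⟨Or.inl h, (hdisj e h).1, (hdisj e h).2.1⟩
    · exact ⟨Or.inr (Or.inr (Or.inr h)), fun h' => hnd.1.2 (h' ▸ h), fun h' => hnd.2.1 (h' ▸ h)⟩
  · rintro ⟨h | h | h | h, h1, h2⟩
    · exact Or.inl h
    · exact absurd h h1
    · exact absurd h h2
    · exact Or.inr h

theorem IsPartial.with_edge_undiscovered {d x : E} {S' : List (List E)} (hp : IsPartial s₀ U S)
    (hx : x ∈ U) (hperm : S.flatten.Perm (d :: S'.flatten)) :
    IsPartial (addEdge s₀ d x) (U.erase x) S' := by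
  have hnd := hperm.nodup_iff.1 hp.nodup
  rw [List.nodup_cons] at hnd
  have hdisj : ∀ e ∈ U, e ≠ d ∧ e ∉ S'.flatten := fun e he => by
    have := hp.disj e he
    rw [hperm.mem_iff] at this
    simpa only [List.mem_cons, not_or] using this
  refine hp.with_edge ((hp.edges d).2 (Or.inr (hperm.mem_iff.2 (by simp))))
    ((hp.edges x).2 (Or.inl hx)) (hdisj x hx).1.symm (Finset.erase_subset _ _) hnd.2
    (fun e he => (hdisj e (Finset.mem_of_mem_erase he)).2) fun e => ?_
  rw [hperm.mem_iff, List.mem_cons, Finset.mem_erase]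
  constructor
  · rintro (h | h)
    · exact ⟨Or.inl h.2, (hdisj e h.2).1, h.1⟩
    · exact ⟨Or.inr (Or.inr h), fun h' => hnd.1 (h' ▸ h), fun h' => (hdisj x hx).2 (h' ▸ h)⟩
  · rintro ⟨h | h | h, h1, h2⟩
    · exact Or.inl ⟨h2, h⟩
    · exact absurd h h1
    · exact Or.inr h

/-- Once its side is chosen, `x` leaves the set of undiscovered arcs and its weight comes out as a
factor. -/
theorem sum_weightOn_filter {X : Finset (LoopSystem E)} {x : E} (hx : x ∈ U) {p : LoopSystem E → Prop}
    [DecidablePred p] {X' : Bool → Finset (LoopSystem E)}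
    (hX : ∀ β s, s ∈ X' β ↔ s ∈ X ∧ p s ∧ s.2.2 x = β) :
    ∑ s ∈ X with p s, weightOn a b U s =
      a * ∑ s ∈ X' false, weightOn a b (U.erase x) s +
        b * ∑ s ∈ X' true, weightOn a b (U.erase x) s := by
  rw [← Finset.sum_fiberwise _ (fun s : LoopSystem E => s.2.2 x), Fintype.sum_bool, add_comm,
    Finset.mul_sum, Finset.mul_sum]
  have key : ∀ β, ∑ s ∈ (X.filter p).filter (fun s => s.2.2 x = β), weightOn a b U s =
      ∑ s ∈ X' β, sideWeight a b β * weightOn a b (U.erase x) s := by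
    intro β
    refine Finset.sum_congr ?_ fun s hs => ?_
    · ext s; simp [hX, and_assoc]
    · rw [weightOn_erase hx, ((hX β s).1 hs).2.2]
  rw [key, key]
  simp [sideWeight]

theorem IsPartial.erase {e f : E} {lL lR : List E} (hp : IsPartial s₀ U (lL :: lR :: S))
    (he : e ∉ U) (hf : f ∈ U) (β : Bool) :
    IsPartial (setSide (addToLoop s₀ e f) f β) (U.erase f)
      ((if β then lL else f :: lL) :: (if β then lR ++ [f] else lR) :: S) := by
  have hperm : ((if β then lL else f :: lL) :: (if β then lR ++ [f] else lR) :: S).flatten.Perm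
      (f :: (lL :: lR :: S).flatten) := by
    cases β
    · simp
    · simp only [if_true, List.flatten_cons]
      rw [List.append_assoc lR, List.singleton_append]
      exact (List.Perm.append_left _ List.perm_middle).trans List.perm_middle
  refine ⟨fun x hx => ?_, hp.inv, fun x => ?_, hperm.nodup_iff.2 ?_, fun x hx hx' => ?_⟩
  · obtain ⟨hxf, hxU⟩ := Finset.mem_erase.1 hx
    have hxe : x ≠ e := fun h' => he (h' ▸ hxU)
    simp [setSide, addToLoop, swap_apply_of_ne_of_ne hxe hxf, hp.loops x hxU]
  · rw [hperm.mem_iff, List.mem_cons, Finset.mem_erase]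
    refine (hp.edges x).trans ?_
    by_cases hxf : x = f
    · subst hxf; simp [hf]
    · simp [hxf]
  · exact List.nodup_cons.2 ⟨hp.disj f hf, hp.nodup⟩
  · obtain ⟨hxf, hxU⟩ := Finset.mem_erase.1 hx
    rw [hperm.mem_iff, List.mem_cons] at hx'
    exact hx'.elim hxf (hp.disj x hxU)

theorem sum_toFinset_eq_sum_range {l : List E} (hl : l.Nodup) {f : E → K} {F : ℕ → K}
    (hf : ∀ l₁ x l₂, l = l₁ ++ x :: l₂ → f x = F l₁.length) :
    ∑ x ∈ l.toFinset, f x = ∑ i ∈ Finset.range l.length, F i := by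
  rw [List.sum_toFinset f hl, Finset.sum_range, ← List.sum_ofFn]
  congr 1
  refine List.ext_getElem (by simp) fun i h1 h2 => ?_
  simp only [List.length_map] at h1
  simp only [List.getElem_map, List.getElem_ofFn]
  rw [hf (l.take i) l[i] (l.drop (i + 1)) (by simp), List.length_take_of_le h1.le]

variable [Fintype E]

/-- An exploration with empty stack must be finished, so undiscovered arcs are impossible. This
matches the empty product `1`, whose only coefficient is in degree `0`. -/
theorem sum_closedSet_nil (hp : IsPartial s₀ U ([] : List (List E))) {m : ℕ} (hm : U.card = 2 * m) :
    ∑ s ∈ closedSet s₀ U [], weightOn a b U s =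
      U.card.factorial * (stackSeries w ([] : List (List E))).coeff m := by
  rcases U.eq_empty_or_nonempty with rfl | hU
  · obtain rfl : m = 0 := by simpa using hm.symm
    have : closedSet s₀ ∅ [] = {s₀} := by
      ext s
      simp only [closedSet, Finset.mem_filter, Finset.mem_univ, true_and, Finset.mem_singleton]
      constructor
      · rintro ⟨h, -⟩
        refine Prod.ext (Equiv.ext fun e => h.loops e (by simp)) (Prod.ext (Equiv.ext fun e =>
          h.edges e ?_) (funext fun e => h.sides e (by simp)))
        rw [Ne, hp.edges]; simp
      · rintro rfl
        refine ⟨⟨fun _ _ => rfl, fun _ _ => rfl, fun _ _ => rfl, hp.inv, fun e => ?_⟩, Run.done⟩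
        rw [Ne, hp.edges]; simp
    simp [this, weightOn, stackSeries]
  · have hm0 : m ≠ 0 := by
      rintro rfl
      exact hU.ne_empty (Finset.card_eq_zero.1 (by simpa using hm))
    have : closedSet s₀ U [] = ∅ := by
      ext s
      simp only [closedSet, Finset.mem_filter, Finset.mem_univ, true_and, Finset.notMem_empty,
        iff_false, not_and]
      rintro - hr
      cases hr
      exact hU.ne_empty rfl
    simp [this, stackSeries, PowerSeries.coeff_one, hm0]

theorem closedSet_pop : closedSet s₀ U ([] :: S) = closedSet s₀ U S := by
  ext s
  simp only [closedSet, Finset.mem_filter, Finset.mem_univ, true_and, and_congr_right_iff]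
  intro _
  constructor
  · intro hr
    cases hr with
    | pop hr => exact hr
  · exact Run.pop

-- If the loop returns to its start after `e`, no further arc belongs to it, because `e₀ ∉ U`; its
-- two sides then become ordinary boundaries.
open Classical in
theorem openSet_filter_close {e₀ e : E} {lL lR : List E} (he : e ∉ U) (he₀ : e₀ ∉ U)
    (hs₀ : s₀.1 e = e₀) :
    ((openSet s₀ U e₀ e lL lR S).filter fun s => s.1 e = e₀) = closedSet s₀ U (lL :: lR :: S) := by
  ext s
  simp only [openSet, closedSet, Finset.mem_filter, Finset.mem_univ, true_and]
  constructor
  · rintro ⟨⟨hA, v, hvU, -, hv, hr⟩, hse⟩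
    have : v = [] := by
      cases v with
      | nil => rfl
      | cons f v =>
        simp only [IsPath, List.cons_append, List.isChain_cons_cons] at hv
        exact absurd (hvU f (by simp)) (by rw [← hv.1, hse]; exact he₀)
    subst this
    refine ⟨⟨fun x hx => ?_, hA.edges, hA.sides, hA.matching⟩, by
      simpa [leftEnds, rightEnds] using hr⟩
    by_cases hxe : x = e
    · rw [hxe, hse, hs₀]
    · exact hA.loops x (by simp [hxe, hx])
  · rintro ⟨hA, hr⟩
    have : s.1 e = e₀ := by rw [hA.loops e he, hs₀]
    refine ⟨⟨⟨fun x hx => hA.loops x fun h' => hx (Finset.mem_insert_of_mem h'), hA.edges,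
      hA.sides, hA.matching⟩, [], by simp, by simp, by simpa [IsPath] using this, by
      simpa [leftEnds, rightEnds] using hr⟩, this⟩

-- The next arc `f` becomes the last one discovered. Its end goes to the front on the left and to
-- the back on the right, since left ends are listed backwards.
open Classical in
theorem openSet_filter_step {e₀ e f : E} {lL lR : List E} (he : e ∉ U) (hf : f ∈ U)
    (hs₀ : s₀.1 f = f) (he₀ : e₀ ∉ U) (β : Bool) :
    ((openSet s₀ U e₀ e lL lR S).filter fun s => s.1 e = f ∧ s.2.2 f = β) =
      openSet (setSide (addToLoop s₀ e f) f β) (U.erase f) e₀ f (if β then lL else f :: lL)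
        (if β then lR ++ [f] else lR) S := by
  ext s
  simp only [openSet, Finset.mem_filter, Finset.mem_univ, true_and]
  rw [Finset.insert_erase hf, agrees_setSide_iff hf, agrees_addToLoop_iff hf he hs₀]
  have hlists : s.2.2 f = β → ∀ v,
      ((leftEnds s.2.2 (f :: v) ++ lL) :: (lR ++ rightEnds s.2.2 (f :: v)) :: S) =
        ((leftEnds s.2.2 v ++ if β then lL else f :: lL) ::
          ((if β then lR ++ [f] else lR) ++ rightEnds s.2.2 v) :: S) := by
    intro hβ v
    cases β <;> simp [leftEnds, rightEnds, hβ]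
  have hU : ∀ v : List E, U \ (f :: v).toFinset = U.erase f \ v.toFinset := by
    intro v
    ext x
    simp [not_or, and_assoc, and_left_comm]
  constructor
  · rintro ⟨⟨hA, v, hvU, hvn, hv, hr⟩, hse, hβ⟩
    cases v with
    | nil =>
      simp only [IsPath, List.singleton_append, List.isChain_cons_cons] at hv
      exact absurd hf (by rw [← hse, hv.1]; exact he₀)
    | cons f' v =>
      simp only [IsPath, List.cons_append, List.isChain_cons_cons] at hv
      obtain rfl : f = f' := hse.symm.trans hv.1
      rw [List.nodup_cons] at hvn
      refine ⟨⟨⟨hA, hse⟩, hβ⟩, v, fun x hx => ?_, hvn.2, hv.2, ?_⟩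
      · exact Finset.mem_erase.2 ⟨fun h' => hvn.1 (h' ▸ hx), hvU x (List.mem_cons_of_mem _ hx)⟩
      · rwa [hlists hβ, hU] at hr
  · rintro ⟨⟨⟨hA, hse⟩, hβ⟩, v, hvU, hvn, hv, hr⟩
    refine ⟨⟨hA, f :: v, fun x hx => ?_, List.nodup_cons.2 ⟨fun h' => ?_, hvn⟩, ?_, ?_⟩, hse, hβ⟩
    · rcases List.mem_cons.1 hx with rfl | hx
      · exact hf
      · exact Finset.mem_of_mem_erase (hvU x hx)
    · exact absurd (hvU f h') (by simp)
    · simp only [IsPath, List.cons_append, List.isChain_cons_cons]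
      exact ⟨hse, hv⟩
    · rwa [hlists hβ, hU]

open Classical in
theorem closedSet_filter_split {d x : E} {l l₁ l₂ : List E} (hp : IsPartial s₀ U ((d :: l) :: S))
    (hl : l = l₁ ++ x :: l₂) :
    ((closedSet s₀ U ((d :: l) :: S)).filter fun s => s.2.1 d = x) =
      closedSet (addEdge s₀ d x) U (l₁ :: l₂ :: S) := by
  have hnd := hp.nodup
  rw [List.flatten_cons, List.cons_append, List.nodup_cons, List.mem_append, not_or] at hnd
  have hxl : x ∈ l := by simp [hl]
  have hdx : d ≠ x := fun h' => hnd.1.1 (h' ▸ hxl)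
  have hxU : x ∉ U := fun h' => hp.disj x h' (by simp [hxl])
  ext s
  simp only [closedSet, Finset.mem_filter, Finset.mem_univ, true_and]
  rw [agrees_addEdge_iff hp.inv ((hp.edges d).2 (Or.inr (by simp)))
    ((hp.edges x).2 (Or.inr (by simp [hxl]))) hdx]
  constructor
  · rintro ⟨⟨hA, hr⟩, hsd⟩
    refine ⟨⟨hA, hsd⟩, ?_⟩
    cases hr with
    | split l₁' l₂' hl' hr =>
      rw [hsd, hl] at hl'
      have hnl : (l₁ ++ x :: l₂).Nodup := hl ▸ (List.nodup_append'.1 hnd.2).1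
      have hx1 : x ∉ l₁ := fun h' => (List.nodup_append'.1 hnl).2.2 h' (by simp)
      have hx1' : x ∉ l₁' := by
        rw [hl'] at hnl
        exact fun h' => (List.nodup_append'.1 hnl).2.2 h' (by simp)
      -- A list without repetition is cut at `x` in only one way, as the position of `x` shows.
      obtain ⟨rfl, h2⟩ := List.append_inj' hl' (by
        have e1 : (l₁ ++ x :: l₂).idxOf x = l₁.length := by
          rw [List.idxOf_append_of_notMem hx1]; simp
        have e2 : (l₁' ++ x :: l₂').idxOf x = l₁'.length := by
          rw [List.idxOf_append_of_notMem hx1']; simp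
        have e3 := congrArg List.length hl'
        rw [hl', e2] at e1
        simp only [List.length_append] at e3
        omega)
      simp only [List.cons.injEq, true_and] at h2
      rwa [h2]
    | merge _ _ _ _ _ hg => omega
    | loop v hU => exact absurd (hU (s.2.1 d) (by simp)) (by rwa [hsd])
  · rintro ⟨⟨hA, hsd⟩, hr⟩
    exact ⟨⟨hA, Run.split l₁ l₂ (by rw [hsd, hl]) hr⟩, hsd⟩

-- Discovery starts with the loop reduced to `x`. The dashed end of `x` is already used, so that the
-- only pending ends are those of `l`, on the side `β`.
open Classical in
theorem closedSet_filter_loop {d x : E} {l : List E} (hp : IsPartial s₀ U ((d :: l) :: S))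
    (hx : x ∈ U) (β : Bool) :
    ((closedSet s₀ U ((d :: l) :: S)).filter fun s => s.2.1 d = x ∧ s.2.2 x = β) =
      openSet (setSide (addEdge s₀ d x) x β) (U.erase x) x x (if β then [] else l)
        (if β then l else []) S := by
  have hdx : d ≠ x := fun h' => hp.disj x hx (by simp [← h'])
  have hxl : x ∉ l := fun h' => hp.disj x hx (by simp [h'])
  ext s
  simp only [closedSet, openSet, Finset.mem_filter, Finset.mem_univ, true_and]
  rw [Finset.insert_erase hx, agrees_setSide_iff hx,
    agrees_addEdge_iff hp.inv ((hp.edges d).2 (Or.inr (by simp))) ((hp.edges x).2 (Or.inl hx)) hdx]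
  have hU : ∀ v : List E, U \ (x :: v).toFinset = U.erase x \ v.toFinset := by
    intro v
    ext y
    simp [not_or, and_assoc, and_left_comm]
  constructor
  · rintro ⟨⟨hA, hr⟩, hsd, hβ⟩
    refine ⟨⟨⟨hA, hsd⟩, hβ⟩, ?_⟩
    cases hr with
    | split l₁' l₂' hl' hr => exact absurd (by rw [hl', hsd]; simp) hxl
    | merge _ _ _ _ _ hg => omega
    | loop v hvU hvn hv hr =>
      rw [hsd] at hvU hvn hv hr
      rw [hβ, hU] at hr
      rw [List.nodup_cons] at hvn
      exact ⟨v, fun y hy => Finset.mem_erase.2 ⟨fun h' => hvn.1 (h' ▸ hy),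
        hvU y (List.mem_cons_of_mem _ hy)⟩, hvn.2, hv, hr⟩
  · rintro ⟨⟨⟨hA, hsd⟩, hβ⟩, v, hvU, hvn, hv, hr⟩
    refine ⟨⟨hA, Run.loop v ?_ ?_ ?_ ?_⟩, hsd, hβ⟩
    · rw [hsd]
      intro y hy
      rcases List.mem_cons.1 hy with rfl | hy
      · exact hx
      · exact Finset.mem_of_mem_erase (hvU y hy)
    · rw [hsd]
      exact List.nodup_cons.2 ⟨fun h' => absurd (hvU x h') (by simp), hvn⟩
    · rwa [hsd]
    · rwa [hsd, hβ, hU]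

/-- The weighted number of systems with given closed boundaries, at degree `m`. -/
def ClosedFormula (E : Type) [DecidableEq E] [Fintype E] (a b : K) (w : ℕ → PowerSeries K)
    (m : ℕ) : Prop :=
  ∀ (s₀ : LoopSystem E) (U : Finset E) (S : List (List E)), IsPartial s₀ U S →
    U.card + S.flatten.length = 2 * m →
    ∑ s ∈ closedSet s₀ U S, weightOn a b U s = U.card.factorial * (stackSeries w S).coeff m

/-- The weighted number of systems with a loop under construction, at degree `m`. -/
def OpenFormula (E : Type) [DecidableEq E] [Fintype E] (a b : K) (w : ℕ → PowerSeries K)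
    (h : ℕ → ℕ → PowerSeries K) (m : ℕ) : Prop :=
  ∀ (s₀ : LoopSystem E) (U : Finset E) (e₀ e : E) (lL lR : List E) (S : List (List E)),
    IsPartial s₀ U (lL :: lR :: S) → e ∉ U → e₀ ∉ U → s₀.1 e = e₀ →
    U.card + (lL :: lR :: S).flatten.length = 2 * m →
    ∑ s ∈ openSet s₀ U e₀ e lL lR S, weightOn a b U s =
      U.card.factorial * (h lR.length lL.length * stackSeries w S).coeff m

/-- Sort the systems by the arc following `e`. The start `e₀` closes the loop and gives `w i * w j`.
Each of the `U.card` arcs `f` gives the same sum, with `(U.card - 1)!` and the terms in `a` and `b`;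
together they produce `U.card !`. The degree `m` is unchanged, and the induction is on `U.card`. -/
theorem openFormula_of_closedFormula (hs : IsCoeffSolution a b w h) {m : ℕ}
    (hc : ClosedFormula E a b w m) : OpenFormula E a b w h m := by
  classical
  intro s₀ U
  induction hN : U.card using Nat.strong_induction_on generalizing s₀ U with
  | _ N ih =>
  subst hN
  intro e₀ e lL lR S hp he he₀ hs₀ hcard
  have hmaps : ∀ s ∈ openSet s₀ U e₀ e lL lR S, s.1 e ∈ insert e₀ U := by
    intro s hsm
    simp only [openSet, Finset.mem_filter, Finset.mem_univ, true_and] at hsm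
    obtain ⟨-, v, hvU, -, hv, -⟩ := hsm
    cases v with
    | nil =>
      simp only [IsPath, List.singleton_append, List.isChain_cons_cons] at hv
      simp [hv.1]
    | cons f v =>
      simp only [IsPath, List.cons_append, List.isChain_cons_cons] at hv
      rw [hv.1]
      exact Finset.mem_insert_of_mem (hvU f (by simp))
  rw [← Finset.sum_fiberwise_of_maps_to hmaps, Finset.sum_insert he₀,
    openSet_filter_close he he₀ hs₀, hc s₀ U _ hp hcard, stackSeries_cons, stackSeries_cons]
  have hstep : ∀ f ∈ U, ∑ s ∈ openSet s₀ U e₀ e lL lR S with s.1 e = f, weightOn a b U s =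
      (U.card - 1).factorial * (a * (h lR.length (lL.length + 1) * stackSeries w S).coeff m +
        b * (h (lR.length + 1) lL.length * stackSeries w S).coeff m) := by
    intro f hf
    have hX : ∀ β s, s ∈ openSet (setSide (addToLoop s₀ e f) f β) (U.erase f) e₀ f
        (if β then lL else f :: lL) (if β then lR ++ [f] else lR) S ↔
        s ∈ openSet s₀ U e₀ e lL lR S ∧ s.1 e = f ∧ s.2.2 f = β := by
      intro β s
      rw [← openSet_filter_step he hf (hp.loops f hf) he₀ β, Finset.mem_filter]
    have hcU : (U.erase f).card < U.card := Finset.card_erase_lt_of_mem hf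
    have hcU' := Finset.card_erase_add_one hf
    have hsum : ∀ β : Bool, ∑ s ∈ openSet (setSide (addToLoop s₀ e f) f β) (U.erase f) e₀ f
        (if β then lL else f :: lL) (if β then lR ++ [f] else lR) S, weightOn a b (U.erase f) s =
        (U.card - 1).factorial * (h (if β then lR ++ [f] else lR).length
          (if β then lL else f :: lL).length * stackSeries w S).coeff m := by
      intro β
      rw [← Finset.card_erase_of_mem hf]
      refine ih _ hcU _ (U.erase f) rfl e₀ f _ _ S (hp.erase he hf β) (by simp)
        (fun h' => he₀ (Finset.mem_of_mem_erase h')) ?_ ?_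
      · simp [setSide, addToLoop, hs₀]
      · rw [← hcard, ← hcU']
        cases β <;> simp <;> omega
    rw [sum_weightOn_filter hf hX, hsum, hsum]
    simp only [Bool.false_eq_true, if_false, if_true, List.length_cons, List.length_append,
      List.length_nil, zero_add]
    ring
  rw [Finset.sum_congr rfl hstep, Finset.sum_const, nsmul_eq_mul]
  have hh : h lR.length lL.length * stackSeries w S =
      w lL.length * (w lR.length * stackSeries w S) +
      (PowerSeries.C a * (h lR.length (lL.length + 1) * stackSeries w S) +
        PowerSeries.C b * (h (lR.length + 1) lL.length * stackSeries w S)) := by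
    rw [hs.h_eq lR.length lL.length]; ring
  rw [hh, map_add, map_add, PowerSeries.coeff_C_mul, PowerSeries.coeff_C_mul,
    mul_add (U.card.factorial : K), ← mul_assoc (U.card : K)]
  congr 1
  -- With no arc left the loop cannot continue. The corresponding terms vanish too, as they would
  -- need more than `2 * m` ends in degree `m`.
  rcases Nat.eq_zero_or_pos U.card with h0 | h0
  · have hv1 : (h lR.length (lL.length + 1) * stackSeries w S).coeff m = 0 := by
      refine ((hs.halfOrderGE_h _ _).mul (hs.halfOrderGE_stackSeries S)) m ?_
      rw [← hcard, h0]; simp; omega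
    have hv2 : (h (lR.length + 1) lL.length * stackSeries w S).coeff m = 0 := by
      refine ((hs.halfOrderGE_h _ _).mul (hs.halfOrderGE_stackSeries S)) m ?_
      rw [← hcard, h0]; simp; omega
    rw [hv1, hv2]; simp
  · rw [← Nat.cast_mul, Nat.mul_factorial_pred h0.ne']

/-- Sort the systems by the partner of the first end `d`. A partner at position `i` of the boundary
splits it into pieces of lengths `i` and `l.length - 1 - i`; an undiscovered partner opens a loop
with all of `l` on one side. The edge so added accounts for the factor `t` and the passage from `m'`
to `m' + 1`. -/
theorem closedFormula_of_openFormula (hs : IsCoeffSolution a b w h) {m : ℕ}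
    (hc : ∀ m', m = m' + 1 → ClosedFormula E a b w m' ∧ OpenFormula E a b w h m') :
    ClosedFormula E a b w m := by
  classical
  intro s₀ U S
  induction S with
  | nil => exact fun hp hcard => sum_closedSet_nil hp (by simpa using hcard)
  | cons L S ih =>
  intro hp hcard
  cases L with
  | nil =>
    rw [closedSet_pop, ih hp.pop (by simpa using hcard), stackSeries_cons, List.length_nil,
      hs.w_zero, one_mul]
  | cons d l =>
  obtain ⟨m, rfl⟩ : ∃ m', m = m' + 1 := ⟨m - 1, by simp at hcard; omega⟩
  obtain ⟨hcl, hop⟩ := hc m rfl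
  have hnd := hp.nodup
  rw [List.flatten_cons, List.cons_append, List.nodup_cons, List.mem_append, not_or] at hnd
  have hnl : l.Nodup := (List.nodup_append'.1 hnd.2).1
  have hlU : ∀ x ∈ l, x ∉ U := fun x hx h' => hp.disj x h' (by simp [hx])
  have hdisj : Disjoint l.toFinset U := Finset.disjoint_left.2 fun x hx =>
    hlU x (List.mem_toFinset.1 hx)
  have hmaps : ∀ s ∈ closedSet s₀ U ((d :: l) :: S), s.2.1 d ∈ l.toFinset ∪ U := by
    intro s hsm
    simp only [closedSet, Finset.mem_filter, Finset.mem_univ, true_and] at hsm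
    rw [Finset.mem_union, List.mem_toFinset]
    cases hsm.2 with
    | split l₁ l₂ hl hr => left; rw [hl]; simp
    | merge _ _ _ _ _ hg => omega
    | loop v hvU => right; exact hvU _ (by simp)
  rw [← Finset.sum_fiberwise_of_maps_to hmaps, Finset.sum_union hdisj]
  have hsplit : ∑ x ∈ l.toFinset, ∑ s ∈ closedSet s₀ U ((d :: l) :: S) with s.2.1 d = x,
      weightOn a b U s = ∑ i ∈ Finset.range l.length,
        U.card.factorial * (w i * w (l.length - 1 - i) * stackSeries w S).coeff m := by
    refine sum_toFinset_eq_sum_range hnl fun l₁ x l₂ hl => ?_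
    have hperm : l.Perm (x :: (l₁ ++ l₂)) := by rw [hl]; exact List.perm_middle
    have hlen := hperm.length_eq
    simp only [List.length_cons, List.length_append] at hlen
    have hp' : IsPartial (addEdge s₀ d x) U (l₁ :: l₂ :: S) := by
      refine hp.with_edge_mem ?_
      simp only [List.flatten_cons, List.cons_append, hl, List.append_assoc]
      exact List.Perm.cons _ List.perm_middle
    rw [closedSet_filter_split hp hl, hcl _ U _ hp' ?_, stackSeries_cons, stackSeries_cons,
      ← mul_assoc, show l.length - 1 - l₁.length = l₂.length by omega]
    simp only [List.flatten_cons, List.length_append, List.length_cons] at hcard ⊢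
    omega
  have hloop : ∀ x ∈ U, ∑ s ∈ closedSet s₀ U ((d :: l) :: S) with s.2.1 d = x, weightOn a b U s =
      (U.card - 1).factorial * (a * (h 0 l.length * stackSeries w S).coeff m +
        b * (h l.length 0 * stackSeries w S).coeff m) := by
    intro x hx
    have hX : ∀ β s, s ∈ openSet (setSide (addEdge s₀ d x) x β) (U.erase x) x x
        (if β then [] else l) (if β then l else []) S ↔
        s ∈ closedSet s₀ U ((d :: l) :: S) ∧ s.2.1 d = x ∧ s.2.2 x = β := by
      intro β s
      rw [← closedSet_filter_loop hp hx β, Finset.mem_filter]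
    have hcU' := Finset.card_erase_add_one hx
    have hflat : ∀ β : Bool, ((if β then [] else l) :: (if β then l else []) :: S).flatten =
        l ++ S.flatten := by intro β; cases β <;> simp
    have hp' : ∀ β : Bool, IsPartial (addEdge s₀ d x) (U.erase x)
        ((if β then [] else l) :: (if β then l else []) :: S) := fun β =>
      hp.with_edge_undiscovered hx (by
        rw [hflat, List.flatten_cons, List.cons_append])
    have hsum : ∀ β : Bool, ∑ s ∈ openSet (setSide (addEdge s₀ d x) x β) (U.erase x) x x
        (if β then [] else l) (if β then l else []) S, weightOn a b (U.erase x) s =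
        (U.card - 1).factorial * (h (if β then l else []).length
          (if β then [] else l).length * stackSeries w S).coeff m := by
      intro β
      rw [← Finset.card_erase_of_mem hx]
      refine hop _ (U.erase x) x x _ _ S ?_ (by simp) (by simp) (hp.loops x hx) ?_
      · exact ⟨(hp' β).loops, (hp' β).inv, (hp' β).edges, (hp' β).nodup, (hp' β).disj⟩
      · rw [hflat]
        simp only [List.flatten_cons, List.length_append, List.length_cons] at hcard ⊢
        omega
    rw [sum_weightOn_filter hx hX, hsum, hsum]
    simp only [Bool.false_eq_true, if_false, if_true, List.length_nil]
    ring
  rw [hsplit, Finset.sum_congr rfl hloop, Finset.sum_const, nsmul_eq_mul, stackSeries_cons,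
    List.length_cons, hs.w_succ]
  have hh : PowerSeries.X * (∑ i ∈ Finset.range l.length, w i * w (l.length - 1 - i) +
      PowerSeries.C a * h 0 l.length + PowerSeries.C b * h l.length 0) * stackSeries w S =
      PowerSeries.X * (∑ i ∈ Finset.range l.length,
        w i * w (l.length - 1 - i) * stackSeries w S +
        (PowerSeries.C a * (h 0 l.length * stackSeries w S) +
          PowerSeries.C b * (h l.length 0 * stackSeries w S))) := by
    rw [← Finset.sum_mul]; ring
  rw [hh, PowerSeries.coeff_succ_X_mul, map_add, map_add, PowerSeries.coeff_C_mul,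
    PowerSeries.coeff_C_mul, map_sum, mul_add (U.card.factorial : K), Finset.mul_sum,
    ← mul_assoc (U.card : K)]
  congr 1
  -- Without undiscovered arcs no loop can be found, and the terms in `h` vanish by their order in
  -- `t`.
  rcases Nat.eq_zero_or_pos U.card with h0 | h0
  · simp only [List.flatten_cons, List.length_append, List.length_cons] at hcard
    have hv1 : (h 0 l.length * stackSeries w S).coeff m = 0 :=
      ((hs.halfOrderGE_h _ _).mul (hs.halfOrderGE_stackSeries S)) m (by omega)
    have hv2 : (h l.length 0 * stackSeries w S).coeff m = 0 :=
      ((hs.halfOrderGE_h _ _).mul (hs.halfOrderGE_stackSeries S)) m (by omega)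
    rw [hv1, hv2]; simp
  · rw [← Nat.cast_mul, Nat.mul_factorial_pred h0.ne']

theorem openFormula (hs : IsCoeffSolution a b w h) (m : ℕ) : OpenFormula E a b w h m := by
  suffices ClosedFormula E a b w m ∧ OpenFormula E a b w h m from this.2
  induction m with
  | zero =>
    have := closedFormula_of_openFormula (E := E) hs (m := 0) (by simp)
    exact ⟨this, openFormula_of_closedFormula hs this⟩
  | succ m ih =>
    have := closedFormula_of_openFormula (E := E) hs (m := m + 1) (by
      rintro m' hm'
      obtain rfl : m = m' := by omega
      exact ih)
    exact ⟨this, openFormula_of_closedFormula hs this⟩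

/-- The system `s` is explored from the loop of `r` without merges. -/
def IsExplored (s : LoopSystem E) (r : E) : Prop :=
  IsMatching s.2.1 ∧ ∃ v, (r :: v).Nodup ∧ IsPath s.1 r v r ∧
    Run s.1 s.2.1 s.2.2 (Finset.univ \ (r :: v).toFinset)
      [leftEnds s.2.2 v ++ (if s.2.2 r then [] else [r]),
        (if s.2.2 r then [r] else []) ++ rightEnds s.2.2 v] 0

open Classical in
/-- The weighted number of rooted systems that are explored without merges. -/
theorem sum_isExplored (hs : IsCoeffSolution a b w h) {n : ℕ} (hn : Fintype.card E = 2 * n)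
    (r : E) : ∑ s with IsExplored s r, weightOn a b Finset.univ s =
      (2 * n - 1).factorial * (h 0 0 - 1).coeff n := by
  -- Start from the partial system with nothing chosen, in which the loop consists of `r` and the
  -- only pending end is that of `r`, on its side `β`.
  have hX : ∀ β (s : LoopSystem E), s ∈ openSet (setSide (1, 1, fun _ => false) r β)
      (Finset.univ.erase r) r r (if β then [] else [r]) (if β then [r] else []) [] ↔
      s ∈ Finset.univ ∧ IsExplored s r ∧ s.2.2 r = β := by
    intro β s
    simp only [openSet, Finset.mem_filter, Finset.mem_univ, true_and]
    rw [Finset.insert_erase (Finset.mem_univ r), agrees_setSide_iff (Finset.mem_univ r)]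
    have hA : Agrees ((1, 1, fun _ => false) : LoopSystem E) Finset.univ Finset.univ s ↔
        IsMatching s.2.1 :=
      ⟨fun h => h.matching, fun h => ⟨by simp, by simp, by simp, h⟩⟩
    have hU : ∀ v : List E, Finset.univ \ (r :: v).toFinset =
        Finset.univ.erase r \ v.toFinset := by
      intro v
      ext x
      simp [not_or]
    rw [hA, IsExplored]
    constructor
    · rintro ⟨⟨hM, rfl⟩, v, hvU, hvn, hv, hr⟩
      refine ⟨⟨hM, v, List.nodup_cons.2 ⟨fun h' => absurd (hvU r h') (by simp), hvn⟩, hv, ?_⟩, rfl⟩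
      rwa [hU]
    · rintro ⟨⟨hM, v, hvn, hv, hr⟩, rfl⟩
      rw [List.nodup_cons] at hvn
      refine ⟨⟨hM, rfl⟩, v, fun x hx => ?_, hvn.2, hv, ?_⟩
      · simp only [Finset.mem_erase, Finset.mem_univ, and_true]
        rintro rfl
        exact hvn.1 hx
      · rwa [hU] at hr
  have hpos : 0 < Fintype.card E := Fintype.card_pos_iff.2 ⟨r⟩
  have hcard : (Finset.univ.erase r).card = 2 * n - 1 := by
    rw [Finset.card_erase_of_mem (Finset.mem_univ r), Finset.card_univ, hn]
  have hsum : ∀ β : Bool, ∑ s ∈ openSet (setSide (1, 1, fun _ => false) r β)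
      (Finset.univ.erase r) r r (if β then [] else [r]) (if β then [r] else []) [],
      weightOn a b (Finset.univ.erase r) s = (2 * n - 1).factorial *
        (h (if β then [r] else []).length (if β then [] else [r]).length).coeff n := by
    intro β
    rw [← hcard, openFormula hs n _ _ _ _ _ _ _ ?_ (by simp) (by simp) (by simp [setSide]) ?_]
    · simp [stackSeries]
    · refine ⟨fun _ _ => rfl, fun _ => rfl, fun e => ?_, ?_, fun e he => ?_⟩
      · by_cases her : e = r
        · cases β <;> simp [setSide, her]
        · simp [setSide, her]
      · cases β <;> simp
      · have := Finset.ne_of_mem_erase he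
        cases β <;> simp [this]
    · rw [hcard]
      cases β <;> simp <;> omega
  rw [sum_weightOn_filter (Finset.mem_univ r) hX, hsum, hsum]
  -- The term `1 = w 0 ^ 2` in `h 0 0` would be a root loop without arcs; the other two terms choose
  -- the side of the root's dashed end.
  have hh : h 0 0 - 1 = PowerSeries.C a * h 0 1 + PowerSeries.C b * h 1 0 := by
    rw [hs.h_eq 0 0, hs.w_zero]; ring
  rw [hh, map_add, PowerSeries.coeff_C_mul, PowerSeries.coeff_C_mul]
  simp only [Bool.false_eq_true, if_false, if_true, List.length_nil, List.length_singleton]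
  ring

end CountingSums

/-! ### Periods, transitivity and conjugation of permutations -/

section PermLemmas

variable {D D' : Type}

theorem ncard_sameCycle [Finite D] (f : Perm D) (d : D) :
    {e | f.SameCycle d e}.ncard = Function.minimalPeriod f d := by
  classical
  have := Fintype.ofFinite D
  have h1 : {e | f.SameCycle d e} = MulAction.orbit (Subgroup.zpowers f) d := by
    ext e
    simp only [Set.mem_ofPred_eq, MulAction.mem_orbit_iff, Subtype.exists, Subgroup.mem_zpowers_iff,
      Perm.SameCycle]
    constructor
    · rintro ⟨i, rfl⟩; exact ⟨f ^ i, ⟨i, rfl⟩, rfl⟩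
    · rintro ⟨_, ⟨i, rfl⟩, rfl⟩; exact ⟨i, rfl⟩
  rw [h1, ← Nat.card_coe_set_eq, Nat.card_eq_fintype_card, ← MulAction.minimalPeriod_eq_card]
  rfl

theorem minimalPeriod_eq_four_iff (f : Perm D) (d : D) :
    Function.minimalPeriod f d = 4 ↔ f (f (f (f d))) = d ∧ f (f d) ≠ d := by
  constructor
  · intro h
    refine ⟨?_, fun h2 => ?_⟩
    · have := Function.iterate_minimalPeriod (f := f) (x := d)
      rwa [h] at this
    · have := Function.IsPeriodicPt.minimalPeriod_le (f := f) (x := d) (n := 2) (by norm_num) h2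
      omega
  · rintro ⟨h4, h2⟩
    have hdvd : Function.minimalPeriod f d ∣ 2 ^ (1 + 1) :=
      Function.IsPeriodicPt.minimalPeriod_dvd (n := 4) h4
    have hn : ¬ Function.minimalPeriod f d ∣ 2 ^ 1 := fun h =>
      h2 (Function.isPeriodicPt_iff_minimalPeriod_dvd.2 h)
    exact Nat.eq_prime_pow_of_dvd_least_prime_pow Nat.prime_two hn hdvd

theorem minimalPeriod_eq_two_iff (f : Perm D) (d : D) :
    Function.minimalPeriod f d = 2 ↔ f (f d) = d ∧ f d ≠ d := by
  constructor
  · intro h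
    refine ⟨?_, fun h2 => ?_⟩
    · have := Function.iterate_minimalPeriod (f := f) (x := d)
      rwa [h] at this
    · have := Function.IsPeriodicPt.minimalPeriod_le (f := f) (x := d) (n := 1) (by norm_num) h2
      omega
  · rintro ⟨h4, h2⟩
    have hdvd : Function.minimalPeriod f d ∣ 2 ^ (0 + 1) :=
      Function.IsPeriodicPt.minimalPeriod_dvd (n := 2) h4
    have hn : ¬ Function.minimalPeriod f d ∣ 2 ^ 0 := fun h =>
      h2 (Function.isPeriodicPt_iff_minimalPeriod_dvd.2 h)
    exact Nat.eq_prime_pow_of_dvd_least_prime_pow Nat.prime_two hn hdvd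

theorem numCycles_mul_of_minimalPeriod [Finite D] {f : Perm D} {k : ℕ}
    (h : ∀ d, Function.minimalPeriod f d = k) : numCycles f * k = Nat.card D := by
  classical
  have := Fintype.ofFinite D
  have := Fintype.ofFinite (Quotient (Perm.SameCycle.setoid f))
  rw [numCycles, Nat.card_eq_fintype_card, Nat.card_eq_fintype_card, ← Finset.card_univ (α := D),
    Finset.card_eq_sum_card_fiberwise (f := fun d => Quotient.mk (Perm.SameCycle.setoid f) d)
      (t := Finset.univ) (by simp)]
  rw [Finset.sum_const_nat (m := k), Finset.card_univ]
  intro q _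
  refine Quotient.inductionOn q fun d => ?_
  rw [← h d, ← ncard_sameCycle, ← Set.ncard_coe_finset]
  congr 1
  ext e
  simp only [Finset.coe_filter, Finset.mem_univ, true_and, Set.mem_ofPred_eq]
  rw [Quotient.eq]
  exact Perm.sameCycle_comm

/-- Connectedness becomes the absence of proper nonempty stable sets. Stability under inverses is
automatic by finiteness. -/
theorem closure_transitive_iff [Finite D] (f g : Perm D) :
    (∀ d e, ∃ h ∈ Subgroup.closure {f, g}, h d = e) ↔
      ∀ T : Set D, (∀ x ∈ T, f x ∈ T) → (∀ x ∈ T, g x ∈ T) → T.Nonempty → T = Set.univ := by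
  constructor
  · intro h T hf hg ⟨d, hd⟩
    refine Set.eq_univ_of_forall fun e => ?_
    obtain ⟨p, hp, rfl⟩ := h d e
    have inv : ∀ q : Perm D, (∀ x ∈ T, q x ∈ T) → ∀ x ∈ T, q⁻¹ x ∈ T := fun q hq x hx =>
      Perm.perm_symm_mapsTo_of_mapsTo q hq hx
    have : ∀ x ∈ T, p x ∈ T := by
      induction hp using Subgroup.closure_induction with
      | mem q hq =>
        rcases hq with rfl | rfl
        · exact hf
        · exact hg
      | one => exact fun x hx => hx
      | mul p q _ _ hp hq => exact fun x hx => hp _ (hq x hx)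
      | inv p _ hp => exact inv p hp
    exact this d hd
  · intro h d e
    have := h {e | ∃ p ∈ Subgroup.closure {f, g}, p d = e} ?_ ?_ ⟨d, 1, one_mem _, rfl⟩
    · have he : e ∈ (Set.univ : Set D) := trivial
      rwa [← this] at he
    · rintro x ⟨p, hp, rfl⟩
      exact ⟨f * p, mul_mem (Subgroup.subset_closure (by simp)) hp, rfl⟩
    · rintro x ⟨p, hp, rfl⟩
      exact ⟨g * p, mul_mem (Subgroup.subset_closure (by simp)) hp, rfl⟩

theorem sameCycle_permCongr (ι : D ≃ D') (f : Perm D) (x y : D) :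
    (ι.permCongr f).SameCycle (ι x) (ι y) ↔ f.SameCycle x y := by
  refine exists_congr fun i => ?_
  have : ι.permCongr f ^ i = ι.permCongr (f ^ i) := (map_zpow ι.permCongrHom f i).symm
  rw [this]
  simp [Equiv.permCongr_apply]

/-- The bijection between the cycles of conjugate permutations. -/
def cyclesCongr (ι : D ≃ D') (f : Perm D) : Quotient (Perm.SameCycle.setoid f) ≃
    Quotient (Perm.SameCycle.setoid (ι.permCongr f)) :=
  Quotient.congr ι fun x y => (sameCycle_permCongr ι f x y).symm

theorem numCycles_permCongr (ι : D ≃ D') (f : Perm D) :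
    numCycles (ι.permCongr f) = numCycles f :=
  (Nat.card_congr (cyclesCongr ι f)).symm

end PermLemmas

/-! ### Relabelling, and labelled against unlabelled counts -/

theorem PlanarMap.isQuartic_iff {D : Type} [Finite D] (M : PlanarMap D) :
    M.IsQuartic ↔ ∀ d, M.rot (M.rot (M.rot (M.rot d))) = d ∧ M.rot (M.rot d) ≠ d := by
  simp only [PlanarMap.IsQuartic, ncard_sameCycle, minimalPeriod_eq_four_iff]

/-- Relabelling the half-edges of a planar map. -/
def PlanarMap.transport {D D' : Type} [Finite D] (M : PlanarMap D) (ι : D ≃ D') : PlanarMap D' where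
  rot := ι.permCongr M.rot
  opp := ι.permCongr M.opp
  opp_opp d := by simp [Equiv.permCongr_apply, M.opp_opp]
  opp_ne d h := M.opp_ne (ι.symm d) (by
    rw [Equiv.permCongr_apply] at h
    rw [← ι.symm_apply_apply (M.opp _), h])
  connected := by
    have : Finite D' := Finite.of_equiv D ι
    have hM := (closure_transitive_iff _ _).1 M.connected
    rw [closure_transitive_iff]
    intro T hf hg ⟨d, hd⟩
    have h1 : ι ⁻¹' T = Set.univ := by
      refine hM _ (fun x hx => ?_) (fun x hx => ?_) ⟨ι.symm d, by simpa using hd⟩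
      · simpa [Equiv.permCongr_apply] using hf (ι x) hx
      · simpa [Equiv.permCongr_apply] using hg (ι x) hx
    refine Set.eq_univ_of_forall fun e => ?_
    have : ι.symm e ∈ ι ⁻¹' T := by rw [h1]; trivial
    simpa using this
  euler := by
    have : ι.permCongr M.rot * ι.permCongr M.opp = ι.permCongr (M.rot * M.opp) :=
      (map_mul ι.permCongrHom _ _).symm
    rw [this, numCycles_permCongr, numCycles_permCongr, numCycles_permCongr, M.euler]

theorem PlanarMap.IsEulerianOrientation.transport {D D' : Type} [Finite D] {M : PlanarMap D}
    {out : D → Bool} (h : M.IsEulerianOrientation out) (ι : D ≃ D') :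
    (M.transport ι).IsEulerianOrientation (out ∘ ι.symm) where
  out_opp d := by simp [PlanarMap.transport, Equiv.permCongr_apply, h.out_opp]
  balanced d := by
    have key : ∀ b, {e | (M.transport ι).rot.SameCycle d e ∧ (out ∘ ι.symm) e = b} =
        ι '' {e | M.rot.SameCycle (ι.symm d) e ∧ out e = b} := by
      intro b
      ext e
      obtain ⟨e, rfl⟩ := ι.surjective e
      obtain ⟨d, rfl⟩ := ι.surjective d
      simp [PlanarMap.transport, sameCycle_permCongr]
    rw [key, key, Set.ncard_image_of_injective _ ι.injective,
      Set.ncard_image_of_injective _ ι.injective, h.balanced]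

namespace RootedQuarticOrientation

variable {D D' : Type}

theorem ext_data {M N : RootedQuarticOrientation D} (h1 : M.rot = N.rot)
    (h2 : M.opp = N.opp) (h3 : M.out = N.out) (h4 : M.root = N.root) : M = N := by
  obtain ⟨⟨_, _, _, _, _, _⟩, _, _, _, _, _⟩ := M
  obtain ⟨⟨_, _, _, _, _, _⟩, _, _, _, _, _⟩ := N
  simp only at h1 h2 h3 h4
  subst h1 h2 h3 h4
  rfl

instance [Finite D] : Finite (RootedQuarticOrientation D) :=
  Finite.of_injective (fun M => (M.rot, M.opp, M.out, M.root)) fun M N h => by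
    simp only [Prod.mk.injEq] at h
    exact ext_data h.1 h.2.1 h.2.2.1 h.2.2.2

/-- Relabelling the half-edges of a rooted quartic orientation. -/
def transport [Finite D] (M : RootedQuarticOrientation D) (ι : D ≃ D') :
    RootedQuarticOrientation D' where
  toPlanarMap := M.toPlanarMap.transport ι
  out := M.out ∘ ι.symm
  root := ι M.root
  quartic := by
    have : Finite D' := Finite.of_equiv D ι
    have hq := (PlanarMap.isQuartic_iff _).1 M.quartic
    rw [PlanarMap.isQuartic_iff]
    intro d
    obtain ⟨d, rfl⟩ := ι.surjective d
    simpa [PlanarMap.transport, Equiv.permCongr_apply] using hq d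
  eulerian := M.eulerian.transport ι
  root_out := by simpa using M.root_out

section

variable [Finite D] (M N : RootedQuarticOrientation D) (ι : D ≃ D')

theorem transport_rot : (M.transport ι).rot = ι.permCongr M.rot := rfl

theorem transport_opp : (M.transport ι).opp = ι.permCongr M.opp := rfl

theorem transport_out : (M.transport ι).out = M.out ∘ ι.symm := rfl

theorem transport_root : (M.transport ι).root = ι M.root := rfl

theorem iso_iff : Iso M N ↔ ∃ f : Perm D, M.transport f = N := by
  refine exists_congr fun f => ?_
  constructor
  · rintro ⟨h1, h2, h3, h4⟩
    refine ext_data (Equiv.ext fun d => ?_) (Equiv.ext fun d => ?_) (funext fun d => ?_) h4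
    · rw [transport_rot, Equiv.permCongr_apply, h1, Equiv.apply_symm_apply]
    · rw [transport_opp, Equiv.permCongr_apply, h2, Equiv.apply_symm_apply]
    · rw [transport_out, Function.comp_apply, ← h3, Equiv.apply_symm_apply]
  · rintro rfl
    simp [transport_rot, transport_opp, transport_out, transport_root]

/-- A rooted map has no nontrivial automorphism. -/
theorem transport_injective : Function.Injective fun f : Perm D => M.transport f := by
  intro f g h
  have h1 : ∀ d, f (M.rot d) = (M.transport f).rot (f d) := fun d => by
    simp [transport_rot]
  have h1' : ∀ d, g (M.rot d) = (M.transport g).rot (g d) := fun d => by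
    simp [transport_rot]
  have h2 : ∀ d, f (M.opp d) = (M.transport f).opp (f d) := fun d => by
    simp [transport_opp]
  have h2' : ∀ d, g (M.opp d) = (M.transport g).opp (g d) := fun d => by
    simp [transport_opp]
  have h3 : f M.root = g M.root := congrArg RootedQuarticOrientation.root h
  have h' : M.transport f = M.transport g := h
  -- The set where `f` and `g` agree contains the root and is stable under both permutations.
  have := (closure_transitive_iff _ _).1 M.connected {x | f x = g x} (fun x hx => ?_)
    (fun x hx => ?_) ⟨M.root, h3⟩
  · refine Equiv.ext fun x => ?_
    have hx : x ∈ (Set.univ : Set D) := trivial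
    rwa [← this] at hx
  · change f _ = g _
    rw [h1, h1', h', show f x = g x from hx]
  · change f _ = g _
    rw [h2, h2', h', show f x = g x from hx]

theorem numAlternating_transport : (M.transport ι).numAlternating = M.numAlternating := by
  refine (Nat.card_congr (Equiv.subtypeEquiv (cyclesCongr ι M.rot) fun q => ?_)).symm
  constructor
  · intro h d hd
    obtain ⟨d, rfl⟩ := ι.surjective d
    have := h d ((cyclesCongr ι M.rot).injective hd)
    simpa [transport_rot, transport_out, Equiv.permCongr_apply] using this
  · intro h d hd
    have := h (ι d) (by rw [← hd]; rfl)
    simpa [transport_rot, transport_out, Equiv.permCongr_apply] using this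

end

/-- Every isomorphism class has as many elements as there are renamings. -/
theorem card_numAlternating_eq (n k : ℕ) :
    Nat.card {M : RootedQuarticOrientation (Fin (4 * n)) // M.numAlternating = k} =
      count n k * (4 * n).factorial := by
  set X := {M : RootedQuarticOrientation (Fin (4 * n)) // M.numAlternating = k}
  let st : Setoid X := (isoSetoid (Fin (4 * n))).comap Subtype.val
  -- A labelled map is a relabelling of the chosen representative of its class, and the relabelling
  -- is unique by rigidity.
  let F : Quotient st × Perm (Fin (4 * n)) → X := fun p =>
    ⟨p.1.out.1.transport p.2, by rw [numAlternating_transport]; exact p.1.out.2⟩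
  have hF : Function.Bijective F := by
    constructor
    · rintro ⟨q, f⟩ ⟨q', f'⟩ h
      have h' : q.out.1.transport f = q'.out.1.transport f' := congrArg Subtype.val h
      have hq : q = q' := by
        rw [← Quotient.out_eq q, ← Quotient.out_eq q']
        refine Quotient.sound ?_
        exact ((isoSetoid _).trans ((iso_iff _ _).2 ⟨f, h'⟩)
          ((isoSetoid _).symm ((iso_iff _ _).2 ⟨f', rfl⟩)) : Iso _ _)
      subst hq
      rw [transport_injective _ h']
    · intro M
      have hM : Iso (Quotient.mk st M).out.1 M.1 := Quotient.exact (Quotient.out_eq (Quotient.mk st M))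
      obtain ⟨f, hf⟩ := (iso_iff _ _).1 hM
      exact ⟨(Quotient.mk st M, f), Subtype.ext hf⟩
  rw [← Nat.card_congr (Equiv.ofBijective F hF), Nat.card_prod, Nat.card_perm, Nat.card_fin]
  rfl

theorem numCycles_rot {n : ℕ} {D : Type} [Finite D] (hD : Nat.card D = 4 * n)
    (M : RootedQuarticOrientation D) : numCycles M.rot = n := by
  have := numCycles_mul_of_minimalPeriod (f := M.rot) (k := 4) fun d => by
    rw [← ncard_sameCycle]; exact M.quartic d
  omega

theorem numAlternating_le {n : ℕ} {D : Type} [Finite D] (hD : Nat.card D = 4 * n)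
    (M : RootedQuarticOrientation D) : M.numAlternating ≤ n := by
  rw [← numCycles_rot hD M]
  exact Nat.card_le_card_of_injective _ Subtype.val_injective

open Classical in
theorem sum_pow_numAlternating {K : Type*} [Field K] (γ : K) (n : ℕ)
    [Fintype (RootedQuarticOrientation (Fin (4 * n)))] :
    ∑ M : RootedQuarticOrientation (Fin (4 * n)), γ ^ M.numAlternating =
      (4 * n).factorial * ∑ k ∈ Finset.range (n + 1), (count n k : K) * γ ^ k := by
  rw [← Finset.sum_fiberwise_of_maps_to (t := Finset.range (n + 1))
    (g := fun M : RootedQuarticOrientation (Fin (4 * n)) => M.numAlternating)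
    (fun M _ => Finset.mem_range.2 (Nat.lt_succ_of_le (numAlternating_le (by simp) M))),
    Finset.mul_sum]
  refine Finset.sum_congr rfl fun k _ => ?_
  have h1 : ∑ M : RootedQuarticOrientation (Fin (4 * n)) with M.numAlternating = k,
      γ ^ M.numAlternating = ∑ M : RootedQuarticOrientation (Fin (4 * n))
        with M.numAlternating = k, γ ^ k :=
    Finset.sum_congr rfl fun M hM => by rw [(Finset.mem_filter.1 hM).2]
  rw [h1, Finset.sum_const, nsmul_eq_mul, ← Fintype.card_subtype, ← Nat.card_eq_fintype_card,
    card_numAlternating_eq, Nat.cast_mul]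
  ring

end RootedQuarticOrientation

/-! ### The map of a loop system -/

section MapOfSystem

variable {E : Type}

/-- The rotation around the vertices of the map of a loop system: each vertex carries two arcs
matched by `τ`, and `(e, true)`, `(e, false)` are the outgoing and ingoing half of the arc `e`. -/
def rotOf (τ : Perm E) (c : E → Bool) : Perm (E × Bool) where
  toFun x := if x.2 = c x.1 then (x.1, !x.2) else firstDart c (τ x.1)
  invFun x := if x.2 = c x.1 then (τ.symm x.1, !c (τ.symm x.1)) else firstDart c x.1
  left_inv := by
    rintro ⟨e, b⟩
    by_cases h : b = c e
    · simp [h, firstDart]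
    · simp [firstDart, Bool.eq_not.2 h]
  right_inv := by
    rintro ⟨e, b⟩
    by_cases h : b = c e
    · simp [h, firstDart]
    · simp [firstDart, Bool.eq_not.2 h]

/-- The edges of the map of a loop system join each arc to the next one. -/
def oppOf (σ : Perm E) : Perm (E × Bool) where
  toFun x := (if x.2 then σ x.1 else σ.symm x.1, !x.2)
  invFun x := (if x.2 then σ x.1 else σ.symm x.1, !x.2)
  left_inv := by rintro ⟨e, _ | _⟩ <;> simp
  right_inv := by rintro ⟨e, _ | _⟩ <;> simp

variable {σ τ : Perm E} {c : E → Bool}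

theorem rotOf_firstDart (e : E) : rotOf τ c (e, c e) = (e, !c e) := by simp [rotOf]

theorem rotOf_lastDart (e : E) : rotOf τ c (e, !c e) = (τ e, c (τ e)) := by
  simp [rotOf, firstDart]

theorem oppOf_true (e : E) : oppOf σ (e, true) = (σ e, false) := rfl

theorem oppOf_false (e : E) : oppOf σ (e, false) = (σ.symm e, true) := rfl

theorem oppOf_oppOf (x : E × Bool) : oppOf σ (oppOf σ x) = x := (oppOf σ).left_inv x

theorem oppOf_snd (x : E × Bool) : (oppOf σ x).2 = !x.2 := rfl

/-- This identifies the faces of the map with those of the exploration. Walking along a side of a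
loop, one passes to the next arc; if that arc has its dashed end on this side, one crosses along the
dashed edge, otherwise one stays. -/
theorem rotOf_mul_oppOf (x : E × Bool) : (rotOf τ c * oppOf σ) x = twist τ c (sideNext σ x) := by
  obtain ⟨e, b⟩ := x
  rw [Perm.mul_apply, sideNext, twist]
  cases b
  · rw [oppOf_false]
    cases h : c (σ.symm e) <;> simp [rotOf, h, firstDart]
  · rw [oppOf_true]
    cases h : c (σ e) <;> simp [rotOf, h, firstDart]

theorem rotOf_quartic (hτ : IsMatching τ) (x : E × Bool) :
    rotOf τ c (rotOf τ c (rotOf τ c (rotOf τ c x))) = x ∧ rotOf τ c (rotOf τ c x) ≠ x := by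
  obtain ⟨e, b⟩ := x
  have h2 := hτ.2 e
  by_cases h : b = c e
  · subst h
    simp only [rotOf_firstDart, rotOf_lastDart, hτ.1, true_and]
    exact fun h => h2 (congrArg Prod.fst h)
  · obtain rfl := Bool.eq_not.2 h
    simp only [rotOf_firstDart, rotOf_lastDart, hτ.1, true_and]
    exact fun h => h2 (congrArg Prod.fst h)

/-- The arcs that can be reached from `r` make up the whole system. -/
def IsConnectedFrom (σ τ : Perm E) (r : E) : Prop :=
  ∀ T : Set E, r ∈ T → (∀ e ∈ T, σ e ∈ T) → (∀ e ∈ T, τ e ∈ T) → ∀ e, e ∈ T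

/-- Both halves of an arc belong to the same vertex, so stable sets of half-edges are the same as
stable sets of arcs. -/
theorem isConnectedFrom_iff [Finite E] (r : E) : IsConnectedFrom σ τ r ↔
    ∀ d e, ∃ g ∈ Subgroup.closure {rotOf τ c, oppOf σ}, g d = e := by
  rw [closure_transitive_iff]
  constructor
  · intro h T hf hg ⟨d, hd⟩
    have hboth : ∀ e b b', (e, b) ∈ T → (e, b') ∈ T := by
      intro e b b' hb
      have hinv := Perm.perm_symm_mapsTo_of_mapsTo (rotOf τ c) hf
      by_cases hbb : b = b'
      · rwa [← hbb]
      · by_cases hc : b = c e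
        · have := hf _ hb
          rwa [hc, rotOf_firstDart, ← hc, ← Bool.eq_not.2 (Ne.symm hbb)] at this
        · have := hinv hb
          have h' : (rotOf τ c).symm (e, b) = (e, b') := by
            rw [Equiv.symm_apply_eq, show b' = c e by cases b <;> cases b' <;> simp_all,
              rotOf_firstDart, Bool.eq_not.2 hc]
          rwa [h'] at this
    have hall : ∀ e, (e, true) ∈ T := by
      have hd' : (d.1, true) ∈ T := hboth _ _ _ hd
      -- The equivalence with the membership of `r` gives a set that contains `r` for free, although
      -- only `d` is known to be in `T`.
      have hconn := h {e | (r, true) ∈ T ↔ (e, true) ∈ T} Iff.rfl ?_ ?_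
      · have := (hconn d.1).2 hd'
        exact fun e => (hconn e).1 this
      · intro e he
        refine Iff.trans he ⟨fun h' => hboth _ _ _ (hg _ h'), fun h' => ?_⟩
        have := hg _ (hboth _ _ false h')
        rwa [oppOf_false, Equiv.symm_apply_apply] at this
      · intro e he
        refine Iff.trans he ⟨fun h' => ?_, fun h' => ?_⟩
        · have := hf _ (hboth _ _ (!c e) h')
          rw [rotOf_lastDart] at this
          exact hboth _ _ _ this
        · have := Perm.perm_symm_mapsTo_of_mapsTo (rotOf τ c) hf (hboth _ _ (c (τ e)) h')
          rw [← rotOf_lastDart, Equiv.symm_apply_apply] at this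
          exact hboth _ _ _ this
    exact Set.eq_univ_of_forall fun x => hboth _ _ _ (hall x.1)
  · intro h T hr hσ hτ e
    have := h {x | x.1 ∈ T} ?_ ?_ ⟨(r, true), hr⟩
    · have he : (e, true) ∈ (Set.univ : Set (E × Bool)) := trivial
      rwa [← this] at he
    · rintro ⟨x, b⟩ hx
      by_cases hb : b = c x
      · subst hb
        rw [rotOf_firstDart]; exact hx
      · rw [Bool.eq_not.2 hb, rotOf_lastDart]; exact hτ x hx
    · rintro ⟨x, _ | _⟩ hx
      · exact Perm.perm_symm_mapsTo_of_mapsTo σ hσ hx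
      · exact hσ x hx

theorem ends_perm (c : E → Bool) (r : E) (v : List E) :
    [leftEnds c v ++ (if c r then [] else [r]), (if c r then [r] else []) ++
      rightEnds c v].flatten.Perm (r :: v) := by
  have h : (leftEnds c v ++ rightEnds c v).Perm v := by
    refine ((List.reverse_perm _).append_right _).trans ?_
    have := List.filter_append_perm (fun e => !c e) v
    simpa [rightEnds] using this
  simp only [List.flatten_cons, List.flatten_nil, List.append_nil]
  cases hc : c r
  · simpa using List.perm_middle.trans (h.cons r)
  · simpa using List.perm_middle.trans (h.cons r)

variable [Fintype E]

theorem facePerm_univ (σ τ : Perm E) (c : E → Bool) : FacePerm (twist τ c) (sideNext σ)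
    (rotOf τ c * oppOf σ) ((Finset.univ : Finset E) ×ˢ Finset.univ) [] :=
  ⟨by simp, by simp, fun x _ => rotOf_mul_oppOf x, by simp, by simp, by simp⟩

variable [DecidableEq E]

/-- The number of faces is governed by the number of merges. -/
theorem numCycles_add_of_run (hτ : IsMatching τ) {n : ℕ} (hn : Fintype.card E = 2 * n) {r : E}
    {v : List E} (hnd : (r :: v).Nodup) (hv : IsPath σ r v r) {g : ℕ}
    (h : Run σ τ c (Finset.univ \ (r :: v).toFinset) [leftEnds c v ++ (if c r then [] else [r]),
      (if c r then [r] else []) ++ rightEnds c v] g) :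
    numCycles (rotOf τ c * oppOf σ) + 2 * g = n + 2 := by
  obtain ⟨φ, hφ, hcount⟩ := (facePerm_univ σ τ c).discover (fun _ _ => Finset.mem_univ _) hnd hv
  have h1 := h.faceCount_eq hτ.1 hφ
  have h2 := (ends_perm c r v).length_eq
  have h3 := Finset.card_sdiff_add_card_eq_card (Finset.subset_univ (r :: v).toFinset)
  rw [List.toFinset_card_of_nodup hnd, Finset.card_univ, hn] at h3
  simp only [List.map_cons, List.map_nil] at h1
  rw [hcount, h2] at h1
  simp only [faceCount, Finset.card_product, Finset.card_univ, Fintype.card_prod, hn,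
    Fintype.card_bool, List.count_nil, List.flatten_nil, List.length_nil, List.length_cons] at h1 h3
  omega

/-- A connected system always has an exploration, with some number `g` of merges and `n + 2 - 2 * g`
faces. Having `n + 2` faces is planarity for `n` vertices and `2 * n` edges. -/
theorem isExplored_iff {n : ℕ} (hn : Fintype.card E = 2 * n) (s : LoopSystem E) (r : E) :
    IsExplored s r ↔ IsMatching s.2.1 ∧ IsConnectedFrom s.1 s.2.1 r ∧
      numCycles (rotOf s.2.1 s.2.2 * oppOf s.1) = n + 2 := by
  constructor
  · rintro ⟨hM, v, hnd, hv, h⟩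
    refine ⟨hM, fun T hr hσ hτ e => ?_, ?_⟩
    · have hrv := hv.mem_of_closed hσ hr
      by_cases he : e ∈ r :: v
      · exact hrv e he
      · refine h.subset_of_closed hσ hτ (fun x hx => hrv x ((ends_perm _ r v).mem_iff.1 hx)) e ?_
        simpa only [Finset.mem_sdiff, Finset.mem_univ, true_and, List.mem_toFinset] using he
    · have := numCycles_add_of_run hM hn hnd hv h
      omega
  · rintro ⟨hM, hconn, hcyc⟩
    obtain ⟨v, hnd, hv, -⟩ := exists_isPath s.1 r
    have hmem : ∀ e, e ∈ Finset.univ \ (r :: v).toFinset ↔ e ∉ r :: v := fun e => by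
      simp only [Finset.mem_sdiff, Finset.mem_univ, true_and, List.mem_toFinset]
    have hS := ends_perm s.2.2 r v
    obtain ⟨g, hg⟩ := exists_run (σ := s.1) (c := s.2.2) hM.1 hM.2
      (Finset.univ \ (r :: v).toFinset) _ (hS.nodup_iff.2 hnd)
      (fun e he => by rw [hS.mem_iff]; exact (hmem e).1 he)
      (fun e he => by rw [hmem, hv.mem_iff]; exact (hmem e).1 he)
      (fun e _ => by rw [hmem, hS.mem_iff]; exact (em _).symm)
      -- The complement of `T` is stable and contains `r`, hence it is everything.
      (fun T hT hσ hτ => by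
        have hσ' := Perm.perm_symm_mapsTo_of_mapsTo s.1 (s := (T : Set E)) hσ
        refine Finset.eq_empty_of_forall_notMem fun e he => ?_
        refine hconn {x | x ∉ T} (fun hr => (hmem r).1 (hT hr) (by simp)) (fun x hx hx' => ?_)
          (fun x hx hx' => ?_) e he
        · have := hσ' hx'
          rw [Equiv.symm_apply_apply] at this
          exact hx this
        · have := hτ _ hx'
          rw [hM.1] at this
          exact hx this)
    have := numCycles_add_of_run hM hn hnd hv hg
    obtain rfl : g = 0 := by omega
    exact ⟨hM, v, hnd, hv, hg⟩

end MapOfSystem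

/-! ### Splitting the vertices into arcs -/

section Splitting

variable {D : Type}

/-- The cycles of a permutation. -/
abbrev Cycles (f : Perm D) : Type := Quotient (Perm.SameCycle.setoid f)

theorem exists_rotation_equiv [Finite D] {f : Perm D}
    (h : ∀ d, f (f (f (f d))) = d ∧ f (f d) ≠ d) :
    ∃ ε : Cycles f × Fin 4 ≃ D,
      (∀ q i, Quotient.mk (Perm.SameCycle.setoid f) (ε (q, i)) = q) ∧
      ∀ q i, f (ε (q, i)) = ε (q, i + 1) := by
  let F : Cycles f × Fin 4 → D := fun x => (f ^ (x.2 : ℕ)) x.1.out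
  have hmk : ∀ q i, Quotient.mk (Perm.SameCycle.setoid f) (F (q, i)) = q := by
    intro q i
    conv_rhs => rw [← Quotient.out_eq q]
    exact Quotient.sound (Perm.SameCycle.symm ⟨i, by simp [F]⟩)
  have h4 : f ^ (4 : ℤ) = 1 := Equiv.ext fun d => (h d).1
  have hsurj : Function.Surjective F := by
    intro d
    obtain ⟨i, hi⟩ : f.SameCycle (Quotient.mk (Perm.SameCycle.setoid f) d).out d :=
      Quotient.exact (Quotient.out_eq (Quotient.mk (Perm.SameCycle.setoid f) d))
    refine ⟨(Quotient.mk _ d, ⟨(i % 4).toNat, by omega⟩), ?_⟩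
    have hi' : f ^ (i % 4).toNat = f ^ i := by
      rw [← zpow_natCast, Int.toNat_of_nonneg (by omega)]
      conv_rhs => rw [← Int.emod_add_mul_ediv i 4, zpow_add, zpow_mul, h4, one_zpow, mul_one]
    simp only [F, hi']
    exact hi
  have hcard := numCycles_mul_of_minimalPeriod (k := 4) fun d => (minimalPeriod_eq_four_iff f d).2 (h d)
  have hbij : Function.Bijective F := by
    refine (Nat.bijective_iff_surjective_and_card F).2 ⟨hsurj, ?_⟩
    rw [Nat.card_prod, Nat.card_fin, ← hcard, numCycles]
  refine ⟨Equiv.ofBijective F hbij, hmk, fun q i => ?_⟩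
  change f ((f ^ (i : ℕ)) q.out) = (f ^ ((i + 1 : Fin 4) : ℕ)) q.out
  fin_cases i
  · rfl
  · rfl
  · rfl
  · exact (h _).1

/-- The parity of a position around a vertex. -/
def isOdd (i : Fin 4) : Bool := ![false, true, false, true] i

/-- Both ways of splitting a vertex of degree `4` into two arcs, summed with their weights. -/
theorem sum_local_splitting {K : Type*} [Field K] {a b : K} (hab : a * b = 1) (o : Fin 4 → Bool)
    (ho : ∑ i, (if o i = true then 1 else 0) = ∑ i, (if o i = false then 1 else 0))
    [Decidable (∀ i, o (i + 1) ≠ o i)] :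
    ∑ β : Bool, ∏ i : Fin 4, (if xor β (isOdd i) = true → o (i + 1) ≠ o i then
      (if xor β (isOdd i) then sideWeight a b (o i) else 1) else 0) =
      if ∀ i, o (i + 1) ≠ o i then a ^ 2 + b ^ 2 else 1 := by
  have hba : b * a = 1 := by rw [mul_comm, hab]
  have h01 : (0 : Fin 4) + 1 = 1 := rfl
  have h12 : (1 : Fin 4) + 1 = 2 := rfl
  have h23 : (2 : Fin 4) + 1 = 3 := rfl
  have h34 : (3 : Fin 4) + 1 = 0 := rfl
  simp only [Fin.sum_univ_four] at ho
  simp only [Fin.forall_fin_succ, Fin.prod_univ_four, h01, h12, h23, h34, Fintype.sum_bool]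
  -- Balance leaves six patterns. The two alternating ones allow both splittings, with weights `a ^
  -- 2` and `b ^ 2`. The four others allow one splitting, with one arc of each weight.
  cases h0 : o 0 <;> cases h1 : o 1 <;> cases h2 : o 2 <;> cases h3 : o 3 <;>
    simp [h0, h1, h2, h3, isOdd, sideWeight, hab, hba] at ho ⊢ <;> ring

/-- A choice, at each vertex, of two arcs that join an ingoing to an adjacent outgoing half-edge:
`f d` tells whether an arc goes counterclockwise from `d` to the next half-edge. -/
def IsSplitting (M : RootedQuarticOrientation D) (f : D → Bool) : Prop :=
  ∀ d, f (M.rot d) = !f d ∧ (f d = true → M.out (M.rot d) ≠ M.out d)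

/-- The weight of a splitting. -/
def splitWeight {K : Type*} [Field K] [Fintype D] (a b : K) (out f : D → Bool) : K :=
  ∏ d, if f d then sideWeight a b (out d) else 1

-- A splitting alternates around each vertex, so it amounts to one bit per vertex. The sum then
-- factors over the vertices into local sums.
open Classical in
theorem sum_splitWeight {K : Type*} [Field K] [Fintype D] {a b : K} (hab : a * b = 1)
    (M : RootedQuarticOrientation D) :
    ∑ f with IsSplitting M f, splitWeight a b M.out f = (a ^ 2 + b ^ 2) ^ M.numAlternating := by
  have hq := M.toPlanarMap.isQuartic_iff.1 M.quartic
  obtain ⟨ε, hmk, hrot⟩ := exists_rotation_equiv hq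
  let out : Cycles M.rot → Fin 4 → Bool := fun q i => M.out (ε (q, i))
  let split : (Cycles M.rot → Bool) → D → Bool := fun g d => xor (g (ε.symm d).1) (isOdd (ε.symm d).2)
  have hodd : ∀ i : Fin 4, isOdd (i + 1) = !isOdd i := by decide
  have hall : ∀ p : D → Prop, (∀ d, p d) ↔ ∀ q i, p (ε (q, i)) := fun p =>
    ⟨fun h q i => h _, fun h d => by simpa using h (ε.symm d).1 (ε.symm d).2⟩
  have hsplit : ∀ g q i, split g (ε (q, i)) = xor (g q) (isOdd i) := fun g q i => by simp [split]
  have hsp : ∀ g, IsSplitting M (split g) ↔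
      ∀ q i, xor (g q) (isOdd i) = true → out q (i + 1) ≠ out q i := by
    intro g
    rw [IsSplitting, hall]
    refine forall₂_congr fun q i => ?_
    rw [hrot, hsplit, hsplit, hodd, Bool.xor_not]
    simp [out]
  have hw : ∀ g, splitWeight a b M.out (split g) =
      ∏ q, ∏ i, if xor (g q) (isOdd i) then sideWeight a b (out q i) else 1 := by
    intro g
    rw [splitWeight, ← Equiv.prod_comp ε, Fintype.prod_prod_type]
    simp only [hsplit, out]
  have hbal : ∀ q, ∑ i, (if out q i = true then 1 else 0) =
      ∑ i, (if out q i = false then 1 else 0) := by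
    intro q
    have key : ∀ β, {e | M.rot.SameCycle (ε (q, 0)) e ∧ M.out e = β}.ncard =
        ∑ i, (if out q i = β then 1 else 0) := by
      intro β
      rw [← Finset.card_filter, ← Set.ncard_coe_finset,
        ← Set.ncard_image_of_injective _ (ε.injective.comp (Prod.mk_right_injective q))]
      congr 1
      ext d
      obtain ⟨⟨q', i⟩, rfl⟩ := ε.surjective d
      have : M.rot.SameCycle (ε (q, 0)) (ε (q', i)) ↔ q = q' := by
        conv_rhs => rw [← hmk q 0, ← hmk q' i]
        exact ⟨fun h => Quotient.sound h, fun h => Quotient.exact h⟩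
      simp only [Set.mem_ofPred_eq, this, Set.mem_image, Finset.coe_filter, Finset.mem_univ,
        true_and, Function.comp_apply, EmbeddingLike.apply_eq_iff_eq, Prod.mk.injEq]
      constructor
      · rintro ⟨rfl, h⟩; exact ⟨i, h, rfl, rfl⟩
      · rintro ⟨j, h, rfl, rfl⟩; exact ⟨rfl, h⟩
    rw [← key, ← key, M.eulerian.balanced]
  have hrec : ∀ f, IsSplitting M f → split (fun q => f (ε (q, 0))) = f := by
    intro f hf
    funext d
    obtain ⟨⟨q, i⟩, rfl⟩ := ε.surjective d
    have hs : ∀ i, f (ε (q, i + 1)) = !f (ε (q, i)) := fun i => by rw [← hrot, (hf _).1]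
    have h1 : f (ε (q, 1)) = !f (ε (q, 0)) := hs 0
    have h2 : f (ε (q, 2)) = f (ε (q, 0)) := by rw [show (2 : Fin 4) = 1 + 1 from rfl, hs, h1]; simp
    have h3 : f (ε (q, 3)) = !f (ε (q, 0)) := by rw [show (3 : Fin 4) = 2 + 1 from rfl, hs, h2]
    rw [hsplit (fun q => f (ε (q, 0))) q i]
    fin_cases i
    · simp [isOdd]
    · simp [isOdd, h1]
    · simp [isOdd, h2]
    · simp [isOdd, h3]
  calc ∑ f with IsSplitting M f, splitWeight a b M.out f
      = ∑ g with IsSplitting M (split g), splitWeight a b M.out (split g) := by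
        refine (Finset.sum_nbij' split (fun f q => f (ε (q, 0))) ?_ ?_ ?_ ?_ ?_).symm
        · simp
        · intro f hf
          simp only [Finset.mem_filter, Finset.mem_univ, true_and] at hf ⊢
          rwa [hrec f hf]
        · intro g _
          funext q
          simp [hsplit, isOdd]
        · intro f hf
          exact hrec f (Finset.mem_filter.1 hf).2
        · simp
    _ = ∑ g : Cycles M.rot → Bool, ∏ q, ∏ i : Fin 4, (if xor (g q) (isOdd i) = true →
          out q (i + 1) ≠ out q i then
            (if xor (g q) (isOdd i) then sideWeight a b (out q i) else 1) else 0) := by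
        rw [Finset.sum_filter]
        refine Finset.sum_congr rfl fun g _ => ?_
        rw [hw]
        simp only [Finset.prod_ite_zero, hsp, Finset.mem_univ, true_imp_iff]
    _ = ∏ q : Cycles M.rot, if ∀ i, out q (i + 1) ≠ out q i then a ^ 2 + b ^ 2 else 1 := by
        have := Finset.prod_univ_sum (fun _ : Cycles M.rot => (Finset.univ : Finset Bool))
          (fun q β => ∏ i : Fin 4, (if xor β (isOdd i) = true →
          out q (i + 1) ≠ out q i then
            (if xor β (isOdd i) then sideWeight a b (out q i) else 1) else 0))
        rw [Fintype.piFinset_univ] at this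
        rw [← this]
        exact Finset.prod_congr rfl fun q _ => sum_local_splitting hab _ (hbal q)
    _ = (a ^ 2 + b ^ 2) ^ M.numAlternating := by
        rw [Finset.prod_ite, Finset.prod_const_one, mul_one, Finset.prod_const,
          ← Fintype.card_subtype, ← Nat.card_eq_fintype_card]
        congr 1
        refine Nat.card_congr (Equiv.subtypeEquivRight fun q => ?_)
        rw [hall]
        constructor
        · intro h q' i hq'
          rw [hmk] at hq'
          subst hq'
          rw [hrot]
          exact h i
        · intro h i
          have := h q i (hmk q i)
          rwa [hrot] at this

end Splitting

/-! ### The two ends of an arc -/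

section Relabel

variable {D D' : Type}

/-- The other end of the arc of a splitting. -/
def mate (M : RootedQuarticOrientation D) (f : D → Bool) (d : D) : D :=
  if f d then M.rot d else M.rot.symm d

theorem IsSplitting.apply_symm {M : RootedQuarticOrientation D} {f : D → Bool}
    (h : IsSplitting M f) (d : D) : f (M.rot.symm d) = !f d := by
  have := (h (M.rot.symm d)).1
  rw [Equiv.apply_symm_apply] at this
  rw [this, Bool.not_not]

theorem IsSplitting.apply_mate {M : RootedQuarticOrientation D} {f : D → Bool}
    (h : IsSplitting M f) (d : D) : f (mate M f d) = !f d := by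
  rw [mate]
  split_ifs
  · exact (h d).1
  · exact h.apply_symm d

theorem IsSplitting.mate_mate {M : RootedQuarticOrientation D} {f : D → Bool}
    (h : IsSplitting M f) (d : D) : mate M f (mate M f d) = d := by
  have h' := h.apply_mate d
  cases hd : f d
  · rw [mate, if_pos (by rw [h', hd]; rfl), mate, if_neg (by simp [hd]), Equiv.apply_symm_apply]
  · rw [mate, if_neg (by rw [h', hd]; simp), mate, if_pos hd, Equiv.symm_apply_apply]

theorem IsSplitting.out_mate {M : RootedQuarticOrientation D} {f : D → Bool}
    (h : IsSplitting M f) (d : D) : M.out (mate M f d) = !M.out d := by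
  cases hd : f d
  · have h1 := (h (M.rot.symm d)).2 (by rw [h.apply_symm, hd]; rfl)
    rw [Equiv.apply_symm_apply] at h1
    rw [mate, if_neg (by simp [hd])]
    exact Bool.eq_not.2 h1.symm
  · rw [mate, if_pos hd]
    exact Bool.eq_not.2 ((h d).2 hd)

/-- Relabelling the half-edges, as a bijection. -/
def transportEquiv [Finite D] [Finite D'] (ι : D ≃ D') :
    RootedQuarticOrientation D ≃ RootedQuarticOrientation D' where
  toFun M := M.transport ι
  invFun M := M.transport ι.symm
  left_inv M := by
    refine RootedQuarticOrientation.ext_data (Equiv.ext fun d => ?_) (Equiv.ext fun d => ?_)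
      (funext fun d => ?_) ?_ <;>
    simp [RootedQuarticOrientation.transport_rot, RootedQuarticOrientation.transport_opp,
      RootedQuarticOrientation.transport_out, RootedQuarticOrientation.transport_root]
  right_inv M := by
    refine RootedQuarticOrientation.ext_data (Equiv.ext fun d => ?_) (Equiv.ext fun d => ?_)
      (funext fun d => ?_) ?_ <;>
    simp [RootedQuarticOrientation.transport_rot, RootedQuarticOrientation.transport_opp,
      RootedQuarticOrientation.transport_out, RootedQuarticOrientation.transport_root]

theorem isSplitting_transport [Finite D] (M : RootedQuarticOrientation D) (ι : D ≃ D')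
    (f : D → Bool) : IsSplitting (M.transport ι) (f ∘ ι.symm) ↔ IsSplitting M f := by
  constructor
  · intro h d
    simpa [RootedQuarticOrientation.transport_rot, RootedQuarticOrientation.transport_out] using h (ι d)
  · intro h d
    simpa [RootedQuarticOrientation.transport_rot, RootedQuarticOrientation.transport_out,
      Equiv.permCongr_apply] using h (ι.symm d)

theorem mate_transport [Finite D] (M : RootedQuarticOrientation D) (ι : D ≃ D')
    (f : D → Bool) (d : D) : mate (M.transport ι) (f ∘ ι.symm) (ι d) = ι (mate M f d) := by
  simp only [mate, RootedQuarticOrientation.transport_rot, Function.comp_apply,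
    Equiv.symm_apply_apply]
  split_ifs
  · simp
  · rw [Equiv.symm_apply_eq]; simp

end Relabel

/-! ### Labelling the arcs -/

section Adapted

variable {E D : Type}

/-- A labelling of the half-edges by pairs: `(e, true)` is the outgoing end of the arc `e`, and
`(e, false)` the ingoing end. -/
def IsAdapted (M : RootedQuarticOrientation D) (f : D → Bool) (ι : E × Bool ≃ D) : Prop :=
  ∀ e, M.out (ι (e, true)) = true ∧ ι (e, false) = mate M f (ι (e, true))

open Classical in
/-- The adapted labellings only depend on the labels of the arcs. -/
theorem card_isAdapted [Fintype E] [Fintype D] (hD : Fintype.card D = 2 * Fintype.card E)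
    {M : RootedQuarticOrientation D} {f : D → Bool} (h : IsSplitting M f) :
    Fintype.card {ι : E × Bool ≃ D // IsAdapted M f ι} = (Fintype.card E).factorial := by
  let S := {d // M.out d = true}
  -- Every arc has exactly one outgoing end, so an adapted labelling is just a bijection from `E` to
  -- the outgoing half-edges.
  let Θ : S × Bool ≃ D :=
    { toFun := fun x => if x.2 then x.1.1 else mate M f x.1.1
      invFun := fun d => if hd : M.out d = true then (⟨d, hd⟩, true) else
        (⟨mate M f d, by rw [h.out_mate]; simp [hd]⟩, false)
      left_inv := by
        rintro ⟨⟨d, hd⟩, _ | _⟩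
        · simp [h.out_mate, hd, h.mate_mate]
        · simp [hd]
      right_inv := by
        intro d
        by_cases hd : M.out d = true
        · simp [hd]
        · simp [hd, h.mate_mate] }
  have hS : Fintype.card E = Fintype.card S := by
    have := Fintype.card_congr Θ
    rw [Fintype.card_prod, Fintype.card_bool, hD] at this
    omega
  let F : (E ≃ S) → {ι : E × Bool ≃ D // IsAdapted M f ι} := fun φ =>
    ⟨(φ.prodCongr (Equiv.refl Bool)).trans Θ, fun e => ⟨(φ e).2, rfl⟩⟩
  have hF : Function.Bijective F := by
    constructor
    · intro φ ψ hφψ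
      refine Equiv.ext fun e => Subtype.ext ?_
      exact DFunLike.congr_fun (congrArg Subtype.val hφψ) (e, true)
    · rintro ⟨ι, hι⟩
      let φ : E → S := fun e => ⟨ι (e, true), (hι e).1⟩
      have hφ : Function.Bijective φ := by
        refine (Fintype.bijective_iff_injective_and_card φ).2 ⟨fun x y hxy => ?_, hS⟩
        exact congrArg Prod.fst (ι.injective (congrArg Subtype.val hxy))
      refine ⟨Equiv.ofBijective φ hφ, Subtype.ext (Equiv.ext ?_)⟩
      rintro ⟨e, _ | _⟩
      · exact (hι e).2.symm
      · rfl
  rw [← Fintype.card_congr (Equiv.ofBijective F hF), Fintype.card_equiv (Fintype.equivOfCardEq hS)]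

theorem isAdapted_transport [Finite D] (M : RootedQuarticOrientation D) (f : D → Bool)
    (ι : E × Bool ≃ D) :
    IsAdapted (M.transport ι.symm) (f ∘ ι) (Equiv.refl (E × Bool)) ↔ IsAdapted M f ι := by
  refine forall_congr' fun e => ?_
  have := mate_transport M ι.symm f (ι (e, true))
  rw [Equiv.symm_symm, Equiv.symm_apply_apply] at this
  rw [RootedQuarticOrientation.transport_out, Equiv.refl_apply, Equiv.refl_apply, this,
    Equiv.eq_symm_apply]
  rfl

theorem splitWeight_transport {K : Type*} [Field K] [Fintype E] [Fintype D] (a b : K)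
    (out f : D → Bool) (ι : E × Bool ≃ D) :
    splitWeight a b (out ∘ ι) (f ∘ ι) = splitWeight a b out f :=
  Equiv.prod_comp ι fun d => if f d then sideWeight a b (out d) else 1

open Classical in
/-- Counting the adapted labellings of all split orientations in two ways. -/
theorem factorial_mul_sum_splitWeight {K : Type*} [Field K] (a b : K) [Fintype E] [Fintype D]
    [Fintype (RootedQuarticOrientation D)] [Fintype (RootedQuarticOrientation (E × Bool))]
    (hD : Fintype.card D = 2 * Fintype.card E) :
    ((Fintype.card E).factorial : K) * ∑ p : RootedQuarticOrientation D × (D → Bool)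
        with IsSplitting p.1 p.2, splitWeight a b p.1.out p.2 =
      (Fintype.card D).factorial *
        ∑ p : RootedQuarticOrientation (E × Bool) × (E × Bool → Bool)
          with IsSplitting p.1 p.2 ∧ IsAdapted p.1 p.2 (Equiv.refl _),
            splitWeight a b p.1.out p.2 := by
  have hcard : Fintype.card (E × Bool ≃ D) = (Fintype.card D).factorial := by
    have h : Fintype.card (E × Bool) = Fintype.card D := by
      rw [Fintype.card_prod, Fintype.card_bool, hD, mul_comm]
    rw [Fintype.card_equiv (Fintype.equivOfCardEq h), h]
  calc _ = ∑ p : RootedQuarticOrientation D × (D → Bool), ∑ ι : E × Bool ≃ D,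
        if IsSplitting p.1 p.2 ∧ IsAdapted p.1 p.2 ι then splitWeight a b p.1.out p.2 else 0 := by
        rw [Finset.sum_filter, Finset.mul_sum]
        refine Finset.sum_congr rfl fun p _ => ?_
        by_cases hp : IsSplitting p.1 p.2
        · simp only [hp, true_and, if_true]
          rw [← Finset.sum_filter, Finset.sum_const, ← Fintype.card_subtype, card_isAdapted hD hp,
            nsmul_eq_mul]
        · simp [hp]
    _ = ∑ ι : E × Bool ≃ D, ∑ p : RootedQuarticOrientation (E × Bool) × (E × Bool → Bool)
          with IsSplitting p.1 p.2 ∧ IsAdapted p.1 p.2 (Equiv.refl _),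
            splitWeight a b p.1.out p.2 := by
        rw [Finset.sum_comm]
        refine Finset.sum_congr rfl fun ι _ => ?_
        rw [← Finset.sum_filter]
        refine Finset.sum_equiv ((transportEquiv ι.symm).prodCongr (ι.symm.arrowCongr (Equiv.refl Bool)))
          (fun p => ?_) (fun p _ => (splitWeight_transport a b p.1.out p.2 ι).symm)
        simp only [Finset.mem_filter, Finset.mem_univ, true_and]
        exact and_congr (isSplitting_transport p.1 ι.symm p.2).symm (isAdapted_transport p.1 p.2 ι).symm
    _ = _ := by rw [Finset.sum_const, nsmul_eq_mul, Finset.card_univ, hcard]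

end Adapted

/-! ### Split orientations as loop systems -/

section MapOfExplored

variable {E : Type}

theorem rotOf_sameCycle_flip (τ : Perm E) (c : E → Bool) (x : E × Bool) :
    (rotOf τ c).SameCycle x (x.1, !x.2) := by
  obtain ⟨e, b⟩ := x
  by_cases h : b = c e
  · exact ⟨1, by rw [zpow_one, h, rotOf_firstDart]⟩
  · refine Perm.SameCycle.symm ⟨1, ?_⟩
    rw [zpow_one, Bool.eq_not.2 h, Bool.not_not, rotOf_firstDart]

/-- The splitting of the orientation of a loop system. -/
def splittingOf (c : E → Bool) (x : E × Bool) : Bool := x.2 == c x.1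

/-- Of the two halves of an arc `e`, only the first one, `(e, c e)`, carries a weight; it is
outgoing exactly when the dashed end is on the right. -/
theorem splitWeight_splittingOf {K : Type*} [Field K] (a b : K) [Fintype E] (s : LoopSystem E) :
    splitWeight a b Prod.snd (splittingOf s.2.2) = weightOn a b Finset.univ s := by
  rw [splitWeight, weightOn, Fintype.prod_prod_type]
  refine Finset.prod_congr rfl fun e _ => ?_
  cases hc : s.2.2 e <;> simp [splittingOf, hc]

variable [DecidableEq E] [Fintype E]

/-- The rooted quartic orientation of an explored loop system. -/
def IsExplored.toOrientation {n : ℕ} (hn : Fintype.card E = 2 * n) {s : LoopSystem E} {r : E}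
    (h : IsExplored s r) : RootedQuarticOrientation (E × Bool) where
  rot := rotOf s.2.1 s.2.2
  opp := oppOf s.1
  opp_opp := oppOf_oppOf
  opp_ne d hd := by simpa [oppOf_snd] using congrArg Prod.snd hd
  connected := (isConnectedFrom_iff r).1 ((isExplored_iff hn s r).1 h).2.1
  euler := by
    obtain ⟨hM, -, hcyc⟩ := (isExplored_iff hn s r).1 h
    have h1 := numCycles_mul_of_minimalPeriod (f := rotOf s.2.1 s.2.2) (k := 4) fun d =>
      (minimalPeriod_eq_four_iff _ d).2 (rotOf_quartic hM d)
    have h2 := numCycles_mul_of_minimalPeriod (f := oppOf s.1) (k := 2) fun d =>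
      (minimalPeriod_eq_two_iff _ d).2 ⟨oppOf_oppOf d, fun hd => by
        simpa [oppOf_snd] using congrArg Prod.snd hd⟩
    rw [Nat.card_eq_fintype_card, Fintype.card_prod, Fintype.card_bool, hn] at h1 h2
    omega
  out := Prod.snd
  root := (r, true)
  quartic := (PlanarMap.isQuartic_iff _).2 (rotOf_quartic ((isExplored_iff hn s r).1 h).1)
  eulerian :=
    { out_opp := oppOf_snd
      balanced := fun d => by
        -- Exchanging the two halves of each arc maps the outgoing half-edges of a vertex onto the
        -- ingoing ones.
        have hinj : Function.Injective fun x : E × Bool => (x.1, !x.2) := by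
          rintro ⟨x, b⟩ ⟨y, b'⟩ hxy
          simpa using hxy
        rw [← Set.ncard_image_of_injective _ hinj]
        congr 1
        ext ⟨x, b⟩
        simp only [Set.mem_image, Set.mem_ofPred_eq, Prod.mk.injEq]
        constructor
        · rintro ⟨y, ⟨hy, hy'⟩, rfl, rfl⟩
          exact ⟨hy.trans (rotOf_sameCycle_flip _ _ y), by simp [hy']⟩
        · rintro ⟨hx, rfl⟩
          exact ⟨(x, true), ⟨hx.trans (rotOf_sameCycle_flip _ _ (x, false)), rfl⟩, rfl, rfl⟩ }
  root_out := rfl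

theorem IsExplored.isSplitting {n : ℕ} (hn : Fintype.card E = 2 * n) {s : LoopSystem E} {r : E}
    (h : IsExplored s r) : IsSplitting (h.toOrientation hn) (splittingOf s.2.2) := by
  rintro ⟨e, b⟩
  change splittingOf _ (rotOf _ _ _) = _ ∧ (_ → (rotOf _ _ _).2 ≠ b)
  by_cases hb : b = s.2.2 e
  · subst hb
    simp [rotOf_firstDart, splittingOf]
  · rw [Bool.eq_not.2 hb]
    simp [rotOf_lastDart, splittingOf]

theorem IsExplored.isAdapted {n : ℕ} (hn : Fintype.card E = 2 * n) {s : LoopSystem E} {r : E}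
    (h : IsExplored s r) :
    IsAdapted (h.toOrientation hn) (splittingOf s.2.2) (Equiv.refl (E × Bool)) := by
  refine fun e => ⟨rfl, ?_⟩
  rw [mate]
  change _ = if _ then rotOf s.2.1 s.2.2 (e, true) else (rotOf s.2.1 s.2.2).symm (e, true)
  have h1 := rotOf_firstDart (τ := s.2.1) (c := s.2.2) e
  cases hc : s.2.2 e
  · rw [hc] at h1
    simp only [Bool.not_false] at h1
    rw [if_neg (by simp [splittingOf, hc]), ← h1, Equiv.symm_apply_apply]
    rfl
  · rw [hc] at h1
    rw [if_pos (by simp [splittingOf, hc]), h1]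
    rfl

/-- Every adapted orientation comes from a loop system. -/
theorem exists_isExplored {n : ℕ} (hn : Fintype.card E = 2 * n)
    {M : RootedQuarticOrientation (E × Bool)} {f : E × Bool → Bool} (hf : IsSplitting M f)
    (hA : IsAdapted M f (Equiv.refl _)) :
    ∃ (s : LoopSystem E) (r : E) (h : IsExplored s r), h.toOrientation hn = M ∧
      splittingOf s.2.2 = f := by
  have hm : ∀ x : E × Bool, mate M f x = (x.1, !x.2) := by
    rintro ⟨e, _ | _⟩
    · have := hf.mate_mate (e, true)
      rwa [← Equiv.refl_apply (e, true), ← (hA e).2] at this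
    · exact (hA e).2.symm
  have hout : ∀ x : E × Bool, M.out x = x.2 := by
    rintro ⟨e, _ | _⟩
    · have := hf.out_mate (e, true)
      rw [hm] at this
      exact this.trans (by rw [show M.out (e, true) = true from (hA e).1]; rfl)
    · exact (hA e).1
  let c : E → Bool := fun e => f (e, true)
  have hfc : splittingOf c = f := by
    funext ⟨e, b⟩
    have h1 := hf.apply_mate (e, true)
    rw [hm] at h1
    simp only [Bool.not_true] at h1
    cases b
    · rw [h1]; simp [splittingOf, c]
    · simp [splittingOf, c]
  have hfirst : ∀ e, M.rot (e, c e) = (e, !c e) := by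
    intro e
    have := hm (e, c e)
    rwa [mate, if_pos (by rw [← hfc]; simp [splittingOf])] at this
  -- After the last half of an arc comes the first half of an arc at the same vertex, which defines
  -- the partner.
  have hlast : ∀ e, M.rot (e, !c e) = ((M.rot (e, !c e)).1, c (M.rot (e, !c e)).1) := by
    intro e
    have h1 := (hf (e, !c e)).1
    rw [← hfc] at h1
    simp only [splittingOf] at h1
    refine Prod.ext rfl ?_
    simpa using h1
  have hq := M.toPlanarMap.isQuartic_iff.1 M.quartic
  have htwo : ∀ e, M.rot (M.rot (e, !c e)) = ((M.rot (e, !c e)).1, !c (M.rot (e, !c e)).1) :=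
    fun e => by conv_lhs => rw [hlast, hfirst]
  let τf : E → E := fun e => (M.rot (e, !c e)).1
  have hττ : ∀ e, τf (τf e) = e := by
    intro e
    have h1 := (hq (e, !c e)).1
    rw [htwo, htwo] at h1
    exact congrArg Prod.fst h1
  let τ : Perm E := ⟨τf, τf, hττ, hττ⟩
  have hτ : IsMatching τ := by
    refine ⟨hττ, fun e he => (hq (e, !c e)).2 ?_⟩
    rw [htwo, show (M.rot (e, !c e)).1 = e from he]
  have hopp : ∀ x, (M.opp x).2 = !x.2 := fun x => by rw [← hout, M.eulerian.out_opp, hout]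
  have hopp' : ∀ x, M.opp x = ((M.opp x).1, !x.2) := fun x => Prod.ext rfl (hopp x)
  have hσ : ∀ e b, (M.opp ((M.opp (e, b)).1, !b)).1 = e := by
    intro e b
    rw [← hopp' (e, b), M.opp_opp]
  let σ : Perm E := ⟨fun e => (M.opp (e, true)).1, fun e => (M.opp (e, false)).1,
    fun e => hσ e true, fun e => hσ e false⟩
  have hrot : rotOf τ c = M.rot := by
    refine Equiv.ext fun ⟨e, b⟩ => ?_
    by_cases hb : b = c e
    · rw [hb, rotOf_firstDart, hfirst]
    · rw [Bool.eq_not.2 hb, rotOf_lastDart, hlast]; rfl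
  have hoppOf : oppOf σ = M.opp := by
    refine Equiv.ext fun ⟨e, b⟩ => ?_
    rw [hopp']
    cases b <;> rfl
  have hroot : M.root = (M.root.1, true) := Prod.ext rfl (by rw [← hout, M.root_out])
  have hE : IsExplored (σ, τ, c) M.root.1 := by
    rw [isExplored_iff hn]
    refine ⟨hτ, ?_, ?_⟩
    · rw [isConnectedFrom_iff (c := c), hrot, hoppOf]
      exact M.connected
    · simp only [hrot, hoppOf]
      have h1 := M.numCycles_rot (n := n) (by simp [hn]; ring)
      have h2 := numCycles_mul_of_minimalPeriod (f := M.opp) (k := 2) fun d =>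
        (minimalPeriod_eq_two_iff _ d).2 ⟨M.opp_opp d, M.opp_ne d⟩
      have h3 := M.euler
      rw [Nat.card_eq_fintype_card, Fintype.card_prod, Fintype.card_bool, hn] at h2
      omega
  exact ⟨_, _, hE, RootedQuarticOrientation.ext_data hrot hoppOf (funext fun x => (hout x).symm)
    hroot.symm, hfc⟩

end MapOfExplored

/-! ### Comparison of the totals -/

section Totals

variable {E : Type} [Fintype E]

open Classical in
/-- The adapted orientations are in bijection with the explored loop systems. -/
theorem sum_isAdapted {K : Type*} [Field K] (a b : K)
    [Fintype (RootedQuarticOrientation (E × Bool))] {n : ℕ} (hn : Fintype.card E = 2 * n) :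
    ∑ p : RootedQuarticOrientation (E × Bool) × (E × Bool → Bool)
        with IsSplitting p.1 p.2 ∧ IsAdapted p.1 p.2 (Equiv.refl _), splitWeight a b p.1.out p.2 =
      ∑ r : E, ∑ s with IsExplored s r, weightOn a b Finset.univ s := by
  simp only [Finset.sum_filter]
  rw [← Fintype.sum_prod_type', ← Finset.sum_filter, ← Finset.sum_filter]
  symm
  refine Finset.sum_bij (fun x hx => ((Finset.mem_filter.1 hx).2.toOrientation hn,
    splittingOf x.2.2.2)) ?_ ?_ ?_ ?_
  · intro x hx
    have h := (Finset.mem_filter.1 hx).2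
    simp only [Finset.mem_filter, Finset.mem_univ, true_and]
    exact ⟨h.isSplitting hn, h.isAdapted hn⟩
  · rintro ⟨r, σ, τ, c⟩ hx ⟨r', σ', τ', c'⟩ hx' heq
    simp only [Prod.mk.injEq] at heq
    have hc : c = c' := by
      funext e
      have := congrFun heq.2 (e, true)
      simpa [splittingOf] using this
    subst hc
    have hr : r = r' := congrArg Prod.fst (congrArg RootedQuarticOrientation.root heq.1)
    have hσ : oppOf σ = oppOf σ' := congrArg (fun M => M.toPlanarMap.opp) heq.1
    have hτ : rotOf τ c = rotOf τ' c := congrArg (fun M => M.toPlanarMap.rot) heq.1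
    have hσ' : σ = σ' := Equiv.ext fun e =>
      congrArg Prod.fst (DFunLike.congr_fun hσ (e, true))
    have hτ' : τ = τ' := Equiv.ext fun e => by
      have := DFunLike.congr_fun hτ (e, !c e)
      rw [rotOf_lastDart, rotOf_lastDart] at this
      exact congrArg Prod.fst this
    subst hr hσ' hτ'
    rfl
  · rintro ⟨M, f⟩ hM
    simp only [Finset.mem_filter, Finset.mem_univ, true_and] at hM
    obtain ⟨s, r, h, h1, h2⟩ := exists_isExplored hn hM.1 hM.2
    exact ⟨(r, s), by simpa using h, by simp only [h1, h2]⟩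
  · intro x hx
    exact (splitWeight_splittingOf a b x.2).symm

-- The `2 * n` possible roots turn `(2 * n - 1)!` into `(2 * n)!`, which cancels against the
-- labellings of the arcs.
open Classical in
theorem sum_pow_numAlternating_eq {K : Type} [Field K] [CharZero K] {a b : K} (hab : a * b = 1)
    {w : ℕ → PowerSeries K} {h : ℕ → ℕ → PowerSeries K} (hs : IsCoeffSolution a b w h) {n : ℕ}
    (hn : n ≠ 0) {D : Type} [Fintype D] [Fintype (RootedQuarticOrientation D)]
    (hE : Fintype.card E = 2 * n) (hD : Fintype.card D = 4 * n) :
    ∑ M : RootedQuarticOrientation D, (a ^ 2 + b ^ 2) ^ M.numAlternating =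
      (4 * n).factorial * (h 0 0 - 1).coeff n := by
  have := Fintype.ofFinite (RootedQuarticOrientation (E × Bool))
  have h2 := factorial_mul_sum_splitWeight (E := E) (D := D) a b (by rw [hE, hD]; ring)
  rw [sum_isAdapted a b hE, hE, hD] at h2
  simp only [sum_isExplored hs hE, Finset.sum_const, Finset.card_univ, hE, nsmul_eq_mul] at h2
  have h3 : ∑ p : RootedQuarticOrientation D × (D → Bool)
        with IsSplitting p.1 p.2, splitWeight a b p.1.out p.2 =
      ∑ M : RootedQuarticOrientation D, (a ^ 2 + b ^ 2) ^ M.numAlternating := by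
    rw [Finset.sum_filter, Fintype.sum_prod_type]
    refine Finset.sum_congr rfl fun M _ => ?_
    rw [← Finset.sum_filter, sum_splitWeight hab]
  rw [h3, ← mul_assoc (((2 * n : ℕ)) : K), ← Nat.cast_mul,
    Nat.mul_factorial_pred (by omega)] at h2
  have hf2 : (((2 * n).factorial : ℕ) : K) ≠ 0 := Nat.cast_ne_zero.2 (Nat.factorial_ne_zero _)
  refine mul_left_cancel₀ hf2 (h2.trans ?_)
  ring

end Totals

/-- The generating polynomial of orientations with `n` vertices, as a coefficient of `h 0 0`. -/
theorem sum_count_mul_pow {K : Type} [Field K] [CharZero K] {a b : K} (hab : a * b = 1)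
    {w : ℕ → PowerSeries K} {h : ℕ → ℕ → PowerSeries K} (hs : IsCoeffSolution a b w h) {n : ℕ}
    (hn : n ≠ 0) : ∑ k ∈ Finset.range (n + 1),
      (RootedQuarticOrientation.count n k : K) * (a ^ 2 + b ^ 2) ^ k =
      (h 0 0 - 1).coeff n := by
  have := Fintype.ofFinite (RootedQuarticOrientation (Fin (4 * n)))
  have hf4 : (((4 * n).factorial : ℕ) : K) ≠ 0 := Nat.cast_ne_zero.2 (Nat.factorial_ne_zero _)
  refine mul_left_cancel₀ hf4 ?_
  rw [← RootedQuarticOrientation.sum_pow_numAlternating, sum_pow_numAlternating_eq hab hs hn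
    (Fintype.card_fin (2 * n)) (Fintype.card_fin _)]

theorem count_zero (k : ℕ) : RootedQuarticOrientation.count 0 k = 0 := by
  have : IsEmpty (RootedQuarticOrientation (Fin (4 * 0))) := ⟨fun M => Fin.elim0 M.root⟩
  rw [RootedQuarticOrientation.count]
  exact Nat.card_of_isEmpty

/-- In degree `0` there is no rooted map, and `h 0 0 - 1 = a * h 0 1 + b * h 1 0` has no constant
term. -/
theorem IsSolution.qseriesAt_eq {W : RingX} {H : RingXY} (hs : IsSolution W H) :
    QseriesAt (om ^ 2 + (om⁻¹) ^ 2) = substXY H (0 : Kω) 0 - 1 := by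
  have hc := (isSolution_iff W H).1 hs
  have hom : om ≠ 0 := RatFunc.X_ne_zero
  rw [substXY_zero_zero]
  ext n
  rw [QseriesAt, Qseries, PowerSeries.coeff_map, PowerSeries.coeff_mk, map_sum]
  simp only [Polynomial.coe_eval₂RingHom, Polynomial.eval₂_monomial, Nat.coe_castRingHom]
  rcases eq_or_ne n 0 with rfl | hn
  · simp only [count_zero, Nat.cast_zero, zero_mul, Finset.sum_const_zero]
    have hh : coeffXY H 0 0 - 1 =
        PowerSeries.C om * coeffXY H 0 1 + PowerSeries.C om⁻¹ * coeffXY H 1 0 := by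
      rw [hc.h_eq 0 0, hc.w_zero]; ring
    rw [hh, map_add, PowerSeries.coeff_C_mul, PowerSeries.coeff_C_mul,
      hc.halfOrderGE_h 0 1 0 (by norm_num), hc.halfOrderGE_h 1 0 0 (by norm_num)]
    simp
  · exact sum_count_mul_pow (mul_inv_cancel₀ hom) hc hn

theorem mainTheorem4 :
    (∃! p : RingX × RingXY, IsSolution p.1 p.2) ∧
    ∀ (W : RingX) (H : RingXY), IsSolution W H →
      QseriesAt (om ^ 2 + (om⁻¹) ^ 2) = substXY H (0 : Kω) 0 - 1 ∧
      ((substXY H (0 : Kω) 0 - 1 : PowerSeries Kω) : LaurentSeries Kω) =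
        (coeffX1 W : LaurentSeries Kω) /
          (((PowerSeries.X : PowerSeries Kω) : LaurentSeries Kω) *
            ((PowerSeries.C (om + om⁻¹) : PowerSeries Kω) : LaurentSeries Kω)) - 1 :=
  ⟨existsUnique_isSolution, fun _ _ hs => ⟨hs.qseriesAt_eq, hs.substXY_zero_eq⟩⟩
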